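/- Let $T>0$ and let $u$ be a weak solution on $[0,T]\times\mathbb{R}^3$ of the incompressible Euler equations $$\partial_t u+u\cdot\nabla u+\nabla\Pi=0,\qquad \operatorname{div}u=0,\qquad u|_{t=0}=u_0\in L^2(\mathbb{R}^3),$$ that is: $u\in C_w([0,T];L^2(\mathbb{R}^3)^3)$ (weakly continuous in time), $u(0)=u_0$, $\operatorname{div}u(t)=0$ in the sense of distributions for every $t\in[0,T]$, and $$\int_{\mathbb{R}^3}u(t)\cdot\psi(t)\,dx-\int_{\mathbb{R}^3}u_0\cdot\psi(0)\,dx=\int_0^t\!\!\int_{\mathbb{R}^3}\bigl(u\cdot\partial_s\psi+(u\otimes u):\nabla\psi\bigr)\,dx\,ds$$ for every $t\in[0,T]$ and every $\psi\in C_c^\infty(\mathbb{R}\times\mathbb{R}^3;\mathbb{R}^3)$ with $\operatorname{div}_x\psi=0$. Let $\varrho,\varphi\in C^\infty(\mathbb{R}^3)$ be nonnegative radial functions supported in $\{|\xi|\le 4/3\}$ and $\{3/4\le|\xi|\le 8/3\}$ with $\varrho(\xi)+\sum_{j\ge0}\varphi(2^{-j}\xi)=1$ for all $\xi$ and $\sum_{j\in\mathbb{Z}}\varphi(2^{-j}\xi)=1$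 for all $\xi\ne0$; put $\Delta_jf=0$ for $j\le-2$, $\Delta_{-1}f=\varrho(D)f$ and $\Delta_jf=\varphi(2^{-j}D)f$ for $j\ge0$. Let $B^\alpha_{q,\infty}(\mathbb{R}^3)$ be the space of tempered distributions $f$ with $\|f\|_{B^\alpha_{q,\infty}}=\sup_{j}2^{j\alpha}\|\Delta_jf\|_{L^q}<\infty$, and let $B^\alpha_{q,c(\mathbb{N})}(\mathbb{R}^3)$ be the subspace, with the same norm, of those $f$ for which moreover $\lim_{j\to\infty}2^{j\alpha}\|\Delta_jf\|_{L^q}=0$. For a space $X$ of tempered distributions with norm $\|\cdot\|_X$, $L^p(0,T;X)$ is the set of measurable $f$ on $(0,T)$ with values in $X$ (for almost every time) and $\|f\|_X\in L^p(0,T)$. Let $p_1,p_2,p_3\in(1,3]$ and suppose that $$u_1\in L^{p_1}\bigl(0,T;B^{1/p_1}_{\frac{2p_1}{p_1-1},c(\mathbb{N})}(\mathbb{R}^3)\bigr),\quad u_2\in L^{p_2}\bigl(0,T;B^{1/p_2}_{\frac{2p_2}{p_2-1},c(\mathbb{N})}(\mathbb{R}^3)\bigr),\quad u_3\in L^{p_3}\bigl(0,T;B^{1/p_3}_{\frac{2p_3}{p_3-1},\infty}(\mathbb{R}^3)\bigr).$$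 Then the kinetic energy is conserved: for every $t\in[0,T]$, $$\frac12\int_{\mathbb{R}^3}|u(x,t)|^2\,dx=\frac12\int_{\mathbb{R}^3}|u_0(x)|^2\,dx.$$ -/

import Mathlib

open MeasureTheory Set Filter Topology
open scoped ENNReal ContDiff SchwartzMap

noncomputable section

namespace EulerEnergy

/-- Three-dimensional Euclidean space. -/
abbrev E3 : Type := EuclideanSpace ℝ (Fin 3)

/-- The space of square integrable vector fields on `ℝ³`. -/
abbrev L2Field : Type := Lp E3 2 (volume : Measure E3)

/-! ### Weak solutions of the incompressible Euler equations -/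

/-- Divergence of a differentiable vector field. -/
def divergence (ψ : E3 → E3) (x : E3) : ℝ :=
  ∑ i : Fin 3, (fderiv ℝ ψ x (EuclideanSpace.single i 1)) i

/-- `u` is a weak solution on `[0, T] × ℝ³` of
`∂ₜ u + u · ∇ u + ∇ Π = 0`, `div u = 0`, `u|_{t = 0} = u₀`: it is weakly continuous from `[0, T]`
to `L²`, divergence free in the sense of distributions, and satisfies the momentum equation tested
against divergence-free test functions (so that the pressure drops out).
Values `u t` with `t ∉ [0, T]` play no role. -/
structure IsWeakSolution (T : ℝ) (u₀ : L2Field) (u : ℝ → L2Field) : Prop where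
  initial : u 0 = u₀
  weaklyContinuous : ∀ g : L2Field, ContinuousOn (fun t => inner ℝ (u t) g) (Icc 0 T)
  divFree : ∀ t ∈ Icc 0 T, ∀ φ : E3 → ℝ, ContDiff ℝ ∞ φ → HasCompactSupport φ →
    ∫ x, fderiv ℝ φ x (u t x) = 0
  /-- `∫ u(t)·ψ(t) - ∫ u₀·ψ(0) = ∫₀ᵗ ∫ (u · ∂ₛψ + (u ⊗ u) : ∇ψ) dx ds`. -/
  momentum : ∀ ψ : ℝ → E3 → E3, ContDiff ℝ ∞ (Function.uncurry ψ) →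
    HasCompactSupport (Function.uncurry ψ) → (∀ t x, divergence (ψ t) x = 0) →
    ∀ t ∈ Icc 0 T,
      (∫ x, inner ℝ (u t x) (ψ t x)) - ∫ x, inner ℝ (u₀ x) (ψ 0 x) =
        ∫ s in (0 : ℝ)..t, ∫ x, (inner ℝ (u s x) (deriv (fun r => ψ r x) s)
          + inner ℝ (u s x) (fderiv ℝ (ψ s) x (u s x)))

/-- The `i`-th component of a square integrable vector field, as a tempered distribution. -/
def component (v : L2Field) (i : Fin 3) : 𝓢'(E3, ℂ) :=
  Lp.toTemperedDistribution
    ((Complex.ofRealCLM ∘L (EuclideanSpace.proj i : E3 →L[ℝ] ℝ)).compLp v)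

/-! ### Littlewood–Paley decomposition and Besov spaces -/

/-- A dyadic partition of unity on the frequency space `ℝ³`. -/
structure DyadicPartition where
  /-- the low frequency cut-off `ϱ` -/
  low : E3 → ℝ
  /-- the shell cut-off `φ` -/
  shell : E3 → ℝ
  low_smooth : ContDiff ℝ ∞ low
  shell_smooth : ContDiff ℝ ∞ shell
  low_nonneg : ∀ ξ, 0 ≤ low ξ
  shell_nonneg : ∀ ξ, 0 ≤ shell ξ
  low_radial : ∀ ξ η, ‖ξ‖ = ‖η‖ → low ξ = low η
  shell_radial : ∀ ξ η, ‖ξ‖ = ‖η‖ → shell ξ = shell η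
  low_support : ∀ ξ, low ξ ≠ 0 → ‖ξ‖ ≤ 4 / 3
  shell_support : ∀ ξ, shell ξ ≠ 0 → 3 / 4 ≤ ‖ξ‖ ∧ ‖ξ‖ ≤ 8 / 3
  /-- `ϱ(ξ) + ∑_{j ≥ 0} φ(2^{-j} ξ) = 1` for every `ξ` -/
  hasSum_nat : ∀ ξ, HasSum (fun j : ℕ => shell ((2 : ℝ) ^ (-(j : ℤ)) • ξ)) (1 - low ξ)
  /-- `∑_{j ∈ ℤ} φ(2^{-j} ξ) = 1` for every `ξ ≠ 0` -/
  hasSum_int : ∀ ξ, ξ ≠ 0 → HasSum (fun j : ℤ => shell ((2 : ℝ) ^ (-j) • ξ)) 1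

/-- A profile for a dyadic partition of unity. -/
def lowProfile (r : ℝ) : ℝ := Real.smoothTransition ((16 - 9 * r ^ 2) / 7)

/-- Dyadic partitions of unity exist. -/
instance : Nonempty DyadicPartition := by
  have anti : ∀ ⦃r s : ℝ⦄, 0 ≤ r → r ≤ s → lowProfile s ≤ lowProfile r := by
    intro r s hr hs
    apply Real.smoothTransition.monotone
    have : r ^ 2 ≤ s ^ 2 := by gcongr
    linarith
  have one : ∀ r : ℝ, 0 ≤ r → r ≤ 3 / 4 → lowProfile r = 1 := by
    intro r h0 h
    apply Real.smoothTransition.one_of_one_le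
    nlinarith
  have zero : ∀ r : ℝ, 4 / 3 ≤ r → lowProfile r = 0 := by
    intro r h
    apply Real.smoothTransition.zero_of_nonpos
    nlinarith
  have smooth : ContDiff ℝ ∞ (fun ξ : E3 => lowProfile ‖ξ‖) := by
    unfold lowProfile
    exact Real.smoothTransition.contDiff.comp
      ((contDiff_const.sub (contDiff_const.mul (contDiff_norm_sq ℝ))).div_const 7)
  have scale : ∀ (k : ℤ) (ξ : E3), lowProfile ‖(1 / 2 : ℝ) • (2 : ℝ) ^ (-k) • ξ‖
      = lowProfile ((2 : ℝ) ^ (-(k + 1)) * ‖ξ‖) := by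
    intro k ξ
    rw [norm_smul, norm_smul, ← mul_assoc, neg_add, zpow_add₀ (by norm_num : (2 : ℝ) ≠ 0)]
    simp [mul_comm]
  have scale' : ∀ (k : ℤ) (ξ : E3), lowProfile ‖(2 : ℝ) ^ (-k) • ξ‖
      = lowProfile ((2 : ℝ) ^ (-k) * ‖ξ‖) := by
    intro k ξ
    rw [norm_smul]; simp
  have nonneg : ∀ ξ : E3, 0 ≤ lowProfile ‖(1 / 2 : ℝ) • ξ‖ - lowProfile ‖ξ‖ := by
    intro ξ
    refine sub_nonneg.2 (anti (norm_nonneg _) ?_)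
    rw [norm_smul]
    have := norm_nonneg ξ
    norm_num; linarith
  have lim : ∀ ξ : E3, Tendsto (fun n : ℕ => lowProfile ((2 : ℝ) ^ (-(n : ℤ)) * ‖ξ‖)) atTop
      (𝓝 1) := by
    intro ξ
    have h : Tendsto (fun n : ℕ => (2 : ℝ) ^ (-(n : ℤ)) * ‖ξ‖) atTop (𝓝 (0 * ‖ξ‖)) := by
      refine Tendsto.mul_const _ ?_
      have := tendsto_pow_atTop_nhds_zero_of_lt_one (r := (1 / 2 : ℝ)) (by norm_num) (by norm_num)
      simpa [zpow_neg] using this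
    rw [zero_mul] at h
    refine tendsto_const_nhds.congr' ?_
    filter_upwards [h.eventually (gt_mem_nhds (by norm_num : (0 : ℝ) < 3 / 4))] with n hn
    exact (one _ (by positivity) hn.le).symm
  have lim' : ∀ ξ : E3, ξ ≠ 0 → Tendsto (fun n : ℕ => lowProfile ((2 : ℝ) ^ (n : ℤ) * ‖ξ‖)) atTop
      (𝓝 0) := by
    intro ξ hξ
    have h : Tendsto (fun n : ℕ => (2 : ℝ) ^ (n : ℤ) * ‖ξ‖) atTop atTop := by
      refine Tendsto.atTop_mul_const (norm_pos_iff.2 hξ) ?_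
      simpa using tendsto_pow_atTop_atTop_of_one_lt (r := (2 : ℝ)) (by norm_num)
    refine tendsto_const_nhds.congr' ?_
    filter_upwards [h.eventually (eventually_ge_atTop (4 / 3))] with n hn
    exact (zero _ hn).symm
  have sumNat : ∀ ξ : E3, HasSum (fun j : ℕ => lowProfile ‖(1 / 2 : ℝ) • (2 : ℝ) ^ (-(j : ℤ)) • ξ‖
      - lowProfile ‖(2 : ℝ) ^ (-(j : ℤ)) • ξ‖) (1 - lowProfile ‖ξ‖) := by
    intro ξ
    rw [hasSum_iff_tendsto_nat_of_nonneg (fun j => nonneg _)]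
    have h : ∀ n : ℕ, ∑ j ∈ Finset.range n, (lowProfile ‖(1 / 2 : ℝ) • (2 : ℝ) ^ (-(j : ℤ)) • ξ‖
      - lowProfile ‖(2 : ℝ) ^ (-(j : ℤ)) • ξ‖)
      = lowProfile ((2 : ℝ) ^ (-(n : ℤ)) * ‖ξ‖) - lowProfile ‖ξ‖ := by
      intro n
      have := Finset.sum_range_sub (fun n : ℕ => lowProfile ((2 : ℝ) ^ (-(n : ℤ)) * ‖ξ‖)) n
      simp only [scale, scale']
      simpa using this
    simp only [h]
    exact (lim ξ).sub_const _
  refine ⟨{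
    low := fun ξ => lowProfile ‖ξ‖
    shell := fun ξ => lowProfile ‖(1 / 2 : ℝ) • ξ‖ - lowProfile ‖ξ‖
    low_smooth := smooth
    shell_smooth := (smooth.comp (contDiff_const_smul (1 / 2 : ℝ))).sub smooth
    low_nonneg := fun ξ => Real.smoothTransition.nonneg _
    shell_nonneg := nonneg
    low_radial := fun ξ η h => by simp only [h]
    shell_radial := fun ξ η h => by simp only [norm_smul, h]
    low_support := fun ξ h => ?_
    shell_support := fun ξ h => ⟨?_, ?_⟩
    hasSum_nat := sumNat
    hasSum_int := fun ξ hξ => ?_ }⟩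
  · by_contra! hc
    exact h (zero _ hc.le)
  · by_contra! hc
    refine h ?_
    have h0 := norm_nonneg ξ
    rw [norm_smul, one _ (by positivity) (by norm_num; linarith), one _ h0 hc.le, sub_self]
  · by_contra! hc
    refine h ?_
    rw [norm_smul, zero _ (by norm_num; linarith), zero _ (by linarith), sub_self]
  · have neg : HasSum (fun j : ℕ => lowProfile ‖(1 / 2 : ℝ) • (2 : ℝ) ^ (-(-((j : ℤ) + 1))) • ξ‖
        - lowProfile ‖(2 : ℝ) ^ (-(-((j : ℤ) + 1))) • ξ‖) (lowProfile ‖ξ‖) := by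
      rw [hasSum_iff_tendsto_nat_of_nonneg (fun j => nonneg _)]
      have h : ∀ n : ℕ, ∑ j ∈ Finset.range n,
          (lowProfile ‖(1 / 2 : ℝ) • (2 : ℝ) ^ (-(-((j : ℤ) + 1))) • ξ‖
            - lowProfile ‖(2 : ℝ) ^ (-(-((j : ℤ) + 1))) • ξ‖)
          = lowProfile ‖ξ‖ - lowProfile ((2 : ℝ) ^ (n : ℤ) * ‖ξ‖) := by
        intro n
        have := Finset.sum_range_sub' (fun n : ℕ => lowProfile ((2 : ℝ) ^ (n : ℤ) * ‖ξ‖)) n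
        simp only [scale, scale']
        simpa using this
      simp only [h]
      simpa using (lim' ξ hξ).const_sub (lowProfile ‖ξ‖)
    have := HasSum.of_nat_of_neg_add_one (f := fun j : ℤ =>
      lowProfile ‖(1 / 2 : ℝ) • (2 : ℝ) ^ (-j) • ξ‖ - lowProfile ‖(2 : ℝ) ^ (-j) • ξ‖)
      (sumNat ξ) neg
    simpa using this

/-- The inhomogeneous dyadic block `Δ_j`: it is `0` for `j ≤ -2`, `ϱ(D)` for `j = -1` and
`φ(2^{-j} D)` for `j ≥ 0`. -/
def block (P : DyadicPartition) (j : ℤ) (f : 𝓢'(E3, ℂ)) : 𝓢'(E3, ℂ) :=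
  if j ≤ -2 then 0
  else if j = -1 then
    TemperedDistribution.fourierMultiplierCLM ℂ (fun ξ => (P.low ξ : ℂ)) f
  else
    TemperedDistribution.fourierMultiplierCLM ℂ (fun ξ => (P.shell ((2 : ℝ) ^ (-j) • ξ) : ℂ)) f

/-- The `L^q` norm (`1 ≤ q ≤ ∞`) of a tempered distribution: the `L^q` norm of the (a.e. unique)
`L^q` function that represents it, and `∞` if there is none. -/
def distLpNorm (q : ℝ≥0∞) (f : 𝓢'(E3, ℂ)) : ℝ≥0∞ :=
  ⨅ (g : E3 → ℂ) (_ : MemLp g q volume) (_ : ∀ θ : 𝓢(E3, ℂ), f θ = ∫ x, θ x * g x),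
    eLpNorm g q volume

/-- The norm of the inhomogeneous Besov space `B^α_{q,∞}(ℝ³)`. -/
def besovNorm (P : DyadicPartition) (α : ℝ) (q : ℝ≥0∞) (f : 𝓢'(E3, ℂ)) : ℝ≥0∞ :=
  ⨆ j : ℤ, (2 : ℝ≥0∞) ^ ((j : ℝ) * α) * distLpNorm q (block P j f)

/-- The Besov space `B^α_{q,∞}(ℝ³)`. -/
def besovInfty (P : DyadicPartition) (α : ℝ) (q : ℝ≥0∞) : Set (𝓢'(E3, ℂ)) :=
  {f | besovNorm P α q f < ⊤}

/-- The space `B^α_{q,c(ℕ)}(ℝ³)`, a subspace of `B^α_{q,∞}(ℝ³)` with the same norm. -/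
def besovC (P : DyadicPartition) (α : ℝ) (q : ℝ≥0∞) : Set (𝓢'(E3, ℂ)) :=
  {f | besovNorm P α q f < ⊤ ∧
    Tendsto (fun j : ℤ => (2 : ℝ≥0∞) ^ ((j : ℝ) * α) * distLpNorm q (block P j f)) atTop (𝓝 0)}

/-- `f ∈ L^p(0, T; X)`, where `X` is a space of tempered distributions with norm `N`: `f` is
measurable (as a map into tempered distributions), takes values in `X` for almost every time,
and `t ↦ N (f t)` lies in `L^p(0, T)`. -/
def MemLpTime (p T : ℝ) (X : Set (𝓢'(E3, ℂ))) (N : 𝓢'(E3, ℂ) → ℝ≥0∞)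
    (f : ℝ → 𝓢'(E3, ℂ)) : Prop :=
  (∀ θ : 𝓢(E3, ℂ), AEMeasurable (fun t => f t θ) (volume.restrict (Ioo 0 T))) ∧
  (∀ᵐ t ∂(volume.restrict (Ioo 0 T)), f t ∈ X) ∧
  MemLp (fun t => N (f t)) (ENNReal.ofReal p) (volume.restrict (Ioo 0 T))

end EulerEnergy

end

/-! The proof is the commutator argument of Constantin, E and Titi, arranged so that one component
may have weaker regularity. Mollifying in space with an even kernel `k` at scale `2 ^ (-n)` gives `w
= k ⋆ u`, and `‖w‖²` changes in time by twice the integral of the flux `∫ (u ⊗ u) : ∇(k ⋆ w)`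
(`IsWeakSolution.energy_balance`). Energy is conserved once these fluxes tend to zero in `L¹(0, T)`.

Moving one mollifier onto `u ⊗ u` and subtracting `∫ (w ⊗ w) : ∇w = 0`, which holds since `div w =
0`, leaves `∑ ∫ R_ij ∂_i w_j` with `R_ij = k ⋆ (u_i u_j) - w_i w_j`
(`sum_flux_eq_integral_covariance`). This `R_ij` is a local covariance, hence quadratic in
increments of `u` over distances at most `2 ^ (1 - n)`, while `∂_i w_j` costs `2 ^ n` times one
increment. If increments of `u_i` have `L³` size `2 ^ (-n/3) m_i`, the powers of two cancel and each
term is bounded by `m_i m_j m_j`.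

Because `∑ ∂_i w_i = 0`, the entry `R_22` can be subtracted from the whole diagonal of `R`. The term
built from component 2 alone disappears, and every remaining product contains `m_0` or `m_1`
(`exists_enorm_integral_covariance_le`). So `m_0` and `m_1` must tend to zero, but `m_2` need only
be bounded.

The Besov hypotheses enter by interpolating `L³` between `L²` and `L^q`, `q = 2p/(p-1)`: `2^(j/3)
‖Δ_j f‖_3 ≤ ‖f‖_2^(1-p/3) (2^(j/p) ‖Δ_j f‖_q)^(p/3)` (`besovCoeff_le`). Decay or boundedness of
these coefficients passes to the moduli `m_i` (`modulus_le_tsum`). As the `L²` norm is bounded in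
time, the cubes `m_i³` are dominated by `p`-th powers of Besov norms, integrable in time, and
dominated convergence finishes the proof.

Testing the equation with the mollified solution, which need not have compact support, requires
density of divergence-free test fields (`divFreeL2_le_closure`). This is reduced to Liouville's
theorem for square integrable harmonic functions. -/

noncomputable section

namespace EulerEnergy

/-! ### Young's inequality and convolution operators on `L²` -/

section Young

/-- Jensen's inequality for weighted integrals. -/
theorem rpow_lintegral_mul_le {p : ℝ} (hp : 1 ≤ p) {k a : E3 → ℝ≥0∞}
    (hk : Measurable k) (ha : AEMeasurable a) :
    (∫⁻ y, k y * a y) ^ p ≤ (∫⁻ y, k y) ^ (p - 1) * ∫⁻ y, k y * a y ^ p := by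
  have hp0 : 0 < p := by linarith
  -- Comparison of the `L¹` and `L^p` norms for the measure with density `k`; its total mass
  -- produces the factor `(∫ k)^(p-1)`.
  have h := eLpNorm'_le_eLpNorm'_mul_rpow_measure_univ (μ := volume.withDensity k)
    one_pos hp (ha.mono_ac (withDensity_absolutelyContinuous _ _)).aestronglyMeasurable
  simp only [eLpNorm', enorm_eq_self, ENNReal.rpow_one, one_div_one,
    withDensity_apply _ MeasurableSet.univ, Measure.restrict_univ] at h
  rw [lintegral_withDensity_eq_lintegral_mul₀ hk.aemeasurable ha,
    lintegral_withDensity_eq_lintegral_mul₀ hk.aemeasurable (ha.pow_const p)] at h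
  simp only [Pi.mul_apply] at h
  calc _ ≤ _ := ENNReal.rpow_le_rpow h hp0.le
    _ = _ := by
      rw [ENNReal.mul_rpow_of_nonneg _ _ hp0.le, ← ENNReal.rpow_mul, ← ENNReal.rpow_mul,
        one_div_mul_cancel hp0.ne', ENNReal.rpow_one, mul_comm]
      congr 2
      field_simp

/-- Minkowski's integral inequality for weighted integrals. -/
theorem lintegral_rpow_lintegral_mul_le {p : ℝ} (hp : 1 ≤ p) {k : E3 → ℝ≥0∞} (hk : Measurable k)
    (hk' : ∫⁻ y, k y ≠ ⊤) {a : E3 × E3 → ℝ≥0∞} (ha : AEMeasurable a (volume.prod volume))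
    {A : ℝ≥0∞} (hA : ∀ y, k y ≠ 0 → ∫⁻ x, a (x, y) ^ p ≤ A) :
    ∫⁻ x, (∫⁻ y, k y * a (x, y)) ^ p ≤ (∫⁻ y, k y) ^ p * A := by
  have hp0 : 0 < p := by linarith
  have hm : AEMeasurable (fun z : E3 × E3 => k z.2 * a z ^ p) (volume.prod volume) :=
    (hk.comp measurable_snd).aemeasurable.mul (ha.pow_const p)
  calc _ ≤ ∫⁻ x, (∫⁻ y, k y) ^ (p - 1) * ∫⁻ y, k y * a (x, y) ^ p := by
        refine lintegral_mono_ae ?_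
        filter_upwards [ha.aestronglyMeasurable.prodMk_left] with x hx
        exact rpow_lintegral_mul_le hp hk hx.aemeasurable
    _ = (∫⁻ y, k y) ^ (p - 1) * ∫⁻ y, ∫⁻ x, k y * a (x, y) ^ p := by
      rw [lintegral_const_mul'' _ hm.lintegral_prod_right', lintegral_lintegral_swap hm]
    _ ≤ (∫⁻ y, k y) ^ (p - 1) * ∫⁻ y, k y * A := by
      refine mul_le_mul_right (lintegral_mono_ae ?_) _
      filter_upwards [ae_lt_top hk hk'] with y hy
      rw [lintegral_const_mul' _ _ hy.ne]
      -- The slice bound is only assumed where the weight is nonzero, so a kernel supported in a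
      -- small ball only sees small shifts.
      rcases eq_or_ne (k y) 0 with h0 | h0
      · simp [h0]
      · exact mul_le_mul_right (hA y h0) _
    _ = _ := by
      rw [lintegral_mul_const _ hk, ← mul_assoc]
      congr 1
      rcases eq_or_ne (∫⁻ y, k y) 0 with h0 | h0
      · rw [h0, mul_zero, ENNReal.zero_rpow_of_pos hp0]
      · nth_rw 2 [← ENNReal.rpow_one (∫⁻ y, k y)]
        rw [← ENNReal.rpow_add _ _ h0 hk', sub_add_cancel]

/-- Young's inequality `L¹ * L^p ⊆ L^p` for nonnegative functions. -/
theorem lintegral_convolution_rpow_le {p : ℝ} (hp : 1 ≤ p) {k f : E3 → ℝ≥0∞}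
    (hk : Measurable k) (hk' : ∫⁻ y, k y ≠ ⊤) (hf : Measurable f) :
    ∫⁻ x, (∫⁻ y, k y * f (x - y)) ^ p ≤ (∫⁻ y, k y) ^ p * ∫⁻ x, f x ^ p :=
  lintegral_rpow_lintegral_mul_le hp hk hk' (a := fun z => f (z.1 - z.2))
    (hf.comp (measurable_fst.sub measurable_snd)).aemeasurable
    fun y _ => (lintegral_sub_right_eq_self (fun x => f x ^ p) y).le

variable {𝕜 : Type*} [RCLike 𝕜] {F : Type*} [NormedAddCommGroup F]

open ContinuousLinearMap (lsmul)

open scoped Convolution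

/-- Young's inequality with the absolute values inside the convolution integral. -/
theorem lintegral_enorm_convolution_rpow_le {p : ℝ≥0∞} (hp : 1 ≤ p) (hp' : p ≠ ⊤)
    {k : E3 → 𝕜} (hk : Integrable k) {f : E3 → F} (hf : AEStronglyMeasurable f) :
    ∫⁻ x, (∫⁻ y, ‖k y‖ₑ * ‖f (x - y)‖ₑ) ^ p.toReal ≤
      ((∫⁻ y, ‖k y‖ₑ) * eLpNorm f p) ^ p.toReal := by
  have hp1 : 1 ≤ p.toReal := by
    rw [← ENNReal.toReal_one]
    exact (ENNReal.toReal_le_toReal ENNReal.one_ne_top hp').2 hp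
  obtain ⟨k', hk'm, hk'⟩ := hk.1.enorm
  obtain ⟨f', hf'm, hf'⟩ := hf.enorm
  have h1 : ∀ x, ∫⁻ y, ‖k y‖ₑ * ‖f (x - y)‖ₑ = ∫⁻ y, k' y * f' (x - y) := by
    intro x
    refine lintegral_congr_ae ?_
    filter_upwards [hk', (quasiMeasurePreserving_sub_left volume x).ae hf'] with y h h'
    rw [h, h']
  have h2 : ∫⁻ y, ‖k y‖ₑ = ∫⁻ y, k' y := lintegral_congr_ae hk'
  have h3 : ∫⁻ y, ‖f y‖ₑ ^ p.toReal = ∫⁻ y, f' y ^ p.toReal :=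
    lintegral_congr_ae (hf'.mono fun y h => by simp only [h])
  have hp0 : p ≠ 0 := (one_pos.trans_le hp).ne'
  rw [eLpNorm_eq_lintegral_rpow_enorm_toReal hp0 hp', h3, h2,
    ENNReal.mul_rpow_of_nonneg _ _ (by positivity), ← ENNReal.rpow_mul,
    one_div_mul_cancel (by positivity), ENNReal.rpow_one]
  simp only [h1]
  exact lintegral_convolution_rpow_le hp1 hk'm (h2 ▸ hk.2.ne) hf'm

variable [NormedSpace 𝕜 F]

/-- By Young's inequality the absolute convolution integral is in `L^p`, hence finite almost
everywhere. Additivity of convolution on `L²` classes rests on this. -/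
theorem ae_convolutionExistsAt {p : ℝ≥0∞} (hp : 1 ≤ p) (hp' : p ≠ ⊤)
    {k : E3 → 𝕜} (hk : Integrable k) {f : E3 → F} (hf : MemLp f p) :
    ∀ᵐ x, ConvolutionExistsAt k f x (lsmul 𝕜 𝕜) volume := by
  have hp1 : 0 < p.toReal := ENNReal.toReal_pos (one_pos.trans_le hp).ne' hp'
  have h := lintegral_enorm_convolution_rpow_le hp hp' hk hf.1
  have hm : AEStronglyMeasurable (fun z : E3 × E3 => lsmul 𝕜 𝕜 (k z.2) (f (z.1 - z.2)))
      (volume.prod volume) := hk.1.convolution_integrand (lsmul 𝕜 𝕜) hf.1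
  have hm' : AEMeasurable (fun x => (∫⁻ y, ‖k y‖ₑ * ‖f (x - y)‖ₑ) ^ p.toReal) volume := by
    have := hm.enorm.lintegral_prod_right'
    simp only [ContinuousLinearMap.lsmul_apply, enorm_smul] at this
    exact this.pow_const _
  have hfin : ∫⁻ x, (∫⁻ y, ‖k y‖ₑ * ‖f (x - y)‖ₑ) ^ p.toReal ≠ ⊤ :=
    (h.trans_lt (ENNReal.rpow_lt_top_of_nonneg hp1.le
      (ENNReal.mul_ne_top hk.2.ne hf.2.ne))).ne
  filter_upwards [ae_lt_top' hm' hfin, hm.prodMk_left] with x hx hx'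
  refine ⟨hx', ?_⟩
  have := (ENNReal.rpow_lt_top_iff_of_pos hp1).1 hx
  simpa only [HasFiniteIntegral, ContinuousLinearMap.lsmul_apply, enorm_smul] using this

variable [NormedSpace ℝ F]

theorem aestronglyMeasurable_convolution {k : E3 → 𝕜} (hk : AEStronglyMeasurable k)
    {f : E3 → F} (hf : AEStronglyMeasurable f) :
    AEStronglyMeasurable (k ⋆[lsmul 𝕜 𝕜] f) :=
  (hk.convolution_integrand (lsmul 𝕜 𝕜) hf).integral_prod_right'

theorem enorm_convolution_le (k : E3 → 𝕜) (f : E3 → F) (x : E3) :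
    ‖(k ⋆[lsmul 𝕜 𝕜] f) x‖ₑ ≤ ∫⁻ y, ‖k y‖ₑ * ‖f (x - y)‖ₑ := by
  refine (enorm_integral_le_lintegral_enorm _).trans_eq ?_
  simp [enorm_smul]

/-- Young's inequality. -/
theorem eLpNorm_convolution_le {p : ℝ≥0∞} (hp : 1 ≤ p) (hp' : p ≠ ⊤)
    {k : E3 → 𝕜} (hk : Integrable k) {f : E3 → F} (hf : AEStronglyMeasurable f) :
    eLpNorm (k ⋆[lsmul 𝕜 𝕜] f) p ≤ (∫⁻ y, ‖k y‖ₑ) * eLpNorm f p := by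
  have hp0 : p ≠ 0 := (one_pos.trans_le hp).ne'
  have hp1 : 0 < p.toReal := ENNReal.toReal_pos hp0 hp'
  rw [eLpNorm_eq_lintegral_rpow_enorm_toReal hp0 hp', one_div, ENNReal.rpow_inv_le_iff hp1]
  refine le_trans (lintegral_mono fun x => ?_) (lintegral_enorm_convolution_rpow_le hp hp' hk hf)
  exact ENNReal.rpow_le_rpow (enorm_convolution_le k f x) hp1.le

theorem MemLp.convolution_left {p : ℝ≥0∞} (hp : 1 ≤ p) (hp' : p ≠ ⊤)
    {k : E3 → 𝕜} (hk : Integrable k) {f : E3 → F} (hf : MemLp f p) :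
    MemLp (k ⋆[lsmul 𝕜 𝕜] f) p :=
  ⟨aestronglyMeasurable_convolution hk.1 hf.1, (eLpNorm_convolution_le hp hp' hk hf.1).trans_lt
    (ENNReal.mul_lt_top hk.2 hf.2)⟩

/-- Equality holds at every point, because `y ↦ x - y` preserves null sets. Representatives can thus
be exchanged freely inside a convolution. -/
theorem convolution_congr_ae_right {k : E3 → 𝕜} {f g : E3 → F} (h : f =ᵐ[volume] g) :
    k ⋆[lsmul 𝕜 𝕜] f = k ⋆[lsmul 𝕜 𝕜] g := by
  ext x
  refine integral_congr_ae ?_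
  filter_upwards [(quasiMeasurePreserving_sub_left volume x).ae h] with y hy
  simp only [hy]

variable (F) in
/-- Convolution with an integrable kernel, as an operator on `L²`. -/
def convL2 (k : E3 → 𝕜) (hk : Integrable k) : Lp F 2 (volume : Measure E3) →L[𝕜]
    Lp F 2 (volume : Measure E3) :=
  LinearMap.mkContinuous
    { toFun := fun f =>
        (MemLp.convolution_left one_le_two ENNReal.ofNat_ne_top hk (Lp.memLp f)).toLp _
      map_add' := fun f g => by
        rw [← MemLp.toLp_add]
        refine MemLp.toLp_congr _ _ ?_
        rw [convolution_congr_ae_right (Lp.coeFn_add f g)]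
        filter_upwards [ae_convolutionExistsAt one_le_two ENNReal.ofNat_ne_top hk (Lp.memLp f),
          ae_convolutionExistsAt one_le_two ENNReal.ofNat_ne_top hk (Lp.memLp g)] with x h1 h2
        exact h1.distrib_add h2
      map_smul' := fun c f => by
        rw [RingHom.id_apply, ← MemLp.toLp_const_smul]
        refine MemLp.toLp_congr _ _ ?_
        rw [convolution_congr_ae_right (Lp.coeFn_smul c f)]
        refine .of_forall fun x => ?_
        simp only [MeasureTheory.convolution, ContinuousLinearMap.lsmul_apply, Pi.smul_apply]
        rw [← integral_smul]
        congr 1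
        ext y
        rw [smul_comm] }
    (∫⁻ y, ‖k y‖ₑ).toReal
    (fun f => by
      simp only [LinearMap.coe_mk, AddHom.coe_mk]
      rw [Lp.norm_toLp, Lp.norm_def, ← ENNReal.toReal_mul]
      exact ENNReal.toReal_mono (ENNReal.mul_ne_top hk.2.ne (Lp.memLp f).2.ne)
        (eLpNorm_convolution_le one_le_two ENNReal.ofNat_ne_top hk (Lp.memLp f).1))

theorem coeFn_convL2 {k : E3 → 𝕜} (hk : Integrable k) (f : Lp F 2 (volume : Measure E3)) :
    convL2 F k hk f =ᵐ[volume] k ⋆[lsmul 𝕜 𝕜] f :=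
  MemLp.coeFn_toLp (MemLp.convolution_left one_le_two ENNReal.ofNat_ne_top hk (Lp.memLp f))

theorem norm_convL2_apply_le {k : E3 → 𝕜} (hk : Integrable k) (f : Lp F 2 (volume : Measure E3)) :
    ‖convL2 F k hk f‖ ≤ (∫⁻ y, ‖k y‖ₑ).toReal * ‖f‖ :=
  (convL2 F k hk).le_of_opNorm_le (LinearMap.mkContinuous_norm_le _ ENNReal.toReal_nonneg _) f

end Young

/-! ### Fourier multipliers on `L²` -/

section Multiplier

open FourierTransform
open ContinuousLinearMap (lsmul)
open scoped Convolution

/-- Complex valued square integrable functions on `ℝ³`. -/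
abbrev L2C : Type := Lp ℂ 2 (volume : Measure E3)

/-- The Fourier multiplier with bounded symbol `m`, on `L²`. -/
def freqMul (m : E3 → ℂ) (hm : MemLp m ⊤) (g : L2C) : L2C :=
  𝓕⁻ ((hm.toLp m • 𝓕 g : L2C))

theorem fourierMultiplierCLM_toTemperedDistribution {m : E3 → ℂ} (hm : MemLp m ⊤)
    (hm' : m.HasTemperateGrowth) (g : L2C) :
    TemperedDistribution.fourierMultiplierCLM ℂ m (Lp.toTemperedDistribution g)
      = Lp.toTemperedDistribution (freqMul m hm g) := by
  rw [freqMul, ← Lp.fourierInv_toTemperedDistribution_eq,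
    Lp.toTemperedDistribution_smul_eq hm', ← Lp.fourier_toTemperedDistribution_eq,
    TemperedDistribution.fourierMultiplierCLM_apply]

theorem fourier_freqMul {m : E3 → ℂ} (hm : MemLp m ⊤) (g : L2C) :
    𝓕 (freqMul m hm g) = (hm.toLp m • 𝓕 g : L2C) := by
  rw [freqMul, fourier_fourierInv_eq]

theorem coeFn_fourier_freqMul {m : E3 → ℂ} (hm : MemLp m ⊤) (g : L2C) :
    (𝓕 (freqMul m hm g) : L2C) =ᵐ[volume] fun ξ => m ξ * (𝓕 g : L2C) ξ := by
  rw [fourier_freqMul]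
  filter_upwards [Lp.coeFn_lpSMul (r := 2) (hm.toLp m) (𝓕 g : L2C), hm.coeFn_toLp] with x h1 h2
  simp [h1, h2]

theorem fourier_L2C_injective {f g : L2C} (h : (𝓕 f : L2C) =ᵐ[volume] (𝓕 g : L2C)) : f = g := by
  have : (𝓕 f : L2C) = 𝓕 g := Lp.ext h
  rw [← fourierInv_fourier_eq (F := L2C) f, this, fourierInv_fourier_eq]

/-- Used with `m₁ = 1` on the support of `m₂`: the output of the second multiplier is then
reproduced by the first. -/
theorem freqMul_freqMul {m₁ m₂ m : E3 → ℂ} (hm₁ : MemLp m₁ ⊤) (hm₂ : MemLp m₂ ⊤)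
    (hm : MemLp m ⊤) (h : ∀ ξ, m₁ ξ * m₂ ξ = m ξ) (g : L2C) :
    freqMul m₁ hm₁ (freqMul m₂ hm₂ g) = freqMul m hm g := by
  refine fourier_L2C_injective ?_
  filter_upwards [coeFn_fourier_freqMul hm₁ (freqMul m₂ hm₂ g), coeFn_fourier_freqMul hm₂ g,
    coeFn_fourier_freqMul hm g] with ξ h1 h2 h3
  rw [h1, h2, h3, ← h, mul_assoc]

theorem norm_freqMul_le {m : E3 → ℂ} (hm : MemLp m ⊤) (hm' : ∀ ξ, ‖m ξ‖ ≤ 1) (g : L2C) :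
    ‖freqMul m hm g‖ ≤ ‖g‖ := by
  rw [← Lp.norm_fourier_eq, ← Lp.norm_fourier_eq g]
  refine Lp.norm_le_norm_of_ae_le ?_
  filter_upwards [coeFn_fourier_freqMul hm g] with ξ h
  rw [h, norm_mul]
  exact mul_le_of_le_one_left (norm_nonneg _) (hm' ξ)

/-- A Fourier multiplier with Schwartz symbol is a convolution operator. -/
theorem freqMul_schwartz (θ : 𝓢(E3, ℂ)) (hθ : MemLp θ ⊤) (g : L2C) :
    freqMul θ hθ g = convL2 ℂ (𝕜 := ℂ) (𝓕⁻ θ : 𝓢(E3, ℂ)) (𝓕⁻ θ : 𝓢(E3, ℂ)).integrable g := by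
  have hcont : Continuous (freqMul θ hθ) := by
    have h1 : Continuous fun g : L2C => (𝓕 g : L2C) := continuous_fourier
    have h2 : Continuous fun g : L2C => (hθ.toLp θ • g : L2C) :=
      (ContinuousLinearMap.continuous ((ContinuousLinearMap.lsmul ℂ ℂ).holderL volume ⊤ 2 2
        (hθ.toLp θ))).congr fun g => by
          refine Lp.ext ?_
          filter_upwards [Lp.coeFn_lpSMul (r := 2) (hθ.toLp θ) g,
            ContinuousLinearMap.coeFn_holder (r := 2) (ContinuousLinearMap.lsmul ℂ ℂ)
              (hθ.toLp θ) g] with x h1 h2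
          rw [h1]
          simpa using h2
    have h3 : Continuous fun g : L2C => (𝓕⁻ g : L2C) := continuous_fourierInv
    exact h3.comp (h2.comp h1)
  -- Both sides are continuous in `g`, so they need only be compared on Schwartz functions, where
  -- the convolution theorem applies.
  refine DenseRange.induction_on (SchwartzMap.denseRange_toLpCLM (E := E3) (F := ℂ) (p := 2)
    (μ := volume) ENNReal.ofNat_ne_top) g
    (isClosed_eq hcont (ContinuousLinearMap.continuous _)) fun f => ?_
  simp only [SchwartzMap.toLpCLM_apply]
  have h1 : freqMul θ hθ (f.toLp 2) =
      (SchwartzMap.convolution (lsmul ℂ ℂ) (𝓕⁻ θ : 𝓢(E3, ℂ)) f).toLp 2 := by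
    refine fourier_L2C_injective ?_
    rw [SchwartzMap.toLp_fourier_eq, SchwartzMap.fourier_convolution]
    filter_upwards [coeFn_fourier_freqMul hθ (f.toLp 2), (𝓕 f).coeFn_toLp 2 volume,
      (SchwartzMap.pairing (lsmul ℂ ℂ) (𝓕 (𝓕⁻ θ : 𝓢(E3, ℂ))) (𝓕 f)).coeFn_toLp 2 volume]
      with ξ h1 h2 h3
    rw [h1, h3, SchwartzMap.toLp_fourier_eq, h2, SchwartzMap.pairing_apply, fourier_fourierInv_eq]
    rfl
  rw [h1]
  refine Lp.ext ?_
  filter_upwards [coeFn_convL2 (𝕜 := ℂ) (𝓕⁻ θ : 𝓢(E3, ℂ)).integrable (f.toLp 2),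
    SchwartzMap.coeFn_toLp (SchwartzMap.convolution (lsmul ℂ ℂ) (𝓕⁻ θ : 𝓢(E3, ℂ)) f) 2 volume]
    with x h2 h3
  rw [h2, h3, SchwartzMap.convolution_apply, convolution_congr_ae_right (f.coeFn_toLp 2 volume)]

/-- `L²` functions are determined by the tempered distribution they define, hence the `L^q` norm
of that distribution dominates the `L^q` norm of the function. -/
theorem eLpNorm_le_distLpNorm {q : ℝ≥0∞} (hq : 1 ≤ q) (g : L2C) :
    eLpNorm g q ≤ distLpNorm q (Lp.toTemperedDistribution g) := by
  refine le_iInf fun h => le_iInf fun hh => le_iInf fun hrep => (eLpNorm_congr_ae ?_).le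
  -- Any admissible representative agrees with `g` against compactly supported smooth functions,
  -- hence almost everywhere. Without a representative the infimum is `⊤`.
  refine ae_eq_of_integral_contDiff_smul_eq ((Lp.memLp g).locallyIntegrable one_le_two)
    (hh.locallyIntegrable hq) fun θ hθ hθ' => ?_
  have h1 : HasCompactSupport (Complex.ofRealCLM ∘ θ) := hθ'.comp_left rfl
  have h2 : ContDiff ℝ ∞ (Complex.ofRealCLM ∘ θ) := by fun_prop
  simpa using hrep (h1.toSchwartzMap h2)

end Multiplier

/-! ### Translation increments of frequency localized functions -/

section Increments

open FourierTransform
open ContinuousLinearMap (lsmul)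
open scoped Convolution

/-- The increment of a function under translation. -/
def incr {F : Type*} [Sub F] (z : E3) (f : E3 → F) (x : E3) : F := f (x - z) - f x

theorem lintegral_comp_smul {c : ℝ} (hc : c ≠ 0) (f : E3 → ℝ≥0∞) :
    ∫⁻ x, f (c • x) = ENNReal.ofReal |(c ^ 3)⁻¹| * ∫⁻ x, f x := by
  have h := lintegral_map_equiv (μ := (volume : Measure E3)) f
    (Homeomorph.smulOfNeZero c hc).toMeasurableEquiv
  have h2 : Measure.map (Homeomorph.smulOfNeZero c hc).toMeasurableEquiv (volume : Measure E3)
      = ENNReal.ofReal |(c ^ 3)⁻¹| • volume := by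
    have := Measure.map_addHaar_smul (volume : Measure E3) hc
    rw [finrank_euclideanSpace_fin] at this
    exact this
  rw [h2, lintegral_smul_measure] at h
  simpa using h.symm

theorem enorm_incr_le {F : Type*} [NormedAddCommGroup F] [NormedSpace ℝ F] [CompleteSpace F]
    {K : E3 → F} (hK : ContDiff ℝ 1 K) (z x : E3) :
    ‖incr z K x‖ₑ ≤ ∫⁻ t in Ioc (0 : ℝ) 1, ‖z‖ₑ * ‖fderiv ℝ K (x - t • z)‖ₑ := by
  have hd : ∀ t : ℝ, HasDerivAt (fun t : ℝ => K (x - t • z))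
      (fderiv ℝ K (x - t • z) (-z)) t := by
    intro t
    have h1 : HasDerivAt (fun t : ℝ => x - t • z) (-z) t := by
      simpa using ((hasDerivAt_id t).smul_const z).const_sub x
    exact ((hK.differentiable one_ne_zero _).hasFDerivAt).comp_hasDerivAt t h1
  have hcont : Continuous fun t : ℝ => fderiv ℝ K (x - t • z) (-z) := by
    have := hK.continuous_fderiv one_ne_zero
    fun_prop
  have h := intervalIntegral.integral_eq_sub_of_hasDerivAt (a := 0) (b := 1) (fun t _ => hd t)
    (hcont.intervalIntegrable _ _)
  simp only [one_smul, zero_smul, sub_zero] at h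
  rw [incr, ← h, intervalIntegral.integral_of_le zero_le_one]
  refine (enorm_integral_le_lintegral_enorm _).trans (lintegral_mono fun t => ?_)
  rw [mul_comm, ← enorm_neg z]
  exact ContinuousLinearMap.le_opENorm _ _

theorem lintegral_enorm_incr_le {F : Type*} [NormedAddCommGroup F] [NormedSpace ℝ F]
    [CompleteSpace F] {K : E3 → F} (hK : ContDiff ℝ 1 K) (z : E3) :
    ∫⁻ x, ‖incr z K x‖ₑ ≤ ‖z‖ₑ * ∫⁻ x, ‖fderiv ℝ K x‖ₑ := by
  have hc := hK.continuous_fderiv one_ne_zero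
  calc _ ≤ ∫⁻ x, ∫⁻ t in Ioc (0 : ℝ) 1, ‖z‖ₑ * ‖fderiv ℝ K (x - t • z)‖ₑ :=
        lintegral_mono fun x => enorm_incr_le hK z x
    _ = ∫⁻ t in Ioc (0 : ℝ) 1, ∫⁻ x, ‖z‖ₑ * ‖fderiv ℝ K (x - t • z)‖ₑ := by
      refine lintegral_lintegral_swap (Continuous.aemeasurable ?_)
      refine ENNReal.continuous_const_mul enorm_ne_top |>.comp (Continuous.enorm ?_)
      exact hc.comp (by fun_prop)
    _ = ∫⁻ t in Ioc (0 : ℝ) 1, ‖z‖ₑ * ∫⁻ x, ‖fderiv ℝ K x‖ₑ := by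
      refine lintegral_congr fun t => ?_
      rw [lintegral_const_mul' _ _ enorm_ne_top,
        lintegral_sub_right_eq_self (fun x => ‖fderiv ℝ K x‖ₑ) (t • z)]
    _ = _ := by simp

theorem lintegral_enorm_incr_le_two {F : Type*} [NormedAddCommGroup F]
    {K : E3 → F} (hK : AEStronglyMeasurable K) (z : E3) :
    ∫⁻ x, ‖incr z K x‖ₑ ≤ 2 * ∫⁻ x, ‖K x‖ₑ := by
  calc _ ≤ ∫⁻ x, (‖K (x - z)‖ₑ + ‖K x‖ₑ) := lintegral_mono fun x => enorm_sub_le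
    _ = _ := by
      rw [lintegral_add_right' _ hK.enorm, lintegral_sub_right_eq_self (fun x => ‖K x‖ₑ) z, two_mul]

/-- The `L¹` modulus of continuity is compatible with dilations. -/
theorem lintegral_enorm_incr_dilation {K : E3 → ℂ} {c : ℝ} (hc : 0 < c) (z : E3) :
    ∫⁻ x, ‖incr z (fun x => (c : ℂ) ^ 3 * K (c • x)) x‖ₑ = ∫⁻ x, ‖incr (c • z) K x‖ₑ := by
  have h : ∀ x, ‖incr z (fun x => (c : ℂ) ^ 3 * K (c • x)) x‖ₑ
      = ENNReal.ofReal (c ^ 3) * ‖incr (c • z) K (c • x)‖ₑ := by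
    intro x
    simp only [incr]
    rw [← mul_sub, enorm_mul, smul_sub]
    congr 1
    rw [← ofReal_norm, norm_pow, Complex.norm_real, Real.norm_of_nonneg hc.le]
  simp only [h]
  rw [lintegral_const_mul' _ _ ENNReal.ofReal_ne_top,
    lintegral_comp_smul hc.ne' (fun x => ‖incr (c • z) K x‖ₑ), ← mul_assoc,
    abs_of_pos (by positivity), ← ENNReal.ofReal_mul (by positivity),
    mul_inv_cancel₀ (by positivity), ENNReal.ofReal_one, one_mul]

theorem fourierInv_dilation (θ : E3 → ℂ) {c : ℝ} (hc : 0 < c) (x : E3) :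
    𝓕⁻ (fun ξ => θ (c⁻¹ • ξ)) x = (c : ℂ) ^ 3 * 𝓕⁻ θ (c • x) := by
  rw [Real.fourierInv_eq', Real.fourierInv_eq']
  have h := Measure.integral_comp_smul (volume : Measure E3)
    (fun v : E3 => Complex.exp (↑(2 * Real.pi * inner ℝ v (c • x)) * Complex.I) • θ v) c⁻¹
  rw [finrank_euclideanSpace_fin, inv_pow, inv_inv, abs_of_pos (by positivity)] at h
  have h2 : ∀ v : E3, inner ℝ (c⁻¹ • v) (c • x) = inner ℝ v x := by
    intro v
    rw [inner_smul_left, inner_smul_right]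
    simp
    field_simp
  simp only [h2] at h
  rw [h, Complex.real_smul]
  push_cast
  rfl

/-- Smooth frequency cut-offs at scale `c` whose kernels have an `L¹` modulus of continuity
of the order of `min(1, c |z|)`. -/
theorem exists_frequency_cutoff : ∃ C : ℝ≥0∞, C ≠ ⊤ ∧ ∀ c : ℝ, 0 < c → ∃ θ : 𝓢(E3, ℂ),
    (∀ ξ, ‖ξ‖ ≤ 3 * c → θ ξ = 1) ∧
    ∀ z, ∫⁻ x, ‖incr z (𝓕⁻ θ : 𝓢(E3, ℂ)) x‖ₑ ≤ C * min 1 (ENNReal.ofReal (c * ‖z‖)) := by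
  -- The plateau radius 3 matches the symbols of the blocks, which vanish outside the ball of radius
  -- `3 * 2 ^ j`; 4 is just a larger radius.
  let b : ContDiffBump (0 : E3) := ⟨3, 4, by norm_num, by norm_num⟩
  have hb1 : HasCompactSupport (Complex.ofRealCLM ∘ b) := b.hasCompactSupport.comp_left rfl
  have hb2 : ContDiff ℝ ∞ (Complex.ofRealCLM ∘ b) := Complex.ofRealCLM.contDiff.comp b.contDiff
  let K : 𝓢(E3, ℂ) := 𝓕⁻ (hb1.toSchwartzMap hb2)
  have hK : (K : E3 → ℂ) = 𝓕⁻ (Complex.ofRealCLM ∘ b) := SchwartzMap.fourierInv_coe _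
  have hfin1 : ∫⁻ x, ‖K x‖ₑ ≠ ⊤ := K.integrable.2.ne
  have hfin2 : ∫⁻ x, ‖fderiv ℝ K x‖ₑ ≠ ⊤ := by
    simpa using (SchwartzMap.fderivCLM ℝ E3 ℂ K).integrable (μ := volume) |>.2.ne
  refine ⟨(2 * ∫⁻ x, ‖K x‖ₑ) + ∫⁻ x, ‖fderiv ℝ K x‖ₑ,
    ENNReal.add_ne_top.2 ⟨ENNReal.mul_ne_top ENNReal.ofNat_ne_top hfin1, hfin2⟩, fun c hc => ?_⟩
  have hc1 : HasCompactSupport fun ξ : E3 => (Complex.ofRealCLM ∘ b) (c⁻¹ • ξ) :=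
    hb1.comp_homeomorph (Homeomorph.smulOfNeZero c⁻¹ (inv_ne_zero hc.ne'))
  have hc2 : ContDiff ℝ ∞ fun ξ : E3 => (Complex.ofRealCLM ∘ b) (c⁻¹ • ξ) :=
    hb2.comp (contDiff_const_smul _)
  refine ⟨hc1.toSchwartzMap hc2, fun ξ hξ => ?_, fun z => ?_⟩
  · have : b (c⁻¹ • ξ) = 1 := by
      refine b.one_of_mem_closedBall ?_
      rw [mem_closedBall_zero_iff, norm_smul, norm_inv, Real.norm_of_nonneg hc.le,
        inv_mul_le_iff₀ hc, mul_comm]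
      exact hξ
    simp [this]
  -- The kernel at scale `c` is the mass-preserving dilation of `K`, so its modulus at `z` is that
  -- of `K` at `c • z`: bounded by twice the mass of `K`, or by `c ‖z‖` times the mass of its
  -- derivative.
  · have h1 : ((𝓕⁻ (hc1.toSchwartzMap hc2) : 𝓢(E3, ℂ)) : E3 → ℂ)
        = fun x => (c : ℂ) ^ 3 * K (c • x) := by
      rw [SchwartzMap.fourierInv_coe, hK]
      ext x
      exact fourierInv_dilation (Complex.ofRealCLM ∘ b) hc x
    rw [h1, lintegral_enorm_incr_dilation hc, mul_min]
    refine le_min ?_ ?_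
    · rw [mul_one]
      exact (lintegral_enorm_incr_le_two K.continuous.aestronglyMeasurable _).trans le_self_add
    · refine (lintegral_enorm_incr_le (K.smooth 1) _).trans ?_
      rw [mul_comm, ← ofReal_norm, norm_smul, Real.norm_of_nonneg hc.le]
      gcongr
      exact le_add_self

/-- Differencing `h = K ⋆ h` puts the translation on the kernel, and Young's inequality leaves only
the `L¹` modulus of `K`. -/
theorem eLpNorm_incr_le_of_convL2_eq {p : ℝ≥0∞} (hp : 1 ≤ p) (hp' : p ≠ ⊤) {K : E3 → ℂ}
    (hK : Integrable K) {h : L2C} (hh : convL2 ℂ (𝕜 := ℂ) K hK h = h) (z : E3) :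
    eLpNorm (incr z h) p ≤ (∫⁻ x, ‖incr z K x‖ₑ) * eLpNorm h p := by
  have hKz : Integrable (incr z K) := (hK.comp_sub_right z).sub hK
  have h1 : (h : E3 → ℂ) =ᵐ[volume] K ⋆[lsmul ℂ ℂ] h := by
    have := coeFn_convL2 (𝕜 := ℂ) hK h
    rwa [hh] at this
  have hz := (measurePreserving_sub_right (volume : Measure E3) z).quasiMeasurePreserving
  have hex := ae_convolutionExistsAt one_le_two ENNReal.ofNat_ne_top hK (Lp.memLp h)
  have hex' := ae_convolutionExistsAt one_le_two ENNReal.ofNat_ne_top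
    (hK.comp_sub_right z) (Lp.memLp h)
  have h2 : incr z h =ᵐ[volume] incr z K ⋆[lsmul ℂ ℂ] h := by
    filter_upwards [h1, hz.ae h1, hex, hex'] with x h3 h4 h5 h6
    have h7 : (incr z K ⋆[lsmul ℂ ℂ] (h : E3 → ℂ)) x
        = (∫ y, K (y - z) • h (x - y)) - ∫ y, K y • h (x - y) := by
      rw [← integral_sub (by simpa [ConvolutionExistsAt] using h6)
        (by simpa [ConvolutionExistsAt] using h5)]
      simp only [MeasureTheory.convolution, incr, ContinuousLinearMap.lsmul_apply, sub_smul]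
    rw [h7, incr, h3, h4]
    congr 1
    change ∫ y, K y • h (x - z - y) = _
    rw [← integral_sub_right_eq_self (fun y => K y • h (x - z - y)) z]
    simp only [sub_sub, add_sub_cancel]
  rw [eLpNorm_congr_ae h2]
  exact eLpNorm_convolution_le hp hp' hKz (Lp.aestronglyMeasurable h)

end Increments

/-! ### Dyadic blocks of square integrable functions -/

section Dyadic

open FourierTransform

variable (P : DyadicPartition)

/-- The symbol of the dyadic block `Δ_j`. -/
def symbol (j : ℤ) (ξ : E3) : ℝ :=
  if j ≤ -2 then 0 else if j = -1 then P.low ξ else P.shell ((2 : ℝ) ^ (-j) • ξ)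

theorem symbol_nonneg (j : ℤ) (ξ : E3) : 0 ≤ symbol P j ξ := by
  unfold symbol
  split_ifs
  exacts [le_rfl, P.low_nonneg _, P.shell_nonneg _]

theorem contDiff_symbol (j : ℤ) : ContDiff ℝ ∞ (symbol P j) := by
  unfold symbol
  split_ifs
  exacts [contDiff_const, P.low_smooth, P.shell_smooth.comp (contDiff_const_smul _)]

/-- The constant 3 serves both cases: `4/3 ≤ 3/2` for `j = -1`, and `8/3 ≤ 3` for `j ≥ 0`. -/
theorem norm_le_of_symbol_ne_zero {j : ℤ} {ξ : E3} (h : symbol P j ξ ≠ 0) :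
    ‖ξ‖ ≤ 3 * (2 : ℝ) ^ j := by
  unfold symbol at h
  split_ifs at h with h1 h2
  · exact absurd rfl h
  · have := P.low_support ξ h
    rw [h2, zpow_neg_one]
    linarith
  · have := (P.shell_support _ h).2
    rw [norm_smul, norm_zpow, Real.norm_ofNat, zpow_neg, inv_mul_le_iff₀ (by positivity)] at this
    nlinarith [zpow_pos (two_pos : (0 : ℝ) < 2) j]

theorem hasCompactSupport_symbol (j : ℤ) : HasCompactSupport (symbol P j) :=
  HasCompactSupport.of_support_subset_isCompact (isCompact_closedBall 0 (3 * (2 : ℝ) ^ j))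
    fun _ h => mem_closedBall_zero_iff.2 (norm_le_of_symbol_ne_zero P h)

theorem symbol_neg_one (ξ : E3) : symbol P (-1) ξ = P.low ξ := by simp [symbol]

theorem symbol_natCast (j : ℕ) (ξ : E3) :
    symbol P j ξ = P.shell ((2 : ℝ) ^ (-(j : ℤ)) • ξ) := by
  have h1 : ¬ ((j : ℤ) ≤ -2) := by omega
  have h2 : ¬ ((j : ℤ) = -1) := by omega
  simp [symbol, h1, h2]

/-- The symbol of the low frequency cut-off `∑_{j < n} Δ_j`. -/
def lowSymbol (n : ℕ) (ξ : E3) : ℝ := symbol P (-1) ξ + ∑ j ∈ Finset.range n, symbol P j ξ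

theorem tendsto_lowSymbol (ξ : E3) : Tendsto (fun n => lowSymbol P n ξ) atTop (𝓝 1) := by
  have h := ((P.hasSum_nat ξ).tendsto_sum_nat).const_add (P.low ξ)
  rw [add_sub_cancel] at h
  refine h.congr fun n => ?_
  simp [lowSymbol, symbol_neg_one, symbol_natCast]

theorem lowSymbol_nonneg (n : ℕ) (ξ : E3) : 0 ≤ lowSymbol P n ξ :=
  add_nonneg (symbol_nonneg P _ _) (Finset.sum_nonneg fun _ _ => symbol_nonneg P _ _)

theorem lowSymbol_le_one (n : ℕ) (ξ : E3) : lowSymbol P n ξ ≤ 1 := by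
  refine ge_of_tendsto (tendsto_lowSymbol P ξ) ?_
  filter_upwards [eventually_ge_atTop n] with m hm
  unfold lowSymbol
  gcongr
  exact fun i _ _ => symbol_nonneg P _ _

theorem symbol_le_one (j : ℤ) (ξ : E3) : symbol P j ξ ≤ 1 := by
  rcases lt_or_ge j (-1) with h | h
  · rw [symbol, if_pos (by omega)]; exact zero_le_one
  rcases h.eq_or_lt with h | h
  · rw [← h]
    simpa [lowSymbol] using lowSymbol_le_one P 0 ξ
  · lift j to ℕ using by omega
    refine le_trans ?_ (lowSymbol_le_one P (j + 1) ξ)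
    rw [lowSymbol, Finset.sum_range_succ]
    have := symbol_nonneg P (-1) ξ
    have := Finset.sum_nonneg fun (i : ℕ) (_ : i ∈ Finset.range j) => symbol_nonneg P i ξ
    linarith

theorem norm_ofReal_symbol_le (j : ℤ) (ξ : E3) : ‖((symbol P j ξ : ℝ) : ℂ)‖ ≤ 1 := by
  rw [Complex.norm_real, Real.norm_of_nonneg (symbol_nonneg P j ξ)]
  exact symbol_le_one P j ξ

theorem memLp_symbol (j : ℤ) : MemLp (fun ξ => ((symbol P j ξ : ℝ) : ℂ)) ⊤ :=
  memLp_top_of_bound (Complex.continuous_ofReal.comp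
    (contDiff_symbol P j).continuous).aestronglyMeasurable 1
    (.of_forall (norm_ofReal_symbol_le P j))

/-- The dyadic block `Δ_j` acting on `L²`. -/
def blockL2 (j : ℤ) (g : L2C) : L2C := freqMul _ (memLp_symbol P j) g

theorem block_toTemperedDistribution (j : ℤ) (g : L2C) :
    block P j (Lp.toTemperedDistribution g) = Lp.toTemperedDistribution (blockL2 P j g) := by
  have hs : HasCompactSupport (Complex.ofRealCLM ∘ symbol P j) :=
    (hasCompactSupport_symbol P j).comp_left rfl
  have hs' : ContDiff ℝ ∞ (Complex.ofRealCLM ∘ symbol P j) :=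
    Complex.ofRealCLM.contDiff.comp (contDiff_symbol P j)
  rw [blockL2, ← fourierMultiplierCLM_toTemperedDistribution (memLp_symbol P j)
    (hs.hasTemperateGrowth hs')]
  unfold block symbol
  split_ifs
  · ext u
    simp
  · rfl
  · rfl

theorem norm_blockL2_le (j : ℤ) (g : L2C) : ‖blockL2 P j g‖ ≤ ‖g‖ :=
  norm_freqMul_le _ (norm_ofReal_symbol_le P j) g

/-- Partial sums of the Littlewood–Paley decomposition. -/
def lowL2 (n : ℕ) (g : L2C) : L2C := blockL2 P (-1) g + ∑ j ∈ Finset.range n, blockL2 P j g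

theorem coeFn_fourier_lowL2 (n : ℕ) (g : L2C) :
    (𝓕 (lowL2 P n g) : L2C) =ᵐ[volume] fun ξ => (lowSymbol P n ξ : ℂ) * (𝓕 g : L2C) ξ := by
  induction n with
  | zero =>
    simpa [lowL2, lowSymbol, blockL2] using coeFn_fourier_freqMul (memLp_symbol P (-1)) g
  | succ n ih =>
    have h1 : lowL2 P (n + 1) g = lowL2 P n g + blockL2 P n g := by
      simp [lowL2, Finset.sum_range_succ, add_assoc]
    rw [h1, FourierTransform.fourier_add]
    filter_upwards [Lp.coeFn_add (𝓕 (lowL2 P n g) : L2C) (𝓕 (blockL2 P n g)), ih,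
      coeFn_fourier_freqMul (memLp_symbol P n) g] with ξ h2 h3 h4
    rw [h2, Pi.add_apply, h3, blockL2, h4]
    simp [lowSymbol, Finset.sum_range_succ]
    ring

/-- The Littlewood–Paley decomposition converges in `L²`. -/
theorem tendsto_lowL2 (g : L2C) : Tendsto (fun n => lowL2 P n g) atTop (𝓝 g) := by
  -- On the Fourier side the remainder is multiplication by `lowSymbol - 1`, which is bounded by one
  -- and tends to zero pointwise, so dominated convergence applies.
  have h : Tendsto (fun n => (𝓕 (lowL2 P n g) : L2C)) atTop (𝓝 (𝓕 g)) := by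
    rw [Lp.tendsto_Lp_iff_tendsto_eLpNorm']
    have h1 : ∀ n, eLpNorm (⇑(𝓕 (lowL2 P n g) : L2C) - ⇑(𝓕 g : L2C)) 2 volume
        = (∫⁻ ξ, (‖(lowSymbol P n ξ : ℂ) - 1‖ₑ * ‖(𝓕 g : L2C) ξ‖ₑ) ^ (2 : ℝ)) ^ (1 / (2 : ℝ)) := by
      intro n
      rw [eLpNorm_eq_lintegral_rpow_enorm_toReal two_ne_zero ENNReal.ofNat_ne_top]
      simp only [ENNReal.toReal_ofNat]
      congr 1
      refine lintegral_congr_ae ?_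
      filter_upwards [coeFn_fourier_lowL2 P n g] with ξ hξ
      rw [Pi.sub_apply, hξ, ← enorm_mul, sub_mul, one_mul]
    simp only [h1]
    have hbound : ∫⁻ ξ, ‖(𝓕 g : L2C) ξ‖ₑ ^ (2 : ℝ) ≠ ⊤ := by
      have := (Lp.memLp (𝓕 g : L2C)).2
      rw [eLpNorm_eq_lintegral_rpow_enorm_toReal two_ne_zero ENNReal.ofNat_ne_top] at this
      simpa using this.ne
    have h2 := tendsto_lintegral_of_dominated_convergence' (μ := (volume : Measure E3))
      (F := fun n ξ => (‖(lowSymbol P n ξ : ℂ) - 1‖ₑ * ‖(𝓕 g : L2C) ξ‖ₑ) ^ (2 : ℝ))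
      (f := fun _ => 0)
      (fun ξ => ‖(𝓕 g : L2C) ξ‖ₑ ^ (2 : ℝ)) (fun n => ?_) (fun n => .of_forall fun ξ => ?_)
      hbound (.of_forall fun ξ => ?_)
    · rw [lintegral_zero] at h2
      have := h2.ennrpow_const (1 / (2 : ℝ))
      simpa using this
    · have hc : Continuous fun ξ => (lowSymbol P n ξ : ℂ) - 1 := by
        refine (Complex.continuous_ofReal.comp ?_).sub continuous_const
        exact (contDiff_symbol P _).continuous.add
          (continuous_finsetSum _ fun i _ => (contDiff_symbol P _).continuous)
      exact (hc.enorm.aemeasurable.mul (Lp.aestronglyMeasurable _).enorm).pow_const _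
    · refine ENNReal.rpow_le_rpow (mul_le_of_le_one_left zero_le ?_) (by norm_num)
      rw [← Complex.ofReal_one, ← Complex.ofReal_sub, ← ofReal_norm, Complex.norm_real,
        ENNReal.ofReal_le_one, Real.norm_eq_abs, abs_le]
      constructor <;> linarith [lowSymbol_nonneg P n ξ, lowSymbol_le_one P n ξ]
    · have h3 : Tendsto (fun n => ‖(lowSymbol P n ξ : ℂ) - 1‖ₑ) atTop (𝓝 0) := by
        have := ((Complex.continuous_ofReal.tendsto _).comp (tendsto_lowSymbol P ξ)).sub_const 1
        simpa using this.enorm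
      have h4 := ENNReal.Tendsto.mul_const (b := ‖(𝓕 g : L2C) ξ‖ₑ) h3 (.inr enorm_ne_top)
      simpa using h4.ennrpow_const (2 : ℝ)
  have h' := (continuous_fourierInv (E := L2C)).tendsto _ |>.comp h
  simpa [Function.comp_def] using h'

end Dyadic

/-! ### Besov regularity and increments -/

section Besov

/-- `2^{n/3}` times the `L³` modulus of continuity at scale `2^{1 - n}`. -/
def modulus {F : Type*} [NormedAddCommGroup F] (n : ℕ) (f : E3 → F) : ℝ≥0∞ :=
  ⨆ z : E3, ⨆ _ : ‖z‖ ≤ (2 : ℝ) ^ (1 - (n : ℝ)), (2 : ℝ≥0∞) ^ ((n : ℝ) / 3) * eLpNorm (incr z f) 3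

theorem eLpNorm_incr_le_modulus {F : Type*} [NormedAddCommGroup F] {n : ℕ} (f : E3 → F) {z : E3}
    (hz : ‖z‖ ≤ (2 : ℝ) ^ (1 - (n : ℝ))) :
    (2 : ℝ≥0∞) ^ ((n : ℝ) / 3) * eLpNorm (incr z f) 3 ≤ modulus n f :=
  le_iSup₂_of_le z hz le_rfl

variable (P : DyadicPartition)

/-- The quantities `2^{j/3} ‖Δ_j g‖_{L³}`. -/
def besovCoeff (g : L2C) (j : ℤ) : ℝ≥0∞ := (2 : ℝ≥0∞) ^ ((j : ℝ) / 3) * eLpNorm (blockL2 P j g) 3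

/-- A summable weight. -/
def dyadicWeight (k : ℤ) : ℝ≥0∞ := (2 : ℝ≥0∞) ^ (-|(k : ℝ)| / 3)

theorem tsum_dyadicWeight_ne_top : ∑' k, dyadicWeight k ≠ ⊤ := by
  have hr : Summable fun n : ℕ => ((2 : ℝ) ^ (-(1 / 3) : ℝ)) ^ n :=
    summable_geometric_of_lt_one (by positivity)
      (Real.rpow_lt_one_of_one_lt_of_neg one_lt_two (by norm_num))
  have h1 : Summable fun n : ℕ => (2 : ℝ) ^ (-(n : ℝ) / 3) := by
    refine hr.congr fun n => ?_
    rw [← Real.rpow_natCast, ← Real.rpow_mul two_pos.le]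
    congr 1
    ring
  have h2 : Summable fun k : ℤ => (2 : ℝ) ^ (-|(k : ℝ)| / 3) := by
    refine Summable.of_nat_of_neg ?_ ?_ <;> simpa using h1
  have h3 : dyadicWeight = fun k : ℤ => ENNReal.ofReal ((2 : ℝ) ^ (-|(k : ℝ)| / 3)) := by
    ext k
    rw [dyadicWeight, ← ENNReal.ofReal_rpow_of_pos two_pos, ENNReal.ofReal_ofNat]
  rw [h3]
  exact h2.tsum_ofReal_ne_top

/-- For `j ≥ n` the trivial bound 1 leaves the decay `2 ^ (-(j - n)/3)` relative to `2 ^ (j/3)`. For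
`j ≤ n` the Lipschitz bound gives `2 ^ (1 - 2(n - j)/3)`, which is even better than needed. -/
theorem two_rpow_mul_min_le (n : ℕ) (j : ℤ) :
    (2 : ℝ≥0∞) ^ ((n : ℝ) / 3) * min 1 ((2 : ℝ≥0∞) ^ ((j : ℝ) + 1 - n)) ≤
      2 * dyadicWeight (j - n) * 2 ^ ((j : ℝ) / 3) := by
  have h2 : (2 : ℝ≥0∞) ≠ 0 := two_ne_zero
  have h2' : (2 : ℝ≥0∞) ≠ ⊤ := ENNReal.ofNat_ne_top
  have h1 : (2 : ℝ≥0∞) * dyadicWeight (j - n) * 2 ^ ((j : ℝ) / 3)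
      = 2 ^ (1 + -|(j : ℝ) - n| / 3 + (j : ℝ) / 3) := by
    rw [ENNReal.rpow_add _ _ h2 h2', ENNReal.rpow_add _ _ h2 h2', ENNReal.rpow_one, dyadicWeight]
    push_cast
    rfl
  rw [h1]
  rcases le_total ((n : ℝ)) (j : ℝ) with h | h
  · refine (mul_le_of_le_one_right zero_le (min_le_left _ _)).trans ?_
    refine ENNReal.rpow_le_rpow_of_exponent_le one_le_two ?_
    rw [abs_of_nonneg (by linarith)]
    linarith
  · refine (mul_le_mul_right (min_le_right _ _) _).trans ?_
    rw [← ENNReal.rpow_add _ _ h2 h2']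
    refine ENNReal.rpow_le_rpow_of_exponent_le one_le_two ?_
    rw [abs_of_nonpos (by linarith)]
    linarith

/-- A block is reproduced by a smooth cut-off at frequency `2 ^ j`, so its increments inherit the
`L¹` modulus of that kernel. -/
theorem eLpNorm_incr_blockL2_le : ∃ C : ℝ≥0∞, C ≠ ⊤ ∧ ∀ (g : L2C) (j : ℤ) (z : E3),
    eLpNorm (incr z (blockL2 P j g)) 3 ≤
      C * min 1 (ENNReal.ofReal ((2 : ℝ) ^ j * ‖z‖)) * eLpNorm (blockL2 P j g) 3 := by
  obtain ⟨C, hC, hcut⟩ := exists_frequency_cutoff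
  refine ⟨C, hC, fun g j z => ?_⟩
  obtain ⟨θ, hθ1, hθ2⟩ := hcut ((2 : ℝ) ^ j) (by positivity)
  have h : freqMul θ (θ.memLp ⊤) (blockL2 P j g) = blockL2 P j g := by
    refine freqMul_freqMul _ _ _ (fun ξ => ?_) g
    by_cases hξ : symbol P j ξ = 0
    · simp [hξ]
    · rw [hθ1 ξ (norm_le_of_symbol_ne_zero P hξ), one_mul]
  rw [freqMul_schwartz] at h
  refine (eLpNorm_incr_le_of_convL2_eq (by norm_num) ENNReal.ofNat_ne_top _ h z).trans ?_
  gcongr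
  exact hθ2 z

theorem aestronglyMeasurable_incr {F : Type*} [NormedAddCommGroup F] {f : E3 → F}
    (hf : AEStronglyMeasurable f) (z : E3) : AEStronglyMeasurable (incr z f) :=
  (hf.comp_measurePreserving (measurePreserving_sub_right volume z)).sub hf

theorem incr_congr_ae {F : Type*} [NormedAddCommGroup F] {f g : E3 → F}
    (h : f =ᵐ[volume] g) (z : E3) : incr z f =ᵐ[volume] incr z g := by
  filter_upwards [h, (measurePreserving_sub_right volume z).quasiMeasurePreserving.ae h]
    with x h1 h2
  rw [incr, incr, h1, h2]

theorem eLpNorm_incr_add_le (f g : L2C) (z : E3) :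
    eLpNorm (incr z (f + g : L2C)) 3 ≤ eLpNorm (incr z f) 3 + eLpNorm (incr z g) 3 := by
  have h1 : incr z (f + g : L2C) =ᵐ[volume] incr z f + incr z g := by
    refine (incr_congr_ae (Lp.coeFn_add f g) z).trans (.of_forall fun x => ?_)
    simp only [incr, Pi.add_apply]
    ring
  rw [eLpNorm_congr_ae h1]
  exact eLpNorm_add_le (aestronglyMeasurable_incr (Lp.aestronglyMeasurable _) z)
    (aestronglyMeasurable_incr (Lp.aestronglyMeasurable _) z) (by norm_num)

theorem eLpNorm_incr_lowL2_le (n : ℕ) (g : L2C) (z : E3) :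
    eLpNorm (incr z (lowL2 P n g)) 3 ≤ ∑' j, eLpNorm (incr z (blockL2 P j g)) 3 := by
  set e : ℤ → ℝ≥0∞ := fun j => eLpNorm (incr z (blockL2 P j g)) 3 with he
  have h1 : eLpNorm (incr z (lowL2 P n g)) 3 ≤ e (-1) + ∑ j ∈ Finset.range n, e j := by
    induction n with
    | zero => simp [lowL2, he]
    | succ n ih =>
      have h1 : lowL2 P (n + 1) g = lowL2 P n g + blockL2 P n g := by
        simp [lowL2, Finset.sum_range_succ, add_assoc]
      rw [h1, Finset.sum_range_succ, ← add_assoc]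
      exact (eLpNorm_incr_add_le _ _ z).trans (add_le_add_left ih _)
  refine h1.trans ?_
  have h2 : ∑ j ∈ (Finset.range n).map Nat.castEmbedding, e j
      = ∑ j ∈ Finset.range n, e (j : ℤ) := Finset.sum_map _ _ _
  rw [← h2, ← Finset.sum_insert (by simp)]
  exact ENNReal.sum_le_tsum _

/-- The decomposition converges in `L²`, hence almost everywhere along a subsequence, and Fatou's
lemma carries the `L³` bound to the limit. No prior `L³` integrability of `g` enters. -/
theorem eLpNorm_incr_le_tsum (g : L2C) (z : E3) :
    eLpNorm (incr z g) 3 ≤ ∑' j, eLpNorm (incr z (blockL2 P j g)) 3 := by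
  obtain ⟨ns, -, hns⟩ :=
    (tendstoInMeasure_of_tendsto_Lp (tendsto_lowL2 P g)).exists_seq_tendsto_ae
  have h1 : ∀ᵐ x, Tendsto (fun k => incr z (lowL2 P (ns k) g) x) atTop (𝓝 (incr z g x)) := by
    filter_upwards [hns, (measurePreserving_sub_right volume z).quasiMeasurePreserving.ae hns]
      with x h1 h2
    exact h2.sub h1
  refine (Lp.eLpNorm_lim_le_liminf_eLpNorm
    (fun k => aestronglyMeasurable_incr (Lp.aestronglyMeasurable _) z) _ h1).trans ?_
  refine liminf_le_of_frequently_le' (Frequently.of_forall fun k => ?_)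
  exact eLpNorm_incr_lowL2_le P _ g z

/-- Summing the block estimates gives a discrete convolution of the coefficients with a summable
weight centred at `j = n`. Both the decay and the uniform bound of the modulus follow from it. -/
theorem modulus_le_tsum : ∃ C : ℝ≥0∞, C ≠ ⊤ ∧ ∀ (g : L2C) (n : ℕ),
    modulus n g ≤ C * ∑' k, dyadicWeight k * besovCoeff P g (n + k) := by
  obtain ⟨C, hC, hblock⟩ := eLpNorm_incr_blockL2_le P
  refine ⟨C * 2, ENNReal.mul_ne_top hC ENNReal.ofNat_ne_top, fun g n => iSup₂_le fun z hz => ?_⟩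
  refine (mul_le_mul_right (eLpNorm_incr_le_tsum P g z) _).trans ?_
  rw [← (Equiv.addLeft (n : ℤ)).tsum_eq, ← ENNReal.tsum_mul_left, ← ENNReal.tsum_mul_left]
  refine ENNReal.tsum_le_tsum fun k => ?_
  rw [Equiv.coe_addLeft]
  refine (mul_le_mul_right (hblock g _ z) _).trans ?_
  have h1 : ENNReal.ofReal ((2 : ℝ) ^ ((n : ℤ) + k) * ‖z‖)
      ≤ (2 : ℝ≥0∞) ^ ((((n : ℤ) + k : ℤ) : ℝ) + 1 - n) := by
    have h3 : (2 : ℝ≥0∞) ^ ((((n : ℤ) + k : ℤ) : ℝ) + 1 - n)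
        = ENNReal.ofReal ((2 : ℝ) ^ ((((n : ℤ) + k : ℤ) : ℝ) + 1 - n)) := by
      rw [← ENNReal.ofReal_rpow_of_pos two_pos, ENNReal.ofReal_ofNat]
    rw [h3, add_sub_assoc, Real.rpow_add two_pos, Real.rpow_intCast]
    gcongr
  have h2 := two_rpow_mul_min_le n (n + k)
  rw [add_sub_cancel_left] at h2
  calc _ = C * ((2 : ℝ≥0∞) ^ ((n : ℝ) / 3) * min 1 (ENNReal.ofReal ((2 : ℝ) ^ ((n : ℤ) + k) * ‖z‖)))
        * eLpNorm (blockL2 P (n + k) g) 3 := by ring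
    _ ≤ C * (2 * dyadicWeight k * 2 ^ ((((n : ℤ) + k : ℤ) : ℝ) / 3))
        * eLpNorm (blockL2 P (n + k) g) 3 := by
      refine mul_le_mul_left (mul_le_mul_right ?_ C) _
      exact (mul_le_mul_right (min_le_min_left _ h1) _).trans h2
    _ = _ := by rw [besovCoeff]; ring

/-- If `2^{j/3} ‖Δ_j g‖_{L³} → 0`, then the `L³` modulus of continuity of `g` at scale `ε` is
`o(ε^{1/3})`. -/
theorem tendsto_modulus {g : L2C} {A : ℝ≥0∞} (hA : A ≠ ⊤) (hgA : ∀ j, besovCoeff P g j ≤ A)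
    (hg : Tendsto (besovCoeff P g) atTop (𝓝 0)) : Tendsto (fun n => modulus n g) atTop (𝓝 0) := by
  obtain ⟨C, hC, h⟩ := modulus_le_tsum P
  have h1 : Tendsto (fun n : ℕ => ∑' k, dyadicWeight k * besovCoeff P g (n + k)) atTop (𝓝 0) := by
    -- The series is read as an integral for the counting measure on `ℤ`, so that dominated
    -- convergence applies with majorant `dyadicWeight k * A`.
    simp only [← lintegral_count]
    rw [← lintegral_zero (μ := (Measure.count : Measure ℤ))]
    refine tendsto_lintegral_of_dominated_convergence (fun k => dyadicWeight k * A)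
      (fun n => measurable_of_countable _) (fun n => .of_forall fun k => mul_le_mul_right (hgA _) _)
      ?_ (.of_forall fun k => ?_)
    · rw [lintegral_count, ENNReal.tsum_mul_right]
      exact ENNReal.mul_ne_top tsum_dyadicWeight_ne_top hA
    · have h2 : Tendsto (fun n : ℕ => (n : ℤ) + k) atTop atTop :=
        tendsto_atTop_add_const_right _ _ tendsto_natCast_atTop_atTop
      have h3 : dyadicWeight k ≠ ⊤ :=
        ne_top_of_le_ne_top tsum_dyadicWeight_ne_top (ENNReal.le_tsum k)
      simpa using ENNReal.Tendsto.const_mul (hg.comp h2) (.inr h3)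
  refine tendsto_of_tendsto_of_tendsto_of_le_of_le tendsto_const_nhds ?_
    (fun _ => zero_le) (h g)
  simpa using ENNReal.Tendsto.const_mul h1 (.inr hC)

theorem modulus_le : ∃ C : ℝ≥0∞, C ≠ ⊤ ∧ ∀ (g : L2C) (A : ℝ≥0∞), (∀ j, besovCoeff P g j ≤ A) →
    ∀ n : ℕ, modulus n g ≤ C * A := by
  obtain ⟨C, hC, h⟩ := modulus_le_tsum P
  refine ⟨C * ∑' k, dyadicWeight k, ENNReal.mul_ne_top hC tsum_dyadicWeight_ne_top,
    fun g A hA n => (h g n).trans ?_⟩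
  rw [mul_assoc, ← ENNReal.tsum_mul_right]
  gcongr
  exact hA _

/-- Interpolation of `L³` between `L²` and `L^{2p/(p-1)}`. -/
theorem eLpNorm_three_le {p : ℝ} (hp : p ∈ Ioc (1 : ℝ) 3) {f : E3 → ℂ}
    (hf : AEStronglyMeasurable f) :
    eLpNorm f 3 ≤ eLpNorm f 2 ^ (1 - p / 3) *
      eLpNorm f (ENNReal.ofReal (2 * p / (p - 1))) ^ (p / 3) := by
  obtain ⟨h1, h3⟩ := hp
  have hq : 0 < 2 * p / (p - 1) := div_pos (by linarith) (by linarith)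
  have hp1 : p - 1 ≠ 0 := by linarith
  rw [eLpNorm_eq_lintegral_rpow_enorm_toReal three_ne_zero ENNReal.ofNat_ne_top,
    eLpNorm_eq_lintegral_rpow_enorm_toReal two_ne_zero ENNReal.ofNat_ne_top,
    eLpNorm_eq_lintegral_rpow_enorm_toReal (by simpa using hq) ENNReal.ofReal_ne_top,
    ENNReal.toReal_ofReal hq.le]
  simp only [ENNReal.toReal_ofNat]
  -- Hölder with weights `(3 - p)/2` and `(p - 1)/2`: they add up to one and combine the exponents 2
  -- and `2p/(p-1)` into `(3 - p) + p = 3`.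
  have h := ENNReal.lintegral_mul_norm_pow_le (μ := (volume : Measure E3))
    (hf.enorm.pow_const (2 : ℝ)) (hf.enorm.pow_const (2 * p / (p - 1)))
    (p := (3 - p) / 2) (q := (p - 1) / 2) (by linarith) (by linarith) (by ring)
  have h2 : ∀ x, (‖f x‖ₑ ^ (2 : ℝ)) ^ ((3 - p) / 2) * (‖f x‖ₑ ^ (2 * p / (p - 1))) ^ ((p - 1) / 2)
      = ‖f x‖ₑ ^ (3 : ℝ) := by
    intro x
    rw [← ENNReal.rpow_mul, ← ENNReal.rpow_mul, ← ENNReal.rpow_add_of_nonneg]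
    · congr 1; field_simp; ring
    · linarith
    · positivity
  simp only [h2] at h
  refine (ENNReal.rpow_le_rpow h (by norm_num : (0 : ℝ) ≤ 1 / 3)).trans_eq ?_
  rw [ENNReal.mul_rpow_of_nonneg _ _ (by norm_num)]
  simp only [← ENNReal.rpow_mul]
  congr 2
  · ring
  · field_simp

/-- Raising the interpolated factor to the power `p/3` turns regularity `1/p` into `1/3` for every
`p`; the remaining power falls on the `L²` norm. -/
theorem besovCoeff_le {p : ℝ} (hp : p ∈ Ioc (1 : ℝ) 3) (g : L2C) (j : ℤ) :
    besovCoeff P g j ≤ ‖g‖ₑ ^ (1 - p / 3) * ((2 : ℝ≥0∞) ^ ((j : ℝ) * (1 / p)) *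
      distLpNorm (ENNReal.ofReal (2 * p / (p - 1)))
        (block P j (Lp.toTemperedDistribution g))) ^ (p / 3) := by
  have hp0 : 0 < p := by linarith [hp.1]
  have hq : 1 ≤ ENNReal.ofReal (2 * p / (p - 1)) := by
    rw [ENNReal.one_le_ofReal, le_div_iff₀ (by linarith [hp.1])]
    linarith
  rw [block_toTemperedDistribution, ENNReal.mul_rpow_of_nonneg _ _ (by positivity),
    ← ENNReal.rpow_mul, besovCoeff]
  have h1 : (j : ℝ) * (1 / p) * (p / 3) = (j : ℝ) / 3 := by field_simp
  rw [h1, mul_left_comm]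
  gcongr
  refine (eLpNorm_three_le hp (Lp.aestronglyMeasurable _)).trans ?_
  gcongr
  · linarith [hp.2]
  · rw [← Lp.enorm_def, ← ofReal_norm, ← ofReal_norm]
    exact ENNReal.ofReal_le_ofReal (norm_blockL2_le P j g)
  · exact eLpNorm_le_distLpNorm hq _

end Besov

/-! ### Mollification -/

section Mollification

open ContinuousLinearMap (lsmul)
open scoped Convolution

/-- The `i`-th partial derivative. -/
def pd (i : Fin 3) (f : E3 → ℝ) (x : E3) : ℝ := fderiv ℝ f x (EuclideanSpace.single i 1)

theorem contDiff_pd {f : E3 → ℝ} (hf : ContDiff ℝ ∞ f) (i : Fin 3) : ContDiff ℝ ∞ (pd i f) :=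
  (hf.fderiv_right (m := ∞) le_rfl).clm_apply contDiff_const

theorem hasCompactSupport_pd {f : E3 → ℝ} (hf : HasCompactSupport f) (i : Fin 3) :
    HasCompactSupport (pd i f) :=
  hf.fderiv_apply ℝ _

theorem pd_comm {f : E3 → ℝ} (hf : ContDiff ℝ ∞ f) (i j : Fin 3) :
    pd i (pd j f) = pd j (pd i f) := by
  ext x
  have hd : DifferentiableAt ℝ (fderiv ℝ f) x :=
    (hf.fderiv_right (m := ∞) le_rfl).differentiable (by simp) x
  have h : ∀ v w : E3, fderiv ℝ (fun y => fderiv ℝ f y v) x w = fderiv ℝ (fderiv ℝ f) x w v := by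
    intro v w
    rw [fderiv_clm_apply hd (differentiableAt_const v)]
    simp
  unfold pd
  rw [h, h]
  exact ((contDiff_infty.1 hf 2).contDiffAt.isSymmSndFDerivAt (by simp)) _ _

theorem pd_comp_sub_left {f : E3 → ℝ} (hf : ContDiff ℝ ∞ f) (i : Fin 3) (x : E3) :
    pd i (fun y => f (x - y)) = fun y => -pd i f (x - y) := by
  ext y
  have h1 : HasFDerivAt (fun y => x - y) (-ContinuousLinearMap.id ℝ E3) y :=
    (hasFDerivAt_id y).const_sub x
  have h2 := (hf.differentiable (by simp) (x - y)).hasFDerivAt.comp y h1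
  have h3 : fderiv ℝ (fun y => f (x - y)) y = _ := h2.fderiv
  simp [pd, h3]

theorem pd_mul {f g : E3 → ℝ} (hf : ContDiff ℝ ∞ f) (hg : ContDiff ℝ ∞ g) (i : Fin 3) (x : E3) :
    pd i (fun x => f x * g x) x = f x * pd i g x + g x * pd i f x := by
  simp only [pd]
  rw [fderiv_fun_mul (hf.differentiable (by simp) x) (hg.differentiable (by simp) x)]
  rfl

theorem fderiv_eq_sum_pd (f : E3 → ℝ) (x v : E3) : fderiv ℝ f x v = ∑ i, v i * pd i f x := by
  have h : v = ∑ i, v i • EuclideanSpace.single i (1 : ℝ) := by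
    ext j
    simp [Pi.single_apply]
  conv_lhs => rw [h]
  simp [pd]

variable {F : Type*} [NormedAddCommGroup F] [NormedSpace ℝ F]

theorem contDiff_conv {k : E3 → ℝ} (hk : ContDiff ℝ ∞ k) (hk' : HasCompactSupport k)
    {f : E3 → F} (hf : LocallyIntegrable f) : ContDiff ℝ ∞ (k ⋆[lsmul ℝ ℝ] f) :=
  hk'.contDiff_convolution_left (lsmul ℝ ℝ) hk hf

theorem integrable_conv_integrand {k : E3 → ℝ} (hk : ContDiff ℝ ∞ k) (hk' : HasCompactSupport k)
    {f : E3 → F} (hf : LocallyIntegrable f) (x : E3) : Integrable fun y => k y • f (x - y) :=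
  hk'.convolutionExists_left (lsmul ℝ ℝ) hk.continuous hf x

theorem fderiv_conv [CompleteSpace F] {k : E3 → ℝ} (hk : ContDiff ℝ ∞ k) (hk' : HasCompactSupport k)
    {f : E3 → F} (hf : LocallyIntegrable f) (x v : E3) :
    fderiv ℝ (k ⋆[lsmul ℝ ℝ] f) x v = ((fun y => fderiv ℝ k y v) ⋆[lsmul ℝ ℝ] f) x := by
  have hk1 : ContDiff ℝ 1 k := hk.of_le (by simp)
  rw [(hk'.hasFDerivAt_convolution_left (lsmul ℝ ℝ) hk1 hf x).fderiv]
  have hi := (hk'.fderiv ℝ).convolutionExists_left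
    ((lsmul ℝ ℝ : ℝ →L[ℝ] F →L[ℝ] F).precompL E3) (hk1.continuous_fderiv one_ne_zero) hf x
  rw [MeasureTheory.convolution, ContinuousLinearMap.integral_apply hi]
  rfl

theorem pd_conv {k : E3 → ℝ} (hk : ContDiff ℝ ∞ k) (hk' : HasCompactSupport k)
    {f : E3 → ℝ} (hf : LocallyIntegrable f) (i : Fin 3) :
    pd i (k ⋆[lsmul ℝ ℝ] f) = pd i k ⋆[lsmul ℝ ℝ] f := by
  ext x
  exact fderiv_conv hk hk' hf x _

theorem conv_apply_coord {k : E3 → ℝ} (hk : ContDiff ℝ ∞ k) (hk' : HasCompactSupport k)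
    {f : E3 → E3} (hf : LocallyIntegrable f) (x : E3) (i : Fin 3) :
    (k ⋆[lsmul ℝ ℝ] f) x i = (k ⋆[lsmul ℝ ℝ] (fun y => f y i)) x := by
  have := (EuclideanSpace.proj i : E3 →L[ℝ] ℝ).integral_comp_comm
    (integrable_conv_integrand hk hk' hf x)
  simpa [MeasureTheory.convolution] using this.symm

theorem integrable_of_contDiff {k : E3 → ℝ} (hk : ContDiff ℝ ∞ k) (hk' : HasCompactSupport k) :
    Integrable k :=
  hk.continuous.integrable_of_hasCompactSupport hk'

theorem memLp_conv {k : E3 → ℝ} (hk : ContDiff ℝ ∞ k) (hk' : HasCompactSupport k)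
    {f : E3 → F} {p : ℝ≥0∞} (hp : 1 ≤ p) (hp' : p ≠ ⊤) (hf : MemLp f p) :
    MemLp (k ⋆[lsmul ℝ ℝ] f) p :=
  MemLp.convolution_left hp hp' (integrable_of_contDiff hk hk') hf

/-- Standard mollifiers at scale `2^{-n}`. -/
def mollBump (n : ℕ) : ContDiffBump (0 : E3) where
  rIn := (2 : ℝ) ^ (-(n : ℝ)) / 2
  rOut := (2 : ℝ) ^ (-(n : ℝ))
  rIn_pos := by positivity
  rIn_lt_rOut := half_lt_self (by positivity)

/-- The standard mollifier at scale `2^{-n}`. -/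
def moll (n : ℕ) : E3 → ℝ := (mollBump n).normed volume

theorem contDiff_moll (n : ℕ) : ContDiff ℝ ∞ (moll n) := (mollBump n).contDiff_normed

theorem hasCompactSupport_moll (n : ℕ) : HasCompactSupport (moll n) :=
  (mollBump n).hasCompactSupport_normed

theorem moll_neg (n : ℕ) (x : E3) : moll n (-x) = moll n x := (mollBump n).normed_neg x

theorem moll_nonneg (n : ℕ) (x : E3) : 0 ≤ moll n x := (mollBump n).nonneg_normed x

theorem integral_moll (n : ℕ) : ∫ x, moll n x = 1 := (mollBump n).integral_normed

theorem integrable_moll (n : ℕ) : Integrable (moll n) :=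
  integrable_of_contDiff (contDiff_moll n) (hasCompactSupport_moll n)

theorem lintegral_enorm_moll (n : ℕ) : ∫⁻ x, ‖moll n x‖ₑ = 1 := by
  rw [← ofReal_integral_norm_eq_lintegral_enorm (integrable_moll n)]
  simp [Real.norm_of_nonneg (moll_nonneg n _), integral_moll]

theorem norm_lt_of_moll_ne_zero {n : ℕ} {x : E3} (h : moll n x ≠ 0) :
    ‖x‖ < (2 : ℝ) ^ (-(n : ℝ)) := by
  have : x ∈ Function.support ((mollBump n).normed volume) := h
  rw [ContDiffBump.support_normed_eq] at this
  simpa [mollBump] using this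

theorem ae_tendsto_moll_conv {f : E3 → F} [CompleteSpace F] (hf : LocallyIntegrable f) :
    ∀ᵐ x, Tendsto (fun n => (moll n ⋆[lsmul ℝ ℝ] f) x) atTop (𝓝 (f x)) := by
  -- The outer and inner radii stay in the fixed ratio 2, the condition needed for Lebesgue
  -- differentiation.
  refine ContDiffBump.ae_convolution_tendsto_right_of_locallyIntegrable (φ := mollBump) (K := 2)
    ?_ (.of_forall fun n => ?_) hf
  · have : Tendsto (fun n : ℕ => ((1 / 2 : ℝ)) ^ n) atTop (𝓝 0) :=
      tendsto_pow_atTop_nhds_zero_of_lt_one (by norm_num) (by norm_num)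
    refine this.congr fun n => ?_
    simp [mollBump, Real.rpow_neg two_pos.le]
  · simp only [mollBump]
    linarith

/-- Liouville's theorem for square integrable weakly harmonic functions. -/
theorem ae_eq_zero_of_weakly_harmonic {g : E3 → ℝ} (hg : MemLp g 2)
    (h : ∀ φ : E3 → ℝ, ContDiff ℝ ∞ φ → HasCompactSupport φ →
      ∫ x, (∑ j, pd j (pd j φ) x) * g x = 0) : g =ᵐ[volume] 0 := by
  have hloc : LocallyIntegrable g := hg.locallyIntegrable one_le_two
  -- Mollifications converge to `g` almost everywhere, and each is smooth, square integrable along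
  -- with its derivatives, and genuinely harmonic.
  suffices hz : ∀ n, moll n ⋆[lsmul ℝ ℝ] g = 0 by
    filter_upwards [ae_tendsto_moll_conv hloc] with x hx
    simp only [hz, Pi.zero_apply] at hx
    exact (tendsto_nhds_unique tendsto_const_nhds hx).symm
  intro n
  set k := moll n
  have hk : ContDiff ℝ ∞ k := contDiff_moll n
  have hk' : HasCompactSupport k := hasCompactSupport_moll n
  set w := k ⋆[lsmul ℝ ℝ] g
  have hw : ContDiff ℝ ∞ w := contDiff_conv hk hk' hloc
  have hw2 : MemLp w 2 := memLp_conv hk hk' one_le_two ENNReal.ofNat_ne_top hg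
  have hpd : ∀ j, pd j w = pd j k ⋆[lsmul ℝ ℝ] g := pd_conv hk hk' hloc
  have hpd2 : ∀ j, pd j (pd j w) = pd j (pd j k) ⋆[lsmul ℝ ℝ] g := fun j => by
    rw [hpd, pd_conv (contDiff_pd hk j) (hasCompactSupport_pd hk' j) hloc]
  have hm1 : ∀ j, MemLp (pd j w) 2 := fun j => hpd j ▸
    memLp_conv (contDiff_pd hk j) (hasCompactSupport_pd hk' j) one_le_two ENNReal.ofNat_ne_top hg
  have hm2 : ∀ j, MemLp (pd j (pd j w)) 2 := fun j => hpd2 j ▸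
    memLp_conv (contDiff_pd (contDiff_pd hk j) j)
      (hasCompactSupport_pd (hasCompactSupport_pd hk' j) j) one_le_two ENNReal.ofNat_ne_top hg
  have hlap : ∀ x, ∑ j, pd j (pd j w) x = 0 := by
    intro x
    have hφ : ContDiff ℝ ∞ fun y => k (x - y) := hk.comp (contDiff_const.sub contDiff_id)
    have hφ' : HasCompactSupport fun y => k (x - y) :=
      hk'.comp_homeomorph (Homeomorph.subLeft x)
    have h1 := h _ hφ hφ'
    have h2 : ∀ j, pd j (pd j (fun y => k (x - y))) = fun y => pd j (pd j k) (x - y) := by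
      intro j
      have h3 : pd j (fun y => k (x - y)) = fun y => (-1) * pd j k (x - y) := by
        rw [pd_comp_sub_left hk]; ext y; ring
      have h4 : ContDiff ℝ ∞ fun y => pd j k (x - y) :=
        (contDiff_pd hk j).comp (contDiff_const.sub contDiff_id)
      ext y
      rw [h3, pd_mul contDiff_const h4, pd_comp_sub_left (contDiff_pd hk j)]
      simp [pd]
    simp only [h2] at h1
    have h5 : ∀ j, pd j (pd j w) x = ∫ y, pd j (pd j k) (x - y) * g y := by
      intro j
      rw [hpd2, convolution_eq_swap]
      rfl
    have h6 : ∀ j, Integrable fun y => pd j (pd j k) (x - y) * g y := by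
      intro j
      have := (integrable_conv_integrand (contDiff_pd (contDiff_pd hk j) j)
        (hasCompactSupport_pd (hasCompactSupport_pd hk' j) j) hloc x).comp_sub_left x
      simpa using this
    simp only [h5]
    rw [← integral_finsetSum _ fun j _ => h6 j]
    simpa only [Finset.sum_mul] using h1
  have hint : ∀ j, Integrable fun x => pd j w x * pd j w x :=
    fun j => (hm1 j).integrable_mul (hm1 j)
  -- Pairing `Δw = 0` with `w` and integrating by parts yields `∫ |∇w|² = 0`, so `w` is constant.
  have hbp : ∀ j, ∫ x, w x * pd j (pd j w) x = -∫ x, pd j w x * pd j w x := fun j =>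
    integral_mul_fderiv_eq_neg_fderiv_mul_of_integrable (hint j)
      (hw2.integrable_mul (hm2 j)) (hw2.integrable_mul (hm1 j))
      (fun x _ => hw.differentiable (by simp) x)
      (fun x _ => (contDiff_pd hw j).differentiable (by simp) x)
  have hsum : ∑ j, ∫ x, pd j w x * pd j w x = 0 := by
    have h1 : ∑ j, ∫ x, w x * pd j (pd j w) x = 0 := by
      have h2 : ∀ j, Integrable fun x => w x * pd j (pd j w) x :=
        fun j => hw2.integrable_mul (hm2 j)
      rw [← integral_finsetSum _ fun j _ => h2 j]
      simp [← Finset.mul_sum, hlap]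
    simpa [hbp] using h1
  have hzero : ∀ j x, pd j w x = 0 := by
    intro j
    have h1 := (Finset.sum_eq_zero_iff_of_nonneg fun j _ =>
      integral_nonneg fun x => mul_self_nonneg (pd j w x)).1 hsum j (Finset.mem_univ _)
    rw [integral_eq_zero_iff_of_nonneg (fun x => mul_self_nonneg _) (hint j)] at h1
    have h2 := (contDiff_pd hw j).continuous
    have h3 := ((h2.mul h2).ae_eq_iff_eq volume continuous_zero).1 h1
    intro x
    exact mul_self_eq_zero.1 (congrFun h3 x)
  have hconst : ∀ x, w x = w 0 := fun x =>
    is_const_of_fderiv_eq_zero (𝕜 := ℝ) (hw.differentiable (by simp))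
      (fun y => by ext v; simp [fderiv_eq_sum_pd, hzero]) x 0
  have h1 : w = fun _ => w 0 := funext hconst
  have h2 := hw2.2
  -- A constant that is square integrable over a space of infinite measure is zero.
  rw [h1, eLpNorm_const_lt_top_iff two_ne_zero ENNReal.ofNat_ne_top] at h2
  rw [h1]
  rcases h2 with h2 | h2
  · rw [h2]; rfl
  · simp at h2

end Mollification

/-! ### Divergence-free fields -/

section DivFree

theorem contDiff_coord {Φ : E3 → E3} (h : ContDiff ℝ ∞ Φ) (i : Fin 3) :
    ContDiff ℝ ∞ fun x => Φ x i := contDiff_euclidean.1 h i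

theorem hasCompactSupport_coord {Φ : E3 → E3} (h : HasCompactSupport Φ) (i : Fin 3) :
    HasCompactSupport fun x => Φ x i := h.comp_left (g := fun v : E3 => v i) rfl

theorem fderiv_coord {Φ : E3 → E3} {x : E3} (h : DifferentiableAt ℝ Φ x) (v : E3) (i : Fin 3) :
    (fderiv ℝ Φ x v) i = fderiv ℝ (fun y => Φ y i) x v := by
  have := ((EuclideanSpace.proj i : E3 →L[ℝ] ℝ).hasFDerivAt.comp x h.hasFDerivAt).fderiv
  have h2 : fderiv ℝ (fun y => Φ y i) x = _ := this
  rw [h2]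
  rfl

theorem divergence_eq_sum_pd {Φ : E3 → E3} (h : ContDiff ℝ ∞ Φ) (x : E3) :
    divergence Φ x = ∑ i, pd i (fun y => Φ y i) x :=
  Finset.sum_congr rfl fun i _ => fderiv_coord (h.differentiable (by simp) x) _ i

theorem memLp_coord {v : E3 → E3} {p : ℝ≥0∞} (hv : MemLp v p) (i : Fin 3) :
    MemLp (fun x => v x i) p :=
  (EuclideanSpace.proj i : E3 →L[ℝ] ℝ).comp_memLp' hv

/-- The gradient of a test function, as a square integrable field. -/
def gradL2 (φ : E3 → ℝ) (hφ : ContDiff ℝ ∞ φ) (hφ' : HasCompactSupport φ) : L2Field :=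
  MemLp.toLp (fun x => (InnerProductSpace.toDual ℝ E3).symm (fderiv ℝ φ x))
    (Continuous.memLp_of_hasCompactSupport
      ((InnerProductSpace.toDual ℝ E3).symm.continuous.comp (hφ.continuous_fderiv (by simp)))
      ((hφ'.fderiv ℝ).comp_left (map_zero (InnerProductSpace.toDual ℝ E3).symm)))

theorem integral_fderiv_eq_inner {φ : E3 → ℝ} (hφ : ContDiff ℝ ∞ φ) (hφ' : HasCompactSupport φ)
    (v : L2Field) : ∫ x, fderiv ℝ φ x (v x) = inner ℝ (gradL2 φ hφ hφ') v := by
  rw [L2.inner_def]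
  refine integral_congr_ae ?_
  filter_upwards [MemLp.coeFn_toLp (μ := (volume : Measure E3))
    (Continuous.memLp_of_hasCompactSupport (p := 2)
      ((InnerProductSpace.toDual ℝ E3).symm.continuous.comp (hφ.continuous_fderiv (by simp)))
      ((hφ'.fderiv ℝ).comp_left (map_zero (InnerProductSpace.toDual ℝ E3).symm)))] with x hx
  have h2 : gradL2 φ hφ hφ' x = (InnerProductSpace.toDual ℝ E3).symm (fderiv ℝ φ x) := hx
  rw [h2, InnerProductSpace.toDual_symm_apply]

/-- The space of weakly divergence-free square integrable fields. -/
def divFreeL2 : Submodule ℝ L2Field where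
  carrier := {v | ∀ φ : E3 → ℝ, ContDiff ℝ ∞ φ → HasCompactSupport φ →
    ∫ x, fderiv ℝ φ x (v x) = 0}
  add_mem' := fun {v w} hv hw φ hφ hφ' => by
    have h1 := hv φ hφ hφ'
    have h2 := hw φ hφ hφ'
    rw [integral_fderiv_eq_inner hφ hφ'] at h1 h2 ⊢
    rw [inner_add_right, h1, h2, add_zero]
  zero_mem' := fun φ hφ hφ' => by rw [integral_fderiv_eq_inner hφ hφ', inner_zero_right]
  smul_mem' := fun c v hv φ hφ hφ' => by
    have h1 := hv φ hφ hφ'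
    rw [integral_fderiv_eq_inner hφ hφ'] at h1 ⊢
    rw [inner_smul_right, h1, mul_zero]

theorem isClosed_divFreeL2 : IsClosed (divFreeL2 : Set L2Field) := by
  have : (divFreeL2 : Set L2Field) = ⋂ (φ : E3 → ℝ) (hφ : ContDiff ℝ ∞ φ)
      (hφ' : HasCompactSupport φ), {v | inner ℝ (gradL2 φ hφ hφ') v = 0} := by
    ext v
    simp only [mem_iInter, mem_ofPred_eq]
    exact forall_congr' fun φ => forall_congr' fun hφ => forall_congr' fun hφ' => by
      rw [integral_fderiv_eq_inner hφ hφ']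
  rw [this]
  exact isClosed_iInter fun φ => isClosed_iInter fun hφ => isClosed_iInter fun hφ' =>
    isClosed_eq (by fun_prop) continuous_const

theorem divergence_add {Φ Ψ : E3 → E3} (hΦ : ContDiff ℝ ∞ Φ) (hΨ : ContDiff ℝ ∞ Ψ) (x : E3) :
    divergence (Φ + Ψ) x = divergence Φ x + divergence Ψ x := by
  simp only [divergence]
  rw [fderiv_add (hΦ.differentiable (by simp) x) (hΨ.differentiable (by simp) x)]
  simp [Finset.sum_add_distrib]

theorem divergence_smul {Φ : E3 → E3} (hΦ : ContDiff ℝ ∞ Φ) (c : ℝ) (x : E3) :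
    divergence (c • Φ) x = c * divergence Φ x := by
  simp only [divergence]
  rw [fderiv_const_smul (hΦ.differentiable (by simp) x)]
  simp [Finset.mul_sum]

/-- The space of smooth, compactly supported, divergence-free fields. -/
def testL2 : Submodule ℝ L2Field where
  carrier := {v | ∃ Φ : E3 → E3, ContDiff ℝ ∞ Φ ∧ HasCompactSupport Φ ∧
    (∀ x, divergence Φ x = 0) ∧ v =ᵐ[volume] Φ}
  add_mem' := by
    rintro v w ⟨Φ, h1, h2, h3, h4⟩ ⟨Ψ, h1', h2', h3', h4'⟩
    exact ⟨Φ + Ψ, h1.add h1', h2.add h2', fun x => by rw [divergence_add h1 h1', h3, h3', add_zero],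
      (Lp.coeFn_add v w).trans (h4.add h4')⟩
  zero_mem' := ⟨0, contDiff_const, HasCompactSupport.zero, fun x => by simp [divergence],
    Lp.coeFn_zero _ _ _⟩
  smul_mem' := by
    rintro c v ⟨Φ, h1, h2, h3, h4⟩
    exact ⟨c • Φ, contDiff_const.smul h1, h2.smul_left (f := fun _ => c),
      fun x => by rw [divergence_smul h1, h3, mul_zero],
      (Lp.coeFn_smul c v).trans (h4.const_smul c)⟩

theorem testL2_le_divFreeL2 : testL2 ≤ divFreeL2 := by
  rintro v ⟨Φ, h1, h2, h3, h4⟩ φ hφ hφ'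
  have hint : ∀ f g : E3 → ℝ, ContDiff ℝ ∞ f → ContDiff ℝ ∞ g → HasCompactSupport f →
      Integrable fun x => f x * g x := fun f g hf hg hf' =>
    (hf.continuous.mul hg.continuous).integrable_of_hasCompactSupport hf'.mul_right
  have h5 : ∀ i, ∫ x, Φ x i * pd i φ x = -∫ x, pd i (fun y => Φ y i) x * φ x := fun i =>
    integral_mul_fderiv_eq_neg_fderiv_mul_of_integrable
      (hint _ _ (contDiff_pd (contDiff_coord h1 i) i) hφ
        (hasCompactSupport_pd (hasCompactSupport_coord h2 i) i))
      (hint _ _ (contDiff_coord h1 i) (contDiff_pd hφ i) (hasCompactSupport_coord h2 i))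
      (hint _ _ (contDiff_coord h1 i) hφ (hasCompactSupport_coord h2 i))
      (fun x _ => (contDiff_coord h1 i).differentiable (by simp) x)
      (fun x _ => hφ.differentiable (by simp) x)
  calc ∫ x, fderiv ℝ φ x (v x) = ∫ x, ∑ i, Φ x i * pd i φ x := by
        refine integral_congr_ae ?_
        filter_upwards [h4] with x hx
        rw [hx, fderiv_eq_sum_pd]
    _ = ∑ i, ∫ x, Φ x i * pd i φ x := integral_finsetSum _ fun i _ =>
        hint _ _ (contDiff_coord h1 i) (contDiff_pd hφ i) (hasCompactSupport_coord h2 i)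
    _ = -∫ x, ∑ i, pd i (fun y => Φ y i) x * φ x := by
        simp only [h5]
        rw [Finset.sum_neg_distrib, integral_finsetSum _ fun i _ =>
          hint _ _ (contDiff_pd (contDiff_coord h1 i) i) hφ
            (hasCompactSupport_pd (hasCompactSupport_coord h2 i) i)]
    _ = 0 := by simp [← Finset.sum_mul, ← divergence_eq_sum_pd h1, h3]

/-- The field `Δφ e_i - ∇ ∂_i φ`. -/
def doubleCurl (φ : E3 → ℝ) (i : Fin 3) (x : E3) : E3 :=
  WithLp.toLp 2 fun l => (if l = i then ∑ j, pd j (pd j φ) x else 0) - pd l (pd i φ) x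

theorem contDiff_laplace {φ : E3 → ℝ} (hφ : ContDiff ℝ ∞ φ) :
    ContDiff ℝ ∞ fun x => ∑ j, pd j (pd j φ) x :=
  ContDiff.sum fun j _ => contDiff_pd (contDiff_pd hφ j) j

theorem contDiff_doubleCurl {φ : E3 → ℝ} (hφ : ContDiff ℝ ∞ φ) (i : Fin 3) :
    ContDiff ℝ ∞ (doubleCurl φ i) := by
  refine contDiff_euclidean.2 fun l => ?_
  simp only [doubleCurl]
  split_ifs
  · exact (contDiff_laplace hφ).sub (contDiff_pd (contDiff_pd hφ i) l)
  · exact contDiff_const.sub (contDiff_pd (contDiff_pd hφ i) l)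

theorem hasCompactSupport_doubleCurl {φ : E3 → ℝ} (hφ : HasCompactSupport φ) (i : Fin 3) :
    HasCompactSupport (doubleCurl φ i) := by
  refine hφ.mono' fun x hx => ?_
  by_contra hx'
  refine hx ?_
  have h : ∀ j l, pd j (pd l φ) x = 0 := by
    intro j l
    refine image_eq_zero_of_notMem_tsupport fun h => hx' ?_
    exact (tsupport_fderiv_apply_subset ℝ _).trans (tsupport_fderiv_apply_subset ℝ _) h
  ext l
  simp [doubleCurl, h]

theorem pd_sub {f g : E3 → ℝ} (hf : ContDiff ℝ ∞ f) (hg : ContDiff ℝ ∞ g) (i : Fin 3) (x : E3) :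
    pd i (fun x => f x - g x) x = pd i f x - pd i g x := by
  simp only [pd]
  rw [fderiv_fun_sub (hf.differentiable (by simp) x) (hg.differentiable (by simp) x)]
  rfl

theorem pd_sum {f : Fin 3 → E3 → ℝ} (hf : ∀ j, ContDiff ℝ ∞ (f j)) (i : Fin 3) (x : E3) :
    pd i (fun x => ∑ j, f j x) x = ∑ j, pd i (f j) x := by
  simp only [pd]
  rw [fderiv_fun_sum fun j _ => (hf j).differentiable (by simp) x]
  simp

/-- The divergence is `∂_i Δφ - Δ ∂_i φ`, and partial derivatives commute. -/
theorem divergence_doubleCurl {φ : E3 → ℝ} (hφ : ContDiff ℝ ∞ φ) (i : Fin 3) (x : E3) :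
    divergence (doubleCurl φ i) x = 0 := by
  rw [divergence_eq_sum_pd (contDiff_doubleCurl hφ i)]
  have h : ∀ l, pd l (fun y => doubleCurl φ i y l) x
      = (if l = i then ∑ j, pd l (pd j (pd j φ)) x else 0) - pd l (pd l (pd i φ)) x := by
    intro l
    simp only [doubleCurl]
    split_ifs with hl
    · rw [pd_sub (contDiff_laplace hφ) (contDiff_pd (contDiff_pd hφ i) l),
        pd_sum fun j => contDiff_pd (contDiff_pd hφ j) j]
    · rw [pd_sub contDiff_const (contDiff_pd (contDiff_pd hφ i) l)]
      simp [pd]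
  simp only [h, Finset.sum_sub_distrib, Finset.sum_ite_eq', Finset.mem_univ, if_true]
  rw [← Finset.sum_sub_distrib]
  refine Finset.sum_eq_zero fun j _ => ?_
  rw [pd_comm (contDiff_pd hφ j) i j, pd_comm hφ i j, sub_self]

/-- A weakly divergence-free `L²` field orthogonal to all divergence-free test fields vanishes. -/
theorem eq_zero_of_orthogonal {v : L2Field} (hv : v ∈ divFreeL2) (h : v ∈ testL2ᗮ) : v = 0 := by
  have hcoord : ∀ i, (fun x => v x i) =ᵐ[volume] 0 := by
    intro i
    -- Orthogonality to `doubleCurl φ i` reads `∫ Δφ v_i = ∫ ∇∂_iφ · v`, and the right side vanishes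
    -- because `v` is weakly divergence free.
    refine ae_eq_zero_of_weakly_harmonic (memLp_coord (Lp.memLp v) i) fun φ hφ hφ' => ?_
    have hm : MemLp (doubleCurl φ i) 2 := (contDiff_doubleCurl hφ i).continuous
      |>.memLp_of_hasCompactSupport (hasCompactSupport_doubleCurl hφ' i)
    have h1 : inner ℝ (hm.toLp) v = 0 :=
      (Submodule.mem_orthogonal _ _).1 h _ ⟨_, contDiff_doubleCurl hφ i,
        hasCompactSupport_doubleCurl hφ' i, divergence_doubleCurl hφ i, hm.coeFn_toLp⟩
    have h2 := hv (pd i φ) (contDiff_pd hφ i) (hasCompactSupport_pd hφ' i)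
    have h3 : inner ℝ (hm.toLp) v
        = ∫ x, ((∑ j, pd j (pd j φ) x) * v x i - fderiv ℝ (pd i φ) x (v x)) := by
      rw [L2.inner_def]
      refine integral_congr_ae ?_
      filter_upwards [hm.coeFn_toLp] with x hx
      rw [hx, fderiv_eq_sum_pd]
      simp only [doubleCurl, PiLp.inner_apply, RCLike.inner_apply, conj_trivial, mul_sub,
        Finset.sum_sub_distrib, mul_ite, mul_zero, Finset.sum_ite_eq', Finset.mem_univ, if_true]
      ring
    have hi1 : Integrable fun x => (∑ j, pd j (pd j φ) x) * v x i := by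
      have hc : HasCompactSupport fun x => ∑ j, pd j (pd j φ) x := by
        refine hφ'.mono' fun x hx => ?_
        by_contra hx'
        refine hx (Finset.sum_eq_zero fun j _ => image_eq_zero_of_notMem_tsupport fun h => hx' ?_)
        exact (tsupport_fderiv_apply_subset ℝ _).trans (tsupport_fderiv_apply_subset ℝ _) h
      exact ((contDiff_laplace hφ).continuous.memLp_of_hasCompactSupport (p := 2) hc).integrable_mul
        (memLp_coord (Lp.memLp v) i)
    have hi2 : Integrable fun x => fderiv ℝ (pd i φ) x (v x) := by
      simp only [fderiv_eq_sum_pd]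
      refine integrable_finsetSum _ fun j _ => (memLp_coord (Lp.memLp v) j).integrable_mul
        ((contDiff_pd (contDiff_pd hφ i) j).continuous.memLp_of_hasCompactSupport (p := 2)
          (hasCompactSupport_pd (hasCompactSupport_pd hφ' i) j))
    rw [h3, integral_sub hi1 hi2, h2, sub_zero] at h1
    exact h1
  refine Lp.ext ?_
  filter_upwards [hcoord 0, hcoord 1, hcoord 2, Lp.coeFn_zero E3 2 volume] with x h0 h1 h2 h3
  rw [h3]
  ext i
  fin_cases i
  exacts [h0, h1, h2]

/-- Divergence-free test fields are dense in the divergence-free `L²` fields. -/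
theorem divFreeL2_le_closure : divFreeL2 ≤ testL2.topologicalClosure := by
  intro v hv
  have hle : testL2.topologicalClosure ≤ divFreeL2 :=
    testL2.topologicalClosure_minimal testL2_le_divFreeL2 isClosed_divFreeL2
  have : CompleteSpace testL2.topologicalClosure :=
    testL2.isClosed_topologicalClosure.completeSpace_coe
  -- The part `z` orthogonal to the closure is a difference of divergence-free fields, hence
  -- divergence free, and `eq_zero_of_orthogonal` applies to it.
  obtain ⟨y, hy, z, hz, rfl⟩ :=
    Submodule.exists_add_mem_mem_orthogonal (K := testL2.topologicalClosure) v
  have hz0 : z = 0 := by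
    refine eq_zero_of_orthogonal ?_ (Submodule.orthogonal_le testL2.le_topologicalClosure hz)
    have := divFreeL2.sub_mem hv (hle hy)
    rwa [add_sub_cancel_left] at this
  rwa [hz0, add_zero]

end DivFree

/-! ### The mollified momentum flux -/

section Flux

open ContinuousLinearMap (lsmul)
open scoped Convolution

/-- An even smooth compactly supported kernel. -/
structure IsEvenKernel (k : E3 → ℝ) : Prop where
  smooth : ContDiff ℝ ∞ k
  compact : HasCompactSupport k
  even : ∀ x, k (-x) = k x

theorem isEvenKernel_moll (n : ℕ) : IsEvenKernel (moll n) :=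
  ⟨contDiff_moll n, hasCompactSupport_moll n, moll_neg n⟩

variable {k : E3 → ℝ}

theorem IsEvenKernel.integrable (hk : IsEvenKernel k) : Integrable k :=
  integrable_of_contDiff hk.smooth hk.compact

theorem locallyIntegrable_L2 (v : L2Field) : LocallyIntegrable v :=
  (Lp.memLp v).locallyIntegrable one_le_two

/-- The mollification operator. -/
def smoothing (hk : IsEvenKernel k) : L2Field →L[ℝ] L2Field := convL2 E3 k hk.integrable

theorem coeFn_smoothing (hk : IsEvenKernel k) (v : L2Field) :
    smoothing hk v =ᵐ[volume] k ⋆[lsmul ℝ ℝ] v :=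
  coeFn_convL2 hk.integrable v

theorem lintegral_enorm_mul_enorm_le {G H : Type*} [NormedAddCommGroup G] [NormedAddCommGroup H]
    {f : E3 → G} {g : E3 → H} (hf : AEStronglyMeasurable f) (hg : AEStronglyMeasurable g) :
    ∫⁻ x, ‖f x‖ₑ * ‖g x‖ₑ ≤ eLpNorm f 2 * eLpNorm g 2 := by
  have h := ENNReal.lintegral_mul_le_Lp_mul_Lq (volume : Measure E3)
    Real.HolderConjugate.two_two hf.enorm hg.enorm
  rw [eLpNorm_eq_lintegral_rpow_enorm_toReal two_ne_zero ENNReal.ofNat_ne_top,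
    eLpNorm_eq_lintegral_rpow_enorm_toReal two_ne_zero ENNReal.ofNat_ne_top]
  simpa using h

theorem aestronglyMeasurable_kernel_mul_inner (hk : IsEvenKernel k) (v w : L2Field) :
    AEStronglyMeasurable (fun z : E3 × E3 => k z.2 * inner ℝ (v (z.1 - z.2)) (w z.1))
      (volume.prod volume) := by
  have h := (hk.smooth.continuous.aestronglyMeasurable (μ := volume)).convolution_integrand
    (lsmul ℝ ℝ) (Lp.aestronglyMeasurable v) (μ := volume)
  have h' := h.inner (𝕜 := ℝ)
    ((Lp.aestronglyMeasurable w).comp_fst (ν := (volume : Measure E3)))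
  refine h'.congr (.of_forall fun z => ?_)
  simp [inner_smul_left]

theorem lintegral_enorm_inner_sub_le (v w : L2Field) (y : E3) :
    ∫⁻ x, ‖(inner ℝ (v (x - y)) (w x) : ℝ)‖ₑ ≤ eLpNorm v 2 * eLpNorm w 2 := by
  have hmp := measurePreserving_sub_right (volume : Measure E3) y
  have h1 : ∀ x, ‖(inner ℝ (v (x - y)) (w x) : ℝ)‖ₑ ≤ ‖v (x - y)‖ₑ * ‖w x‖ₑ := by
    intro x
    rw [← ofReal_norm, ← ofReal_norm, ← ofReal_norm, ← ENNReal.ofReal_mul (norm_nonneg _)]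
    exact ENNReal.ofReal_le_ofReal (norm_inner_le_norm _ _)
  refine (lintegral_mono h1).trans ?_
  rw [← eLpNorm_comp_measurePreserving (Lp.aestronglyMeasurable v) hmp]
  exact lintegral_enorm_mul_enorm_le
    ((Lp.aestronglyMeasurable v).comp_measurePreserving hmp) (Lp.aestronglyMeasurable w)

theorem integrable_kernel_mul_inner (hk : IsEvenKernel k) (v w : L2Field) :
    Integrable (fun z : E3 × E3 => k z.2 * inner ℝ (v (z.1 - z.2)) (w z.1))
      (volume.prod volume) := by
  have hm := aestronglyMeasurable_kernel_mul_inner hk v w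
  refine ⟨hm, ?_⟩
  have h1 : ∫⁻ z, ‖k z.2 * inner ℝ (v (z.1 - z.2)) (w z.1)‖ₑ ∂(volume.prod volume)
      = ∫⁻ y, ‖k y‖ₑ * ∫⁻ x, ‖(inner ℝ (v (x - y)) (w x) : ℝ)‖ₑ := by
    rw [lintegral_prod_symm _ hm.enorm]
    refine lintegral_congr fun y => ?_
    rw [← lintegral_const_mul' _ _ enorm_ne_top]
    refine lintegral_congr fun x => ?_
    rw [enorm_mul]
  rw [HasFiniteIntegral, h1]
  have h2 : eLpNorm v 2 * eLpNorm w 2 < ⊤ := ENNReal.mul_lt_top (Lp.memLp v).2 (Lp.memLp w).2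
  refine (lintegral_mono fun y =>
    mul_le_mul_right (lintegral_enorm_inner_sub_le v w y) _).trans_lt ?_
  rw [lintegral_mul_const' _ _ h2.ne]
  exact ENNReal.mul_lt_top hk.integrable.2 h2

theorem inner_smoothing_eq_integral (hk : IsEvenKernel k) (v w : L2Field) :
    inner ℝ v (smoothing hk w) = ∫ x, ∫ y, k y * inner ℝ (v x) (w (x - y)) := by
  rw [L2.inner_def]
  refine integral_congr_ae ?_
  filter_upwards [coeFn_smoothing hk w] with x hx
  have hi := integrable_conv_integrand hk.smooth hk.compact (locallyIntegrable_L2 w) x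
  rw [hx, MeasureTheory.convolution]
  simp only [ContinuousLinearMap.lsmul_apply]
  rw [← integral_inner hi]
  simp only [inner_smul_right]

/-- Mollification with an even kernel is symmetric. -/
theorem inner_smoothing (hk : IsEvenKernel k) (v w : L2Field) :
    inner ℝ (smoothing hk v) w = inner ℝ v (smoothing hk w) := by
  have h0 : ∀ x y, inner ℝ (w x) (v (x - y)) = inner ℝ (v (x - y)) (w x) :=
    fun x y => real_inner_comm _ _
  rw [real_inner_comm, inner_smoothing_eq_integral, inner_smoothing_eq_integral]
  simp only [h0]
  rw [integral_integral_swap (integrable_kernel_mul_inner hk v w)]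
  -- The shift `x ↦ x + y` followed by `y ↦ -y` exchanges the two fields; evenness of `k` absorbs
  -- the reflection.
  have h3 : ∀ y, ∫ x, k y * inner ℝ (v (x - y)) (w x) = ∫ x, k y * inner ℝ (v x) (w (x + y)) := by
    intro y
    rw [← integral_sub_right_eq_self (fun x => k y * inner ℝ (v x) (w (x + y))) y]
    simp
  simp only [h3]
  rw [← integral_neg_eq_self (fun y => ∫ x, k y * inner ℝ (v x) (w (x + y)))]
  simp only [hk.even, ← sub_eq_add_neg]
  refine (integral_integral_swap ?_).symm
  refine (integrable_kernel_mul_inner hk w v).congr (.of_forall fun z => ?_)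
  simp only [Function.uncurry]
  rw [real_inner_comm]

theorem conv_comm (f g : E3 → ℝ) : f ⋆[lsmul ℝ ℝ] g = g ⋆[lsmul ℝ ℝ] f := by
  ext x
  rw [convolution_eq_swap]
  simp [MeasureTheory.convolution, mul_comm]

theorem divergence_conv {Φ : E3 → E3} (hΦ : ContDiff ℝ ∞ Φ) (hΦ' : HasCompactSupport Φ)
    (hdiv : ∀ x, divergence Φ x = 0) (hk : IsEvenKernel k) (x : E3) :
    divergence (k ⋆[lsmul ℝ ℝ] Φ) x = 0 := by
  have hloc : LocallyIntegrable Φ := hΦ.continuous.locallyIntegrable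
  have hkloc : LocallyIntegrable k := hk.smooth.continuous.locallyIntegrable
  rw [divergence_eq_sum_pd (contDiff_conv hk.smooth hk.compact hloc)]
  have h1 : ∀ i, pd i (fun y => (k ⋆[lsmul ℝ ℝ] Φ) y i) x
      = ∫ y, k y * pd i (fun z => Φ z i) (x - y) := by
    intro i
    have h2 : (fun y => (k ⋆[lsmul ℝ ℝ] Φ) y i) = (fun y => Φ y i) ⋆[lsmul ℝ ℝ] k := by
      ext y
      rw [conv_apply_coord hk.smooth hk.compact hloc, conv_comm]
    rw [h2, pd_conv (contDiff_coord hΦ i) (hasCompactSupport_coord hΦ' i) hkloc, conv_comm]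
    rfl
  have hi : ∀ i, Integrable fun y => k y * pd i (fun z => Φ z i) (x - y) := fun i =>
    integrable_conv_integrand hk.smooth hk.compact
      (contDiff_pd (contDiff_coord hΦ i) i).continuous.locallyIntegrable x
  simp only [h1]
  rw [← integral_finsetSum _ fun i _ => hi i]
  simp only [← Finset.mul_sum, ← divergence_eq_sum_pd hΦ, hdiv, mul_zero, integral_zero]

/-- Convolution keeps test fields divergence free; density of these and closedness of `divFreeL2`
give the general case. -/
theorem smoothing_mem_divFreeL2 (hk : IsEvenKernel k) {v : L2Field} (hv : v ∈ divFreeL2) :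
    smoothing hk v ∈ divFreeL2 := by
  have h1 : MapsTo (smoothing hk) (testL2 : Set L2Field) divFreeL2 := by
    rintro w ⟨Φ, h1, h2, h3, h4⟩
    have hloc : LocallyIntegrable Φ := h1.continuous.locallyIntegrable
    refine testL2_le_divFreeL2 ⟨k ⋆[lsmul ℝ ℝ] Φ, contDiff_conv hk.smooth hk.compact hloc,
      hk.compact.convolution (lsmul ℝ ℝ) h2, divergence_conv h1 h2 h3 hk, ?_⟩
    rw [← convolution_congr_ae_right h4]
    exact coeFn_smoothing hk w
  have h2 := h1.closure (smoothing hk).continuous (divFreeL2_le_closure hv)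
  rwa [isClosed_divFreeL2.closure_eq] at h2

/-- The `L²` norm of the gradient of the kernel. -/
def kernelConst (k : E3 → ℝ) : ℝ := (eLpNorm (fderiv ℝ k) 2 volume).toReal

/-- Cauchy–Schwarz. As the product of two `L²` fields is only integrable, this uniform bound on the
mollified gradient is what makes the flux a bounded trilinear form on `L²`. -/
theorem norm_fderiv_conv_le (hk : IsEvenKernel k) (h : L2Field) (x : E3) :
    ‖fderiv ℝ (k ⋆[lsmul ℝ ℝ] h) x‖ ≤ kernelConst k * ‖h‖ := by
  have hC : 0 ≤ kernelConst k := ENNReal.toReal_nonneg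
  refine ContinuousLinearMap.opNorm_le_bound _ (by positivity) fun v => ?_
  rw [fderiv_conv hk.smooth hk.compact (locallyIntegrable_L2 h)]
  have hdk : Continuous (fderiv ℝ k) := hk.smooth.continuous_fderiv (by simp)
  have hm : MemLp (fderiv ℝ k) 2 :=
    hdk.memLp_of_hasCompactSupport (hk.compact.fderiv ℝ)
  have h1 : ‖((fun y => fderiv ℝ k y v) ⋆[lsmul ℝ ℝ] h) x‖ₑ
      ≤ eLpNorm (fderiv ℝ k) 2 * eLpNorm h 2 * ‖v‖ₑ := by
    refine (enorm_convolution_le _ _ _).trans ?_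
    calc _ ≤ ∫⁻ y, (‖fderiv ℝ k y‖ₑ * ‖h (x - y)‖ₑ) * ‖v‖ₑ := by
          refine lintegral_mono fun y => ?_
          rw [mul_right_comm]
          gcongr
          exact (fderiv ℝ k y).le_opENorm v
      _ = (∫⁻ y, ‖fderiv ℝ k y‖ₑ * ‖h (x - y)‖ₑ) * ‖v‖ₑ := lintegral_mul_const' _ _ enorm_ne_top
      _ ≤ _ := by
          gcongr
          have hmp : MeasurePreserving (fun y => x - y) (volume : Measure E3) volume :=
            Measure.measurePreserving_sub_left volume x
          rw [← eLpNorm_comp_measurePreserving (Lp.aestronglyMeasurable h) hmp]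
          exact lintegral_enorm_mul_enorm_le hm.1
            ((Lp.aestronglyMeasurable h).comp_measurePreserving hmp)
  have h2 := ENNReal.toReal_mono (ENNReal.mul_ne_top
    (ENNReal.mul_ne_top hm.2.ne (Lp.memLp h).2.ne) enorm_ne_top) h1
  simpa [kernelConst, Lp.norm_def] using h2

theorem integrable_flux (hk : IsEvenKernel k) (v w h : L2Field) :
    Integrable fun x => inner ℝ (w x) (fderiv ℝ (k ⋆[lsmul ℝ ℝ] h) x (v x)) := by
  have hc : Continuous (fderiv ℝ (k ⋆[lsmul ℝ ℝ] h)) :=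
    (contDiff_conv hk.smooth hk.compact (locallyIntegrable_L2 h)).continuous_fderiv (by simp)
  have hm : MemLp (fun x => fderiv ℝ (k ⋆[lsmul ℝ ℝ] h) x (v x)) 2 := by
    refine (Lp.memLp v).of_le_mul (c := kernelConst k * ‖h‖)
      (isBoundedBilinearMap_apply.continuous.comp_aestronglyMeasurable
      (hc.aestronglyMeasurable.prodMk (Lp.aestronglyMeasurable v))) (.of_forall fun x => ?_)
    exact (ContinuousLinearMap.le_opNorm _ _).trans
      (mul_le_mul_of_nonneg_right (norm_fderiv_conv_le hk h x) (norm_nonneg _))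
  have h1 := L2.integrable_inner (𝕜 := ℝ) w hm.toLp
  refine h1.congr ?_
  filter_upwards [hm.coeFn_toLp] with x hx
  rw [hx]

theorem norm_integral_flux_le (hk : IsEvenKernel k) (v w h : L2Field) :
    ‖∫ x, inner ℝ (w x) (fderiv ℝ (k ⋆[lsmul ℝ ℝ] h) x (v x))‖
      ≤ kernelConst k * ‖v‖ * ‖w‖ * ‖h‖ := by
  have hC : 0 ≤ kernelConst k := ENNReal.toReal_nonneg
  have hc : Continuous (fderiv ℝ (k ⋆[lsmul ℝ ℝ] h)) :=
    (contDiff_conv hk.smooth hk.compact (locallyIntegrable_L2 h)).continuous_fderiv (by simp)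
  have hb : ∀ᵐ x, ‖fderiv ℝ (k ⋆[lsmul ℝ ℝ] h) x (v x)‖ ≤ kernelConst k * ‖h‖ * ‖v x‖ :=
    .of_forall fun x => (ContinuousLinearMap.le_opNorm _ _).trans
      (mul_le_mul_of_nonneg_right (norm_fderiv_conv_le hk h x) (norm_nonneg _))
  have hm : MemLp (fun x => fderiv ℝ (k ⋆[lsmul ℝ ℝ] h) x (v x)) 2 :=
    (Lp.memLp v).of_le_mul (isBoundedBilinearMap_apply.continuous.comp_aestronglyMeasurable
      (hc.aestronglyMeasurable.prodMk (Lp.aestronglyMeasurable v))) hb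
  have h1 : ∫ x, inner ℝ (w x) (fderiv ℝ (k ⋆[lsmul ℝ ℝ] h) x (v x)) = inner ℝ w hm.toLp := by
    rw [L2.inner_def]
    refine integral_congr_ae ?_
    filter_upwards [hm.coeFn_toLp] with x hx
    rw [hx]
  have h2 : ‖hm.toLp‖ ≤ kernelConst k * ‖h‖ * ‖v‖ := by
    refine Lp.norm_le_mul_norm_of_ae_le_mul ?_
    filter_upwards [hb, hm.coeFn_toLp] with x hx hx'
    rwa [hx']
  rw [h1]
  calc _ ≤ ‖w‖ * ‖hm.toLp‖ := norm_inner_le_norm _ _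
    _ ≤ ‖w‖ * (kernelConst k * ‖h‖ * ‖v‖) := by gcongr
    _ = _ := by ring

theorem fderiv_conv_add (hk : IsEvenKernel k) (h h' : L2Field) (x : E3) :
    fderiv ℝ (k ⋆[lsmul ℝ ℝ] (h + h' : L2Field)) x
    = fderiv ℝ (k ⋆[lsmul ℝ ℝ] h) x + fderiv ℝ (k ⋆[lsmul ℝ ℝ] h') x := by
  have hd : ∀ h : L2Field, Differentiable ℝ (k ⋆[lsmul ℝ ℝ] h) := fun h =>
    (contDiff_conv hk.smooth hk.compact (locallyIntegrable_L2 h)).differentiable (by simp)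
  rw [convolution_congr_ae_right (Lp.coeFn_add h h'), ← fderiv_add (hd h x) (hd h' x)]
  congr 1
  ext1 y
  exact ConvolutionExistsAt.distrib_add
    (integrable_conv_integrand hk.smooth hk.compact (locallyIntegrable_L2 h) y)
    (integrable_conv_integrand hk.smooth hk.compact (locallyIntegrable_L2 h') y)

theorem fderiv_conv_smul (hk : IsEvenKernel k) (c : ℝ) (h : L2Field) (x : E3) :
    fderiv ℝ (k ⋆[lsmul ℝ ℝ] (c • h : L2Field)) x = c • fderiv ℝ (k ⋆[lsmul ℝ ℝ] h) x := by
  have hd : Differentiable ℝ (k ⋆[lsmul ℝ ℝ] h) :=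
    (contDiff_conv hk.smooth hk.compact (locallyIntegrable_L2 h)).differentiable (by simp)
  rw [convolution_congr_ae_right (Lp.coeFn_smul c h), ← fderiv_const_smul (hd x), convolution_smul]

/-- The mollified momentum flux `(v, w, h) ↦ ∫ (v ⊗ w) : ∇ (k ⋆ h)` as a bounded trilinear form. -/
def flux (hk : IsEvenKernel k) : L2Field →L[ℝ] L2Field →L[ℝ] L2Field →L[ℝ] ℝ :=
  LinearMap.mkContinuous₂
    (LinearMap.mk₂ ℝ
      (fun v w => LinearMap.mkContinuous
        { toFun := fun h => ∫ x, inner ℝ (w x) (fderiv ℝ (k ⋆[lsmul ℝ ℝ] h) x (v x))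
          map_add' := fun h h' => by
            rw [← integral_add (integrable_flux hk v w h) (integrable_flux hk v w h')]
            simp only [fderiv_conv_add hk, add_apply, inner_add_right]
          map_smul' := fun c h => by
            simp only [fderiv_conv_smul hk, smul_apply, inner_smul_right,
              RingHom.id_apply, smul_eq_mul, integral_const_mul] }
        (kernelConst k * ‖v‖ * ‖w‖) (norm_integral_flux_le hk v w))
      (fun v v' w => by
        ext h
        simp only [LinearMap.mkContinuous_apply, LinearMap.coe_mk, AddHom.coe_mk,
          add_apply]
        rw [← integral_add (integrable_flux hk v w h) (integrable_flux hk v' w h)]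
        refine integral_congr_ae ?_
        filter_upwards [Lp.coeFn_add v v'] with x hx
        rw [hx, Pi.add_apply, map_add, inner_add_right])
      (fun c v w => by
        ext h
        simp only [LinearMap.mkContinuous_apply, LinearMap.coe_mk, AddHom.coe_mk,
          smul_apply, smul_eq_mul]
        rw [← integral_const_mul]
        refine integral_congr_ae ?_
        filter_upwards [Lp.coeFn_smul c v] with x hx
        rw [hx, Pi.smul_apply, map_smul, inner_smul_right])
      (fun v w w' => by
        ext h
        simp only [LinearMap.mkContinuous_apply, LinearMap.coe_mk, AddHom.coe_mk,
          add_apply]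
        rw [← integral_add (integrable_flux hk v w h) (integrable_flux hk v w' h)]
        refine integral_congr_ae ?_
        filter_upwards [Lp.coeFn_add w w'] with x hx
        rw [hx, Pi.add_apply, inner_add_left])
      (fun c v w => by
        ext h
        simp only [LinearMap.mkContinuous_apply, LinearMap.coe_mk, AddHom.coe_mk,
          smul_apply, smul_eq_mul]
        rw [← integral_const_mul]
        refine integral_congr_ae ?_
        filter_upwards [Lp.coeFn_smul c w] with x hx
        rw [hx, Pi.smul_apply, inner_smul_left]
        simp))
    (kernelConst k)
    (fun v w => LinearMap.mkContinuous_norm_le _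
      (mul_nonneg (mul_nonneg ENNReal.toReal_nonneg (norm_nonneg v)) (norm_nonneg w))
      (norm_integral_flux_le hk v w))

theorem flux_apply (hk : IsEvenKernel k) (v w h : L2Field) :
    flux hk v w h = ∫ x, inner ℝ (w x) (fderiv ℝ (k ⋆[lsmul ℝ ℝ] h) x (v x)) := rfl

end Flux

/-! ### The energy balance of the mollified solution -/

section EnergyBalance

open ContinuousLinearMap (lsmul)
open scoped Convolution

/-! ### Weakly continuous curves in a Hilbert space. -/

theorem norm_sub_of_orthonormal {E : Type*} [NormedAddCommGroup E] [InnerProductSpace ℝ E]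
    {x y : E} (hx : ‖x‖ = 1) (hy : ‖y‖ = 1) (hxy : inner ℝ x y = 0) : 1 < ‖x - y‖ := by
  have h := @norm_sub_sq_real E _ _ x y
  rw [hx, hy, hxy] at h
  nlinarith [norm_nonneg (x - y)]

/-- Distinct members are more than 1 apart, so the balls of radius `1/2` around them are disjoint; a
separable space contains only countably many. -/
theorem countable_of_orthonormal {E : Type*} [NormedAddCommGroup E] [InnerProductSpace ℝ E]
    [TopologicalSpace.SeparableSpace E] {s : Set E} (hs : Orthonormal ℝ ((↑) : s → E)) :
    s.Countable := by
  refine Set.PairwiseDisjoint.countable_of_isOpen (s := fun x => Metric.ball x (1 / 2))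
    (fun x hx y hy hxy => ?_) (fun x _ => Metric.isOpen_ball)
    (fun x _ => Metric.nonempty_ball.2 (by norm_num))
  refine Metric.ball_disjoint_ball ?_
  have h1 : inner ℝ x y = (0 : ℝ) :=
    hs.2 (i := ⟨x, hx⟩) (j := ⟨y, hy⟩) fun h => hxy (congrArg Subtype.val h)
  rw [dist_eq_norm]
  have := norm_sub_of_orthonormal (hs.1 ⟨x, hx⟩) (hs.1 ⟨y, hy⟩) h1
  linarith

/-- Weakly continuous functions with values in a separable Hilbert space are measurable. -/
theorem aestronglyMeasurable_of_weaklyContinuousOn {E : Type*} [NormedAddCommGroup E]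
    [InnerProductSpace ℝ E] [CompleteSpace E] [TopologicalSpace.SeparableSpace E] {u : ℝ → E}
    {s : Set ℝ} (hs : MeasurableSet s) (hu : ∀ g : E, ContinuousOn (fun t => inner ℝ (u t) g) s) :
    AEStronglyMeasurable u (volume.restrict s) := by
  obtain ⟨w, b, hb⟩ := exists_hilbertBasis ℝ E
  -- Countability makes the filter of finite subsets of the basis countably generated, as needed for
  -- limits of measurable functions to be measurable.
  have hw : Countable w := (countable_of_orthonormal (hb ▸ b.orthonormal)).to_subtype
  refine aestronglyMeasurable_of_tendsto_ae (atTop : Filter (Finset w))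
    (f := fun F t => ∑ i ∈ F, inner ℝ (u t) (b i) • b i) (fun F => ?_) (.of_forall fun t => ?_)
  · refine ContinuousOn.aestronglyMeasurable ?_ hs
    exact continuousOn_finsetSum _ fun i _ => (hu (b i)).smul continuousOn_const
  · have := b.hasSum_repr (u t)
    simp only [HilbertBasis.repr_apply_apply, real_inner_comm] at this
    rw [HasSum, SummationFilter.unconditional_filter] at this
    simpa only [real_inner_comm] using this

/-- Weakly continuous functions on compact intervals are bounded. -/
theorem exists_norm_le_of_weaklyContinuousOn {E : Type*} [NormedAddCommGroup E]
    [InnerProductSpace ℝ E] [CompleteSpace E] {u : ℝ → E} {s : Set ℝ} (hs : IsCompact s)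
    (hu : ∀ g : E, ContinuousOn (fun t => inner ℝ (u t) g) s) : ∃ M, ∀ t ∈ s, ‖u t‖ ≤ M := by
  obtain ⟨M, hM⟩ := banach_steinhaus (g := fun t : s => innerSL ℝ (u t)) fun g => by
    obtain ⟨C, hC⟩ := hs.exists_bound_of_continuousOn (hu g)
    exact ⟨C, fun t => by simpa using hC t t.2⟩
  exact ⟨M, fun t ht => by simpa using hM ⟨t, ht⟩⟩

/-! ### Time evolution of the mollified solution. -/

variable {T : ℝ} {u₀ : L2Field} {u : ℝ → L2Field} {k : E3 → ℝ}

theorem IsWeakSolution.exists_norm_le (hu : IsWeakSolution T u₀ u) :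
    ∃ M, 0 ≤ M ∧ ∀ t ∈ Icc 0 T, ‖u t‖ ≤ M := by
  obtain ⟨M, hM⟩ := exists_norm_le_of_weaklyContinuousOn isCompact_Icc hu.weaklyContinuous
  exact ⟨|M|, abs_nonneg M, fun t ht => (hM t ht).trans (le_abs_self M)⟩

theorem IsWeakSolution.aestronglyMeasurable (hu : IsWeakSolution T u₀ u) :
    AEStronglyMeasurable u (volume.restrict (Icc 0 T)) := by
  have : Fact ((2 : ℝ≥0∞) ≠ ⊤) := ⟨ENNReal.ofNat_ne_top⟩
  exact aestronglyMeasurable_of_weaklyContinuousOn measurableSet_Icc hu.weaklyContinuous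

/-- The weak formulation for test fields of the form `k ⋆ Φ`. -/
theorem IsWeakSolution.momentum_conv (hu : IsWeakSolution T u₀ u) (hk : IsEvenKernel k)
    {h : L2Field} (hh : h ∈ testL2) {t : ℝ} (ht : t ∈ Icc 0 T) :
    inner ℝ (u t) (smoothing hk h) - inner ℝ u₀ (smoothing hk h)
      = ∫ s in (0 : ℝ)..t, flux hk (u s) (u s) h := by
  obtain ⟨Φ, h1, h2, h3, h4⟩ := hh
  have hloc : LocallyIntegrable Φ := h1.continuous.locallyIntegrable
  set Ψ := k ⋆[lsmul ℝ ℝ] Φ with hΨ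
  have hΨh : k ⋆[lsmul ℝ ℝ] h = Ψ := convolution_congr_ae_right h4
  have hΨ1 : ContDiff ℝ ∞ Ψ := contDiff_conv hk.smooth hk.compact hloc
  have hΨ2 : HasCompactSupport Ψ := hk.compact.convolution (lsmul ℝ ℝ) h2
  have hT : 0 ≤ T := ht.1.trans ht.2
  -- The time cut-off equals one near every point of `[0, T]`: the test field is compactly supported
  -- in space-time, yet its time derivative vanishes there and only the flux remains.
  let χ : ContDiffBump (0 : ℝ) := ⟨T + 1, T + 2, by linarith, by linarith⟩
  have hχ : ∀ s ∈ Icc 0 T, ∀ᶠ r in 𝓝 s, χ r = 1 := by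
    intro s hs
    have : Metric.ball (0 : ℝ) (T + 1) ∈ 𝓝 s := Metric.isOpen_ball.mem_nhds (by
      rw [mem_ball_zero_iff, Real.norm_of_nonneg hs.1]
      linarith [hs.2])
    filter_upwards [this] with r hr
    exact χ.one_of_mem_closedBall (Metric.ball_subset_closedBall hr)
  have hψ1 : ContDiff ℝ ∞ (Function.uncurry fun (s : ℝ) (x : E3) => χ s • Ψ x) :=
    (χ.contDiff.comp contDiff_fst).smul (hΨ1.comp contDiff_snd)
  have hψ2 : HasCompactSupport (Function.uncurry fun (s : ℝ) (x : E3) => χ s • Ψ x) := by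
    refine HasCompactSupport.of_support_subset_isCompact
      (χ.hasCompactSupport.isCompact.prod hΨ2.isCompact) fun z hz => ?_
    simp only [Function.mem_support, Function.uncurry, ne_eq, smul_eq_zero, not_or] at hz
    exact ⟨subset_tsupport _ hz.1, subset_tsupport _ hz.2⟩
  have hψ3 : ∀ (s : ℝ) (x : E3), divergence (fun x => χ s • Ψ x) x = 0 := by
    intro s x
    have := divergence_smul hΨ1 (χ s) x
    rw [divergence_conv h1 h2 h3 hk, mul_zero] at this
    exact this
  have hm := hu.momentum _ hψ1 hψ2 hψ3 t ht
  have hχ1 : ∀ s ∈ Icc 0 T, χ s = 1 := fun s hs => (hχ s hs).self_of_nhds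
  have hsmooth : ∀ v : L2Field, inner ℝ v (smoothing hk h) = ∫ x, inner ℝ (v x) (Ψ x) := by
    intro v
    rw [L2.inner_def]
    refine integral_congr_ae ?_
    filter_upwards [coeFn_smoothing hk h] with x hx
    rw [hx, hΨh]
  simp only [hχ1 t ht, hχ1 0 ⟨le_rfl, hT⟩, one_smul] at hm
  rw [hsmooth, hsmooth, hm]
  refine intervalIntegral.integral_congr fun s hs => ?_
  rw [uIcc_of_le ht.1] at hs
  have hs' : s ∈ Icc 0 T := ⟨hs.1, hs.2.trans ht.2⟩
  have hd : ∀ x, deriv (fun r => χ r • Ψ x) s = 0 := by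
    intro x
    have : (fun r => χ r • Ψ x) =ᶠ[𝓝 s] fun _ => Ψ x := by
      filter_upwards [hχ s hs'] with r hr
      rw [hr, one_smul]
    rw [this.deriv_eq, deriv_const]
  simp only [hd, inner_zero_right, zero_add, hχ1 s hs', one_smul]
  rw [flux_apply, hΨh]

/-- The flux as a functional on test fields. -/
def fluxFunctional (hk : IsEvenKernel k) (v : L2Field) : L2Field →L[ℝ] ℝ := flux hk v v

theorem aestronglyMeasurable_fluxFunctional (hu : IsWeakSolution T u₀ u) (hk : IsEvenKernel k) :
    AEStronglyMeasurable (fun s => fluxFunctional hk (u s)) (volume.restrict (Icc 0 T)) :=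
  ContinuousLinearMap.aestronglyMeasurable_comp₂ (flux hk) hu.aestronglyMeasurable
    hu.aestronglyMeasurable

theorem exists_norm_fluxFunctional_le (hu : IsWeakSolution T u₀ u) (hk : IsEvenKernel k) :
    ∃ K, 0 ≤ K ∧ ∀ s ∈ Icc 0 T, ‖fluxFunctional hk (u s)‖ ≤ K := by
  obtain ⟨M, hM0, hM⟩ := hu.exists_norm_le
  have hC : 0 ≤ kernelConst k := ENNReal.toReal_nonneg
  refine ⟨kernelConst k * M * M, by positivity, fun s hs => ?_⟩
  refine ContinuousLinearMap.opNorm_le_bound _ (by positivity) fun h => ?_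
  have := hM s hs
  refine (norm_integral_flux_le hk (u s) (u s) h).trans ?_
  gcongr

theorem intervalIntegrable_of_bound {E : Type*} [NormedAddCommGroup E] {f : ℝ → E} {K a b : ℝ}
    (hf : AEStronglyMeasurable f (volume.restrict (Icc 0 T))) (hK : ∀ s ∈ Icc 0 T, ‖f s‖ ≤ K)
    (ha : a ∈ Icc 0 T) (hb : b ∈ Icc 0 T) : IntervalIntegrable f volume a b := by
  rw [intervalIntegrable_iff]
  have hsub : uIoc a b ⊆ Icc 0 T := uIoc_subset_uIcc.trans (uIcc_subset_Icc ha hb)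
  have : Fact (volume (uIoc a b) < ⊤) := ⟨by simp⟩
  refine Integrable.of_bound (hf.mono_set hsub) K ?_
  filter_upwards [ae_restrict_mem measurableSet_uIoc] with s hs
  exact hK s (hsub hs)

theorem intervalIntegrable_fluxFunctional (hu : IsWeakSolution T u₀ u) (hk : IsEvenKernel k)
    {a b : ℝ} (ha : a ∈ Icc 0 T) (hb : b ∈ Icc 0 T) :
    IntervalIntegrable (fun s => fluxFunctional hk (u s)) volume a b := by
  obtain ⟨K, -, hK⟩ := exists_norm_fluxFunctional_le hu hk
  exact intervalIntegrable_of_bound (aestronglyMeasurable_fluxFunctional hu hk) hK ha hb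

/-- The weak formulation for mollified divergence-free `L²` test fields. -/
theorem IsWeakSolution.momentum_divFree (hu : IsWeakSolution T u₀ u) (hk : IsEvenKernel k)
    {h : L2Field} (hh : h ∈ divFreeL2) {t : ℝ} (ht : t ∈ Icc 0 T) :
    inner ℝ (smoothing hk (u t) - smoothing hk u₀) h
      = ∫ s in (0 : ℝ)..t, fluxFunctional hk (u s) h := by
  have h0 : (0 : ℝ) ∈ Icc 0 T := ⟨le_rfl, ht.1.trans ht.2⟩
  have hI := intervalIntegrable_fluxFunctional hu hk h0 ht
  rw [← ContinuousLinearMap.intervalIntegral_apply hI]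
  -- Both sides are continuous in `h`, so the identity extends from test fields to their closure,
  -- which contains the mollified solution.
  have hclosed : IsClosed {h : L2Field | inner ℝ (smoothing hk (u t) - smoothing hk u₀) h
      = (∫ s in (0 : ℝ)..t, fluxFunctional hk (u s)) h} :=
    isClosed_eq (by fun_prop) (ContinuousLinearMap.continuous _)
  refine hclosed.closure_subset_iff.2 (fun h hh => ?_) (divFreeL2_le_closure hh)
  have := hu.momentum_conv hk hh ht
  change inner ℝ (smoothing hk (u t) - smoothing hk u₀) h
    = (∫ s in (0 : ℝ)..t, fluxFunctional hk (u s)) h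
  rw [ContinuousLinearMap.intervalIntegral_apply hI, inner_sub_left, inner_smoothing,
    inner_smoothing, this]
  rfl

theorem IsWeakSolution.mem_divFreeL2 (hu : IsWeakSolution T u₀ u) {t : ℝ} (ht : t ∈ Icc 0 T) :
    u t ∈ divFreeL2 := hu.divFree t ht

theorem IsWeakSolution.inner_increment (hu : IsWeakSolution T u₀ u) (hk : IsEvenKernel k)
    {h : L2Field} (hh : h ∈ divFreeL2) {s t : ℝ} (hs : s ∈ Icc 0 T) (ht : t ∈ Icc 0 T) :
    inner ℝ (smoothing hk (u t) - smoothing hk (u s)) h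
      = ∫ r in s..t, fluxFunctional hk (u r) h := by
  have h0 : (0 : ℝ) ∈ Icc 0 T := ⟨le_rfl, ht.1.trans ht.2⟩
  have hI : ∀ a ∈ Icc 0 T, IntervalIntegrable (fun r => fluxFunctional hk (u r) h) volume 0 a := by
    intro a ha
    obtain ⟨K, -, hK⟩ := exists_norm_fluxFunctional_le hu hk
    refine intervalIntegrable_of_bound (T := T) (K := K * ‖h‖)
      ((aestronglyMeasurable_fluxFunctional hu hk).apply_continuousLinearMap h)
      (fun r hr => ?_) h0 ha
    exact (ContinuousLinearMap.le_opNorm _ _).trans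
      (mul_le_mul_of_nonneg_right (hK r hr) (norm_nonneg _))
  rw [← intervalIntegral.integral_interval_sub_left (hI t ht) (hI s hs),
    ← hu.momentum_divFree hk hh ht, ← hu.momentum_divFree hk hh hs, ← inner_sub_left]
  congr 1
  abel

/-- The mollified solution is Lipschitz in time. -/
theorem norm_smoothing_sub_le (hu : IsWeakSolution T u₀ u) (hk : IsEvenKernel k) {K : ℝ}
    (hK : ∀ s ∈ Icc 0 T, ‖fluxFunctional hk (u s)‖ ≤ K) {s t : ℝ} (hs : s ∈ Icc 0 T)
    (ht : t ∈ Icc 0 T) : ‖smoothing hk (u t) - smoothing hk (u s)‖ ≤ K * |t - s| := by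
  set d := smoothing hk (u t) - smoothing hk (u s) with hd
  have hdm : d ∈ divFreeL2 := divFreeL2.sub_mem (smoothing_mem_divFreeL2 hk (hu.mem_divFreeL2 ht))
    (smoothing_mem_divFreeL2 hk (hu.mem_divFreeL2 hs))
  -- Tested against itself, the increment satisfies `‖d‖² ≤ K ‖d‖ |t - s|`.
  have h1 := hu.inner_increment hk hdm hs ht
  rw [real_inner_self_eq_norm_sq] at h1
  have h2 : ‖∫ r in s..t, fluxFunctional hk (u r) d‖ ≤ K * ‖d‖ * |t - s| := by
    refine intervalIntegral.norm_integral_le_of_norm_le_const fun r hr => ?_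
    have hr' : r ∈ Icc 0 T := uIcc_subset_Icc hs ht (uIoc_subset_uIcc hr)
    exact (ContinuousLinearMap.le_opNorm _ _).trans
      (mul_le_mul_of_nonneg_right (hK r hr') (norm_nonneg _))
  rw [← h1, Real.norm_of_nonneg (sq_nonneg _)] at h2
  have hK0 : 0 ≤ K := (norm_nonneg _).trans (hK s hs)
  rcases (norm_nonneg d).eq_or_lt with h0 | h0
  · rw [← h0]; positivity
  · refine le_of_mul_le_mul_right ?_ h0
    nlinarith

/-- A function on an interval whose increments are quadratically small is constant. -/
theorem eq_of_sq_increments {f : ℝ → ℝ} {C : ℝ}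
    (hf : ∀ s ∈ Icc 0 T, ∀ t ∈ Icc 0 T, |f t - f s| ≤ C * (t - s) ^ 2) {t : ℝ}
    (ht : t ∈ Icc 0 T) : f t = f 0 := by
  have hd : ∀ x ∈ Icc 0 T, HasDerivWithinAt f 0 (Icc 0 T) x := by
    intro x hx
    rw [hasDerivWithinAt_iff_isLittleO]
    simp only [smul_zero, sub_zero]
    have h1 : (fun y => f y - f x) =O[𝓝[Icc 0 T] x] fun y => (y - x) ^ 2 := by
      refine Asymptotics.IsBigO.of_bound C ?_
      filter_upwards [self_mem_nhdsWithin] with y hy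
      simpa using hf x hx y hy
    refine h1.trans_isLittleO ?_
    have h2 : (fun y : ℝ => (y - x) ^ 2) =o[𝓝 x] fun y => y - x := by
      simpa using (Asymptotics.isLittleO_pow_sub_sub x (m := 2) one_lt_two)
    exact h2.mono nhdsWithin_le_nhds
  refine constant_of_has_deriv_right_zero (fun x hx => (hd x hx).continuousWithinAt)
    (fun x hx => ?_) t ht
  exact (hd x ⟨hx.1, hx.2.le⟩).mono_of_mem_nhdsWithin (Icc_mem_nhdsGE_of_mem hx)

/-- The energy balance of the mollified solution. -/
theorem IsWeakSolution.energy_balance (hu : IsWeakSolution T u₀ u) (hk : IsEvenKernel k)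
    {t : ℝ} (ht : t ∈ Icc 0 T) :
    ‖smoothing hk (u t)‖ ^ 2 - ‖smoothing hk u₀‖ ^ 2
      = 2 * ∫ s in (0 : ℝ)..t, flux hk (u s) (u s) (smoothing hk (u s)) := by
  have h0 : (0 : ℝ) ∈ Icc 0 T := ⟨le_rfl, ht.1.trans ht.2⟩
  obtain ⟨K, hK0, hK⟩ := exists_norm_fluxFunctional_le hu hk
  obtain ⟨M, hM0, hM⟩ := hu.exists_norm_le
  set W : ℝ → L2Field := fun r => smoothing hk (u r) with hW
  have hWd : ∀ r ∈ Icc 0 T, W r ∈ divFreeL2 := fun r hr =>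
    smoothing_mem_divFreeL2 hk (hu.mem_divFreeL2 hr)
  have hmeas : ∀ g : ℝ → L2Field, AEStronglyMeasurable g (volume.restrict (Icc 0 T)) →
      AEStronglyMeasurable (fun r => fluxFunctional hk (u r) (g r)) (volume.restrict (Icc 0 T)) :=
    fun g hg => isBoundedBilinearMap_apply.continuous.comp_aestronglyMeasurable
      ((aestronglyMeasurable_fluxFunctional hu hk).prodMk hg)
  have hWm : AEStronglyMeasurable W (volume.restrict (Icc 0 T)) :=
    (smoothing hk).continuous.comp_aestronglyMeasurable hu.aestronglyMeasurable
  have hle : ∀ (r : ℝ) (_ : r ∈ Icc 0 T) (g : L2Field), ‖fluxFunctional hk (u r) g‖ ≤ K * ‖g‖ :=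
    fun r hr g => (ContinuousLinearMap.le_opNorm _ _).trans
      (mul_le_mul_of_nonneg_right (hK r hr) (norm_nonneg _))
  have hWb : ∀ r ∈ Icc 0 T, ‖fluxFunctional hk (u r) (W r)‖ ≤ K * (‖smoothing hk‖ * M) := by
    intro r hr
    refine (hle r hr _).trans ?_
    gcongr
    exact (ContinuousLinearMap.le_opNorm _ _).trans (by have := hM r hr; gcongr)
  have hWI : ∀ a ∈ Icc 0 T, ∀ b ∈ Icc 0 T,
      IntervalIntegrable (fun r => fluxFunctional hk (u r) (W r)) volume a b := fun a ha b hb =>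
    intervalIntegrable_of_bound (hmeas W hWm) hWb ha hb
  have hcI : ∀ (g : L2Field), ∀ a ∈ Icc 0 T, ∀ b ∈ Icc 0 T,
      IntervalIntegrable (fun r => fluxFunctional hk (u r) g) volume a b := fun g a ha b hb =>
    intervalIntegrable_of_bound (hmeas _ aestronglyMeasurable_const) (fun r hr => hle r hr g) ha hb
  -- The solution need not be differentiated in time: the defect in the balance has increments at
  -- most `2 K² (b - a)²`, so it is constant.
  have hconst := eq_of_sq_increments (T := T) (C := 2 * K ^ 2)
    (f := fun r => ‖W r‖ ^ 2 - 2 * ∫ s in (0 : ℝ)..r, fluxFunctional hk (u s) (W s))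
    (fun a ha b hb => ?_) ht
  · simp only [intervalIntegral.integral_same, mul_zero, sub_zero] at hconst
    have h3 : W 0 = smoothing hk u₀ := by rw [hW]; simp only [hu.initial]
    rw [h3] at hconst
    have h4 : ∀ s, flux hk (u s) (u s) (smoothing hk (u s)) = fluxFunctional hk (u s) (W s) :=
      fun s => rfl
    simp only [h4]
    linarith
  · have h1 : ‖W b‖ ^ 2 - ‖W a‖ ^ 2 = ∫ r in a..b, fluxFunctional hk (u r) (W b + W a) := by
      rw [← hu.inner_increment hk (divFreeL2.add_mem (hWd b hb) (hWd a ha)) ha hb]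
      change _ = inner ℝ (W b - W a) (W b + W a)
      rw [inner_sub_left, inner_add_right, inner_add_right, real_inner_self_eq_norm_sq,
        real_inner_self_eq_norm_sq, real_inner_comm (W a) (W b)]
      ring
    have h2 := intervalIntegral.integral_interval_sub_left (hWI 0 h0 b hb) (hWI 0 h0 a ha)
    -- The integrand is the flux tested with the error of replacing `W b + W a` by `2 W r`. One
    -- factor `K` comes from the flux, the other from the Lipschitz bound of `W`.
    have h3 : (‖W b‖ ^ 2 - 2 * ∫ s in (0 : ℝ)..b, fluxFunctional hk (u s) (W s))
        - (‖W a‖ ^ 2 - 2 * ∫ s in (0 : ℝ)..a, fluxFunctional hk (u s) (W s))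
        = ∫ r in a..b, fluxFunctional hk (u r) ((W b - W r) + (W a - W r)) := by
      have h4 : ∀ r, fluxFunctional hk (u r) ((W b - W r) + (W a - W r))
          = fluxFunctional hk (u r) (W b + W a) - 2 * fluxFunctional hk (u r) (W r) := by
        intro r
        simp only [map_add, map_sub]
        ring
      simp only [h4]
      rw [intervalIntegral.integral_sub (hcI _ a ha b hb) ((hWI a ha b hb).const_mul 2),
        intervalIntegral.integral_const_mul, ← h1, ← h2]
      ring
    rw [h3, ← Real.norm_eq_abs]
    refine (intervalIntegral.norm_integral_le_of_norm_le_const (C := 2 * K ^ 2 * |b - a|)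
      fun r hr => ?_).trans_eq ?_
    · have hr1 : r ∈ uIcc a b := uIoc_subset_uIcc hr
      have hr' : r ∈ Icc 0 T := uIcc_subset_Icc ha hb hr1
      have h5 := norm_smoothing_sub_le hu hk hK hr' hb
      have h6 := norm_smoothing_sub_le hu hk hK hr' ha
      have h7 : |b - r| + |a - r| ≤ 2 * |b - a| := by
        have h8 := abs_sub_right_of_mem_uIcc hr1
        have h9 := abs_sub_left_of_mem_uIcc hr1
        rw [abs_sub_comm a r]
        linarith
      calc _ ≤ K * ‖(W b - W r) + (W a - W r)‖ := hle r hr' _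
        _ ≤ K * (K * |b - r| + K * |a - r|) := by
          gcongr
          exact (norm_add_le _ _).trans (add_le_add h5 h6)
        _ = K ^ 2 * (|b - r| + |a - r|) := by ring
        _ ≤ K ^ 2 * (2 * |b - a|) := by gcongr
        _ = _ := by ring
    · rw [mul_assoc, ← sq, sq_abs]

end EnergyBalance

/-! ### The cubic commutator identity -/

section Commutator

open ContinuousLinearMap (lsmul)
open scoped Convolution

/-- Smooth, bounded and square integrable functions. -/
structure IsTame (f : E3 → ℝ) : Prop where
  smooth : ContDiff ℝ ∞ f
  memLp : MemLp f 2
  bounded : ∃ C, ∀ x, ‖f x‖ ≤ C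

theorem isTame_conv {k f : E3 → ℝ} (hk : ContDiff ℝ ∞ k) (hk' : HasCompactSupport k)
    (hf : MemLp f 2) : IsTame (k ⋆[lsmul ℝ ℝ] f) := by
  refine ⟨contDiff_conv hk hk' (hf.locallyIntegrable one_le_two),
    memLp_conv hk hk' one_le_two ENNReal.ofNat_ne_top hf, ?_⟩
  have hm : MemLp k 2 := hk.continuous.memLp_of_hasCompactSupport hk'
  have hfin := ENNReal.mul_ne_top hm.2.ne hf.2.ne
  refine ⟨(eLpNorm k 2 * eLpNorm f 2).toReal, fun x => ?_⟩
  rw [← toReal_enorm]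
  refine ENNReal.toReal_mono hfin ((enorm_convolution_le _ _ _).trans ?_)
  have hmp := Measure.measurePreserving_sub_left (volume : Measure E3) x
  rw [← eLpNorm_comp_measurePreserving hf.1 hmp]
  exact lintegral_enorm_mul_enorm_le hm.1 (hf.1.comp_measurePreserving hmp)

theorem IsTame.integrable_mul {f g h : E3 → ℝ} (hf : IsTame f) (hg : IsTame g) (hh : IsTame h) :
    Integrable fun x => f x * g x * h x := by
  obtain ⟨C, hC⟩ := hh.bounded
  exact (hf.memLp.integrable_mul hg.memLp).mul_bdd hh.smooth.continuous.aestronglyMeasurable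
    (.of_forall hC)

/-- Convolution with an odd kernel is antisymmetric. -/
theorem integral_mul_conv_of_odd {k f g : E3 → ℝ} (hk : ContDiff ℝ ∞ k) (hk' : HasCompactSupport k)
    (hodd : ∀ x, k (-x) = -k x) (hf : Integrable f) (hg : Continuous g) {C : ℝ}
    (hC : ∀ x, ‖g x‖ ≤ C) :
    ∫ x, f x * (k ⋆[lsmul ℝ ℝ] g) x = -∫ x, (k ⋆[lsmul ℝ ℝ] f) x * g x := by
  have hki := integrable_of_contDiff hk hk'
  have h1 : Integrable (fun z : E3 × E3 => f z.1 * (k z.2 * g (z.1 - z.2)))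
      (volume.prod volume) := by
    have := (hf.mul_prod hki).mul_bdd (c := C)
      (g := fun z : E3 × E3 => g (z.1 - z.2)) (by fun_prop) (.of_forall fun z => hC _)
    exact this.congr (.of_forall fun z => mul_assoc _ _ _)
  have h2 : Integrable (fun z : E3 × E3 => k z.2 * f (z.1 - z.2) * g z.1)
      (volume.prod volume) := by
    have := hki.convolution_integrand (lsmul ℝ ℝ) hf
    exact this.mul_bdd (c := C) (g := fun z : E3 × E3 => g z.1) (by fun_prop)
      (.of_forall fun z => hC _)
  calc ∫ x, f x * (k ⋆[lsmul ℝ ℝ] g) x = ∫ x, ∫ y, f x * (k y * g (x - y)) := by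
        refine integral_congr_ae (.of_forall fun x => ?_)
        simp only [MeasureTheory.convolution, ContinuousLinearMap.lsmul_apply, smul_eq_mul]
        rw [integral_const_mul]
    _ = ∫ y, ∫ x, f x * (k y * g (x - y)) := integral_integral_swap h1
    _ = ∫ y, ∫ x, f (x + y) * (k y * g x) := by
      refine integral_congr_ae (.of_forall fun y => ?_)
      simp only
      rw [← integral_add_right_eq_self _ y]
      simp
    _ = ∫ y, ∫ x, -(k y * f (x - y) * g x) := by
      rw [← integral_neg_eq_self]
      refine integral_congr_ae (.of_forall fun y => integral_congr_ae (.of_forall fun x => ?_))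
      simp only [hodd, ← sub_eq_add_neg]
      ring
    _ = -∫ x, ∫ y, k y * f (x - y) * g x := by
      simp only [integral_neg]
      rw [← integral_integral_swap h2]
    _ = _ := by
      congr 1
      refine integral_congr_ae (.of_forall fun x => ?_)
      simp only [MeasureTheory.convolution, ContinuousLinearMap.lsmul_apply, smul_eq_mul]
      rw [integral_mul_const]

variable {k : E3 → ℝ}

theorem IsEvenKernel.pd_odd (hk : IsEvenKernel k) (i : Fin 3) (x : E3) :
    pd i k (-x) = -pd i k x := by
  have h := congrFun (pd_comp_sub_left hk.smooth i 0) x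
  simp only [zero_sub, hk.even] at h
  have h' : pd i k x = -pd i k (-x) := h
  rw [h', neg_neg]

/-- Moving the mollifier and the derivative to the other factor. -/
theorem integral_mul_conv_conv (hk : IsEvenKernel k) (i : Fin 3) {f g : E3 → ℝ} (hf : Integrable f)
    (hg : MemLp g 2) : ∫ x, f x * (pd i k ⋆[lsmul ℝ ℝ] (k ⋆[lsmul ℝ ℝ] g)) x
      = ∫ x, (k ⋆[lsmul ℝ ℝ] f) x * (pd i k ⋆[lsmul ℝ ℝ] g) x := by
  have hw := isTame_conv hk.smooth hk.compact hg
  have hk1 := contDiff_pd hk.smooth i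
  have hk2 := hasCompactSupport_pd hk.compact i
  have hw' := isTame_conv hk1 hk2 hg
  obtain ⟨C, hC⟩ := hw.bounded
  obtain ⟨C', hC'⟩ := hw'.bounded
  have hkf : Integrable (k ⋆[lsmul ℝ ℝ] f) := memLp_one_iff_integrable.1
    (memLp_conv hk.smooth hk.compact le_rfl ENNReal.one_ne_top (memLp_one_iff_integrable.2 hf))
  have hkf' : Integrable (pd i k ⋆[lsmul ℝ ℝ] f) := memLp_one_iff_integrable.1
    (memLp_conv hk1 hk2 le_rfl ENNReal.one_ne_top (memLp_one_iff_integrable.2 hf))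
  -- The derivative of an even kernel is odd: moving it onto `f` costs a sign, which the integration
  -- by parts below cancels.
  rw [integral_mul_conv_of_odd hk1 hk2 (hk.pd_odd i) hf hw.smooth.continuous hC]
  have hg' := pd_conv hk.smooth hk.compact (hg.locallyIntegrable one_le_two) i
  have hf' := pd_conv hk.smooth hk.compact hf.locallyIntegrable i
  have h := integral_mul_fderiv_eq_neg_fderiv_mul_of_integrable (μ := (volume : Measure E3))
    (f := k ⋆[lsmul ℝ ℝ] f) (g := k ⋆[lsmul ℝ ℝ] g) (v := EuclideanSpace.single i 1)
    ?_ ?_ (hkf.mul_bdd hw.smooth.continuous.aestronglyMeasurable (.of_forall hC))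
    (fun x _ => (contDiff_conv hk.smooth hk.compact hf.locallyIntegrable).differentiable
      (by simp) x) (fun x _ => hw.smooth.differentiable (by simp) x)
  · rw [← hf', ← hg']
    exact h.symm
  · change Integrable fun x => pd i (k ⋆[lsmul ℝ ℝ] f) x * _
    rw [hf']
    exact hkf'.mul_bdd hw.smooth.continuous.aestronglyMeasurable (.of_forall hC)
  · change Integrable fun x => _ * pd i (k ⋆[lsmul ℝ ℝ] g) x
    rw [hg']
    exact hkf.mul_bdd hw'.smooth.continuous.aestronglyMeasurable (.of_forall hC')

/-- The local covariance of two functions with respect to an averaging kernel. -/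
def covariance (k f g : E3 → ℝ) (x : E3) : ℝ :=
  ∫ y, k y * ((f (x - y) - (k ⋆[lsmul ℝ ℝ] f) x) * (g (x - y) - (k ⋆[lsmul ℝ ℝ] g) x))

/-- The variance formula for an average of total weight one. It identifies the commutator, which
appears in the energy flux, with an expression quadratic in increments. -/
theorem covariance_eq (hk : IsEvenKernel k) (hk1 : ∫ x, k x = 1) {f g : E3 → ℝ} (hf : MemLp f 2)
    (hg : MemLp g 2) (x : E3) : covariance k f g x
      = (k ⋆[lsmul ℝ ℝ] fun y => f y * g y) x - (k ⋆[lsmul ℝ ℝ] f) x * (k ⋆[lsmul ℝ ℝ] g) x := by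
  have hi : ∀ h : E3 → ℝ, LocallyIntegrable h → Integrable fun y => k y * h (x - y) :=
    fun h hh => integrable_conv_integrand hk.smooth hk.compact hh x
  have hf1 := hi f (hf.locallyIntegrable one_le_two)
  have hg1 := hi g (hg.locallyIntegrable one_le_two)
  have hfg1 := hi (fun y => f y * g y) (hf.integrable_mul hg).locallyIntegrable
  set a := (k ⋆[lsmul ℝ ℝ] f) x with ha
  set b := (k ⋆[lsmul ℝ ℝ] g) x with hb
  have ha' : ∫ y, k y * f (x - y) = a := rfl
  have hb' : ∫ y, k y * g (x - y) = b := rfl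
  have h : ∀ y, k y * ((f (x - y) - a) * (g (x - y) - b)) =
      (k y * (f (x - y) * g (x - y)) - b * (k y * f (x - y)))
        - (a * (k y * g (x - y)) - a * b * k y) := fun y => by ring
  change ∫ y, k y * ((f (x - y) - a) * (g (x - y) - b)) = _
  simp only [h]
  have hi1 : Integrable fun y => k y * (f (x - y) * g (x - y)) - b * (k y * f (x - y)) :=
    hfg1.sub (hf1.const_mul b)
  have hi2 : Integrable fun y => a * (k y * g (x - y)) - a * b * k y :=
    (hg1.const_mul a).sub (hk.integrable.const_mul _)
  rw [integral_sub hi1 hi2, integral_sub hfg1 (hf1.const_mul b),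
    integral_sub (hg1.const_mul a) (hk.integrable.const_mul _),
    integral_const_mul, integral_const_mul, integral_const_mul, ha', hb', hk1]
  change (k ⋆[lsmul ℝ ℝ] fun y => f y * g y) x - _ - _ = _
  ring

theorem continuous_covariance (hk : IsEvenKernel k) (hk1 : ∫ x, k x = 1) {f g : E3 → ℝ}
    (hf : MemLp f 2) (hg : MemLp g 2) : Continuous (covariance k f g) := by
  have : covariance k f g = fun x => _ := funext fun x => covariance_eq hk hk1 hf hg x
  rw [this]
  exact (contDiff_conv hk.smooth hk.compact
      (hf.integrable_mul hg).locallyIntegrable).continuous.sub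
    ((isTame_conv hk.smooth hk.compact hf).smooth.continuous.mul
      (isTame_conv hk.smooth hk.compact hg).smooth.continuous)

/-- A smooth divergence-free field does not transfer energy to itself. -/
theorem sum_integral_mul_mul_pd_eq_zero {w : Fin 3 → E3 → ℝ} (hw : ∀ i, IsTame (w i))
    (hw' : ∀ i j, IsTame (pd i (w j))) (hdiv : ∀ x, ∑ i, pd i (w i) x = 0) (j : Fin 3) :
    ∑ i, ∫ x, w i x * w j x * pd i (w j) x = 0 := by
  -- Since `w_j ∂_i w_j = ∂_i (w_j²) / 2`, integrating by parts leaves `∂_i w_i`, which sums to zero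
  -- over `i`.
  have h1 : ∀ i, ∫ x, w i x * w j x * pd i (w j) x
      = -(1 / 2) * ∫ x, pd i (w i) x * w j x * w j x := by
    intro i
    have hsq : ∀ x, pd i (fun y => w j y * w j y) x = w j x * pd i (w j) x + w j x * pd i (w j) x :=
      pd_mul (hw j).smooth (hw j).smooth i
    have h := integral_mul_fderiv_eq_neg_fderiv_mul_of_integrable (μ := (volume : Measure E3))
      (f := w i) (g := fun y => w j y * w j y) (v := EuclideanSpace.single i 1)
      (((hw' i i).integrable_mul (hw j) (hw j)).congr (.of_forall fun x => mul_assoc _ _ _)) ?_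
      (((hw i).integrable_mul (hw j) (hw j)).congr (.of_forall fun x => mul_assoc _ _ _))
      (fun x _ => (hw i).smooth.differentiable (by simp) x)
      (fun x _ => ((hw j).smooth.mul (hw j).smooth).differentiable (by simp) x)
    · change ∫ x, w i x * pd i (fun y => w j y * w j y) x
        = -∫ x, pd i (w i) x * (w j x * w j x) at h
      simp only [hsq] at h
      have h2 : ∀ x, w i x * (w j x * pd i (w j) x + w j x * pd i (w j) x)
        = 2 * (w i x * w j x * pd i (w j) x) := fun x => by ring
      simp only [h2, ← mul_assoc (pd i (w i) _)] at h
      rw [integral_const_mul] at h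
      linarith
    · change Integrable fun x => w i x * pd i (fun y => w j y * w j y) x
      simp only [hsq]
      refine (((hw i).integrable_mul (hw j) (hw' i j)).const_mul 2).congr (.of_forall fun x => ?_)
      simp only
      ring
  simp only [h1]
  rw [← Finset.mul_sum, ← integral_finsetSum _ fun i _ => (hw' i i).integrable_mul (hw j) (hw j)]
  simp only [← Finset.sum_mul, hdiv, zero_mul, integral_zero, mul_zero]

/-- The Constantin–E–Titi commutator identity. -/
theorem sum_flux_eq_integral_covariance (hk : IsEvenKernel k) (hk1 : ∫ x, k x = 1)
    {f : Fin 3 → E3 → ℝ} (hf : ∀ i, MemLp (f i) 2)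
    (hdiv : ∀ x, ∑ i, (pd i k ⋆[lsmul ℝ ℝ] f i) x = 0) :
    ∑ j, ∑ i, ∫ x, f i x * f j x * (pd i k ⋆[lsmul ℝ ℝ] (k ⋆[lsmul ℝ ℝ] f j)) x
      = ∫ x, ∑ j, ∑ i, covariance k (f i) (f j) x * (pd i k ⋆[lsmul ℝ ℝ] f j) x := by
  have hw : ∀ i, IsTame (k ⋆[lsmul ℝ ℝ] f i) := fun i => isTame_conv hk.smooth hk.compact (hf i)
  have hG : ∀ i j, IsTame (pd i k ⋆[lsmul ℝ ℝ] f j) := fun i j =>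
    isTame_conv (contDiff_pd hk.smooth i) (hasCompactSupport_pd hk.compact i) (hf j)
  have hpd : ∀ i j, pd i (k ⋆[lsmul ℝ ℝ] f j) = pd i k ⋆[lsmul ℝ ℝ] f j := fun i j =>
    pd_conv hk.smooth hk.compact ((hf j).locallyIntegrable one_le_two) i
  have h0 : ∀ j, ∑ i, ∫ x, (k ⋆[lsmul ℝ ℝ] f i) x * (k ⋆[lsmul ℝ ℝ] f j) x
      * (pd i k ⋆[lsmul ℝ ℝ] f j) x = 0 := by
    intro j
    have := sum_integral_mul_mul_pd_eq_zero hw (fun i j => hpd i j ▸ hG i j)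
      (by simpa only [hpd] using hdiv) j
    simpa only [hpd] using this
  have hi1 : ∀ i j, Integrable fun x => (k ⋆[lsmul ℝ ℝ] fun y => f i y * f j y) x
      * (pd i k ⋆[lsmul ℝ ℝ] f j) x := by
    intro i j
    obtain ⟨C, hC⟩ := (hG i j).bounded
    exact (memLp_one_iff_integrable.1 (memLp_conv hk.smooth hk.compact le_rfl ENNReal.one_ne_top
      (memLp_one_iff_integrable.2 ((hf i).integrable_mul (hf j))))).mul_bdd
        (hG i j).smooth.continuous.aestronglyMeasurable (.of_forall hC)
  have hi2 : ∀ i j, Integrable fun x => (k ⋆[lsmul ℝ ℝ] f i) x * (k ⋆[lsmul ℝ ℝ] f j) x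
      * (pd i k ⋆[lsmul ℝ ℝ] f j) x := fun i j => (hw i).integrable_mul (hw j) (hG i j)
  have hi : ∀ i j, Integrable fun x =>
      covariance k (f i) (f j) x * (pd i k ⋆[lsmul ℝ ℝ] f j) x := by
    intro i j
    refine ((hi1 i j).sub (hi2 i j)).congr (.of_forall fun x => ?_)
    simp only [Pi.sub_apply]
    rw [covariance_eq hk hk1 (hf i) (hf j), sub_mul]
  rw [integral_finsetSum _ fun j _ => integrable_finsetSum _ fun i _ => hi i j]
  refine Finset.sum_congr rfl fun j _ => ?_
  rw [integral_finsetSum _ fun i _ => hi i j]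
  -- Subtracting the vanishing self-transfer `h0` turns `k ⋆ (f_i f_j)` into the covariance.
  rw [← sub_zero (∑ i, ∫ x, f i x * _ * _), ← h0 j, ← Finset.sum_sub_distrib]
  refine Finset.sum_congr rfl fun i _ => ?_
  rw [integral_mul_conv_conv hk i (f := fun y => f i y * f j y)
    ((hf i).integrable_mul (hf j)) (hf j)]
  rw [← integral_sub (hi1 i j) (hi2 i j)]
  refine integral_congr_ae (.of_forall fun x => ?_)
  simp only
  rw [covariance_eq hk hk1 (hf i) (hf j), sub_mul]

end Commutator

/-! ### The estimate of the mollified flux -/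

section FluxEstimate

open ContinuousLinearMap (lsmul)
open scoped Convolution

/-! ### Scaling of the mollifiers. -/

theorem mollBump_apply (n : ℕ) (x : E3) : mollBump n x = mollBump 0 ((2 : ℝ) ^ (n : ℝ) • x) := by
  -- A bump depends only on the ratio of its radii, which is 2 for all `n`, and on the point
  -- rescaled by the inner radius.
  change (someContDiffBumpBase E3).toFun _ _ = (someContDiffBumpBase E3).toFun _ _
  have h : (2 : ℝ) ^ (-(n : ℝ)) ≠ 0 := by positivity
  have h' : (2 : ℝ) ^ (n : ℝ) ≠ 0 := by positivity
  simp only [mollBump, sub_zero, smul_smul, Nat.cast_zero, neg_zero, Real.rpow_zero]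
  congr 1
  · field_simp
  · congr 1
    rw [Real.rpow_neg two_pos.le]
    field_simp

theorem moll_apply (n : ℕ) (x : E3) :
    moll n x = ((2 : ℝ) ^ (n : ℝ)) ^ 3 * moll 0 ((2 : ℝ) ^ (n : ℝ) • x) := by
  have h : ∫ y, mollBump n y = (((2 : ℝ) ^ (n : ℝ)) ^ 3)⁻¹ * ∫ y, mollBump 0 y := by
    simp only [mollBump_apply n]
    rw [Measure.integral_comp_smul, finrank_euclideanSpace_fin, abs_of_nonneg (by positivity),
      smul_eq_mul]
  have h' : (2 : ℝ) ^ (n : ℝ) ≠ 0 := by positivity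
  have h0 : ∫ y, mollBump 0 y ≠ 0 := (mollBump 0).integral_pos.ne'
  simp only [moll, ContDiffBump.normed]
  rw [h, mollBump_apply n]
  field_simp

theorem pd_moll (n : ℕ) (l : Fin 3) (x : E3) : pd l (moll n) x
    = (2 : ℝ) ^ (n : ℝ) * (((2 : ℝ) ^ (n : ℝ)) ^ 3 * pd l (moll 0) ((2 : ℝ) ^ (n : ℝ) • x)) := by
  set c := (2 : ℝ) ^ (n : ℝ) with hc
  have h1 : moll n = fun x => c ^ 3 * moll 0 (c • x) := funext fun x => moll_apply n x
  have h2 : HasFDerivAt (fun x : E3 => c • x) (c • ContinuousLinearMap.id ℝ E3) x :=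
    (hasFDerivAt_id x).const_smul c
  have h3 := ((((contDiff_moll 0).differentiable (by simp) (c • x)).hasFDerivAt.comp x h2).const_mul
    (c ^ 3)).fderiv
  have h4 : fderiv ℝ (fun x => c ^ 3 * moll 0 (c • x)) x = _ := h3
  rw [h1, pd, h4]
  simp [pd]
  ring

theorem exists_lintegral_enorm_pd_moll_le : ∃ C : ℝ≥0∞, C ≠ ⊤ ∧ ∀ (n : ℕ) (l : Fin 3),
    ∫⁻ x, ‖pd l (moll n) x‖ₑ ≤ C * 2 ^ (n : ℝ) := by
  refine ⟨∑ l, ∫⁻ x, ‖pd l (moll 0) x‖ₑ, ENNReal.sum_ne_top.2 fun l _ =>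
    (integrable_of_contDiff (contDiff_pd (contDiff_moll 0) l)
      (hasCompactSupport_pd (hasCompactSupport_moll 0) l)).2.ne, fun n l => ?_⟩
  have hc : (0 : ℝ) < 2 ^ (n : ℝ) := by positivity
  have h2 : ‖(2 : ℝ) ^ (n : ℝ)‖ₑ = 2 ^ (n : ℝ) := by
    rw [Real.enorm_of_nonneg hc.le, ← ENNReal.ofReal_rpow_of_pos two_pos, ENNReal.ofReal_ofNat]
  simp only [pd_moll n l, enorm_mul]
  rw [lintegral_const_mul' _ _ enorm_ne_top, lintegral_const_mul' _ _ enorm_ne_top,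
    lintegral_comp_smul hc.ne' (fun x => ‖pd l (moll 0) x‖ₑ),
    ← mul_assoc ‖((2 : ℝ) ^ (n : ℝ)) ^ 3‖ₑ,
    Real.enorm_of_nonneg (r := ((2 : ℝ) ^ (n : ℝ)) ^ 3) (by positivity),
    ← ENNReal.ofReal_mul (by positivity),
    abs_of_nonneg (by positivity), mul_inv_cancel₀ (by positivity), ENNReal.ofReal_one, one_mul,
    h2, mul_comm]
  gcongr
  exact Finset.single_le_sum (f := fun l => ∫⁻ x, ‖pd l (moll 0) x‖ₑ) (fun _ _ => zero_le)
    (Finset.mem_univ l)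

/-! ### `L³` estimates of covariances and mollified gradients. -/

theorem lintegral_mul_mul_le {F G H : E3 → ℝ≥0∞} (hF : AEMeasurable F) (hG : AEMeasurable G)
    (hH : AEMeasurable H) {A B D : ℝ≥0∞} (hA : ∫⁻ x, F x ^ (3 : ℝ) ≤ A ^ (3 : ℝ))
    (hB : ∫⁻ x, G x ^ (3 : ℝ) ≤ B ^ (3 : ℝ)) (hD : ∫⁻ x, H x ^ (3 : ℝ) ≤ D ^ (3 : ℝ)) :
    ∫⁻ x, F x * G x * H x ≤ A * B * D := by
  have h := ENNReal.lintegral_prod_norm_pow_le (μ := (volume : Measure E3))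
    (Finset.univ : Finset (Fin 3))
    (f := ![fun x => F x ^ (3 : ℝ), fun x => G x ^ (3 : ℝ), fun x => H x ^ (3 : ℝ)])
    (p := fun _ => 1 / 3) (fun i _ => by
      fin_cases i
      exacts [hF.pow_const _, hG.pow_const _, hH.pow_const _]) (by norm_num) (by norm_num)
  have hc : ∀ a : ℝ≥0∞, (a ^ (3 : ℝ)) ^ (1 / 3 : ℝ) = a := fun a => by
    rw [← ENNReal.rpow_mul]; norm_num
  have hc' : ∀ a b : ℝ≥0∞, a ≤ b ^ (3 : ℝ) → a ^ (1 / 3 : ℝ) ≤ b := fun a b hab =>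
    (ENNReal.rpow_le_rpow hab (by norm_num)).trans_eq (hc b)
  simp only [Fin.prod_univ_three, Matrix.cons_val, hc] at h
  refine h.trans ?_
  gcongr
  exacts [hc' _ _ hA, hc' _ _ hB, hc' _ _ hD]

theorem lintegral_enorm_rpow_three {f : E3 → ℝ} :
    ∫⁻ x, ‖f x‖ₑ ^ (3 : ℝ) = eLpNorm f 3 ^ (3 : ℝ) := by
  rw [eLpNorm_eq_lintegral_rpow_enorm_toReal (by norm_num) (by simp), ← ENNReal.rpow_mul]
  norm_num

/-- The size of increments at scale `2^{-n}`. -/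
def incrBound (n : ℕ) (f : E3 → ℝ) : ℝ≥0∞ := 2 ^ (-((n : ℝ) / 3)) * modulus n f

/-- Three increments gain `2 ^ (-n/3)` each and one derivative loses `2 ^ n`: at regularity `1/3`
the powers balance exactly. -/
theorem incrBound_mul_mul (n : ℕ) (f g h : E3 → ℝ) :
    incrBound n f * incrBound n g * (2 ^ (n : ℝ) * incrBound n h)
      = modulus n f * modulus n g * modulus n h := by
  have h2 : (2 : ℝ≥0∞) ^ (-((n : ℝ) / 3)) * 2 ^ (-((n : ℝ) / 3)) * 2 ^ (-((n : ℝ) / 3))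
      * 2 ^ (n : ℝ) = 1 := by
    rw [← ENNReal.rpow_add _ _ two_ne_zero ENNReal.ofNat_ne_top,
      ← ENNReal.rpow_add _ _ two_ne_zero ENNReal.ofNat_ne_top,
      ← ENNReal.rpow_add _ _ two_ne_zero ENNReal.ofNat_ne_top]
    ring_nf
    simp
  calc _ = (2 : ℝ≥0∞) ^ (-((n : ℝ) / 3)) * 2 ^ (-((n : ℝ) / 3)) * 2 ^ (-((n : ℝ) / 3))
      * 2 ^ (n : ℝ) * (modulus n f * modulus n g * modulus n h) := by
        simp only [incrBound]
        ring
    _ = _ := by rw [h2, one_mul]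

/-- After translation by `z` this is one increment by `y - z`. Two points of the mollifier's support
can be almost `2 ^ (1 - n)` apart, which explains the scale in `modulus`. -/
theorem lintegral_enorm_sub_sub_le {n : ℕ} {f : E3 → ℝ} (hf : AEStronglyMeasurable f) {y z : E3}
    (hyz : ‖y - z‖ ≤ (2 : ℝ) ^ (1 - (n : ℝ))) :
    ∫⁻ x, ‖f (x - y) - f (x - z)‖ₑ ^ (3 : ℝ) ≤ incrBound n f ^ (3 : ℝ) := by
  have h1 : (fun x => f (x - y) - f (x - z)) = incr (y - z) f ∘ fun x => x - z := by
    ext x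
    simp [incr]
  rw [lintegral_enorm_rpow_three, h1, eLpNorm_comp_measurePreserving
    (aestronglyMeasurable_incr hf (y - z)) (measurePreserving_sub_right volume z)]
  refine ENNReal.rpow_le_rpow ?_ (by norm_num)
  calc _ = (2 : ℝ≥0∞) ^ (-((n : ℝ) / 3)) * (2 ^ ((n : ℝ) / 3) * eLpNorm (incr (y - z) f) 3) := by
        rw [← mul_assoc, ← ENNReal.rpow_add _ _ two_ne_zero ENNReal.ofNat_ne_top, neg_add_cancel,
          ENNReal.rpow_zero, one_mul]
    _ ≤ (2 : ℝ≥0∞) ^ (-((n : ℝ) / 3)) * modulus n f := by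
      have h := eLpNorm_incr_le_modulus f hyz
      generalize modulus n f = m at h ⊢
      gcongr

theorem two_mul_two_rpow_neg (n : ℕ) :
    (2 : ℝ) ^ (-(n : ℝ)) + (2 : ℝ) ^ (-(n : ℝ)) = (2 : ℝ) ^ (1 - (n : ℝ)) := by
  rw [sub_eq_add_neg, Real.rpow_add two_pos, Real.rpow_one]
  ring

theorem aestronglyMeasurable_comp_sub {f : E3 → ℝ} (hf : AEStronglyMeasurable f) :
    AEStronglyMeasurable (fun z : E3 × E3 => f (z.1 - z.2)) (volume.prod volume) :=
  hf.comp_quasiMeasurePreserving (quasiMeasurePreserving_sub_of_right_invariant volume volume)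

theorem aestronglyMeasurable_comp_sub_const {f : E3 → ℝ} (hf : AEStronglyMeasurable f) (y : E3) :
    AEStronglyMeasurable (fun x => f (x - y)) :=
  hf.comp_measurePreserving (measurePreserving_sub_right volume y)

/-- As the mollifier has integral one, the deviation is an average of `f (x - y) - f (x - z)` over
`z` in its support; Minkowski's inequality takes the `L³` norm inside. -/
theorem lintegral_enorm_sub_conv_le {n : ℕ} {f : E3 → ℝ} (hf : MemLp f 2) {y : E3}
    (hy : moll n y ≠ 0) :
    ∫⁻ x, ‖f (x - y) - (moll n ⋆[lsmul ℝ ℝ] f) x‖ₑ ^ (3 : ℝ) ≤ incrBound n f ^ (3 : ℝ) := by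
  have hloc := hf.locallyIntegrable one_le_two
  have h1 : ∀ x, ‖f (x - y) - (moll n ⋆[lsmul ℝ ℝ] f) x‖ₑ
      ≤ ∫⁻ z, ‖moll n z‖ₑ * ‖f (x - y) - f (x - z)‖ₑ := by
    intro x
    have hi : Integrable fun z => moll n z * f (x - z) :=
      integrable_conv_integrand (contDiff_moll n) (hasCompactSupport_moll n) hloc x
    have h2 : f (x - y) - (moll n ⋆[lsmul ℝ ℝ] f) x
        = ∫ z, moll n z * (f (x - y) - f (x - z)) := by
      simp only [mul_sub]
      rw [integral_sub ((integrable_moll n).mul_const _) hi, integral_mul_const, integral_moll,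
        one_mul]
      rfl
    rw [h2]
    refine (enorm_integral_le_lintegral_enorm _).trans_eq ?_
    simp only [enorm_mul]
  have h3 := lintegral_rpow_lintegral_mul_le (p := 3) (by norm_num)
    (contDiff_moll n).continuous.enorm.measurable (by rw [lintegral_enorm_moll]; simp)
    (a := fun w => ‖f (w.1 - y) - f (w.1 - w.2)‖ₑ) (A := incrBound n f ^ (3 : ℝ)) ?_ fun z hz => ?_
  · rw [lintegral_enorm_moll, ENNReal.one_rpow, one_mul] at h3
    refine le_trans (lintegral_mono fun x => ?_) h3
    exact ENNReal.rpow_le_rpow (h1 x) (by norm_num)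
  · exact ((aestronglyMeasurable_comp_sub_const hf.1 y).comp_fst.sub
      (aestronglyMeasurable_comp_sub hf.1)).enorm
  · refine lintegral_enorm_sub_sub_le hf.1 ?_
    rw [← two_mul_two_rpow_neg]
    exact (norm_sub_le _ _).trans (add_le_add (norm_lt_of_moll_ne_zero hy).le
      (norm_lt_of_moll_ne_zero (enorm_ne_zero.1 hz)).le)

theorem norm_le_of_pd_moll_ne_zero {n : ℕ} {l : Fin 3} {x : E3} (h : pd l (moll n) x ≠ 0) :
    ‖x‖ ≤ (2 : ℝ) ^ (-(n : ℝ)) := by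
  by_contra! hx
  refine h ?_
  have h1 : moll n =ᶠ[𝓝 x] fun _ => 0 := by
    filter_upwards [continuous_norm.continuousAt.eventually (lt_mem_nhds hx)] with y hy
    by_contra hy'
    exact (norm_lt_of_moll_ne_zero hy').not_gt hy
  rw [pd, h1.fderiv_eq]
  simp

theorem integral_pd_moll (n : ℕ) (l : Fin 3) : ∫ x, pd l (moll n) x = 0 := by
  have h := integral_neg_eq_self (fun x => pd l (moll n) x) (volume : Measure E3)
  simp only [(isEvenKernel_moll n).pd_odd, integral_neg] at h
  linarith

/-- The derivative of the mollifier has mean zero, so `f x` can be subtracted inside the convolution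
and only increments remain. -/
theorem lintegral_enorm_pd_conv_le {n : ℕ} {f : E3 → ℝ} (hf : MemLp f 2) (l : Fin 3) :
    ∫⁻ x, ‖(pd l (moll n) ⋆[lsmul ℝ ℝ] f) x‖ₑ ^ (3 : ℝ)
      ≤ ((∫⁻ x, ‖pd l (moll n) x‖ₑ) * incrBound n f) ^ (3 : ℝ) := by
  have hloc := hf.locallyIntegrable one_le_two
  have hc1 := contDiff_pd (contDiff_moll n) l
  have hc2 := hasCompactSupport_pd (hasCompactSupport_moll n) l
  have hint := integrable_of_contDiff hc1 hc2
  have h1 : ∀ x, ‖(pd l (moll n) ⋆[lsmul ℝ ℝ] f) x‖ₑ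
      ≤ ∫⁻ z, ‖pd l (moll n) z‖ₑ * ‖f (x - z) - f (x - 0)‖ₑ := by
    intro x
    have hi : Integrable fun z => pd l (moll n) z * f (x - z) :=
      integrable_conv_integrand hc1 hc2 hloc x
    have h2 : (pd l (moll n) ⋆[lsmul ℝ ℝ] f) x
        = ∫ z, pd l (moll n) z * (f (x - z) - f (x - 0)) := by
      simp only [mul_sub]
      rw [integral_sub hi (hint.mul_const _), integral_mul_const, integral_pd_moll, zero_mul,
        sub_zero]
      rfl
    rw [h2]
    refine (enorm_integral_le_lintegral_enorm _).trans_eq ?_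
    simp only [enorm_mul]
  have h3 := lintegral_rpow_lintegral_mul_le (p := 3) (by norm_num)
    hc1.continuous.enorm.measurable hint.2.ne
    (a := fun w => ‖f (w.1 - w.2) - f (w.1 - 0)‖ₑ) (A := incrBound n f ^ (3 : ℝ)) ?_ fun z hz => ?_
  · rw [ENNReal.mul_rpow_of_nonneg _ _ (by norm_num)]
    refine le_trans (lintegral_mono fun x => ?_) h3
    exact ENNReal.rpow_le_rpow (h1 x) (by norm_num)
  · exact ((aestronglyMeasurable_comp_sub hf.1).sub
      (aestronglyMeasurable_comp_sub_const hf.1 0).comp_fst).enorm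
  · refine lintegral_enorm_sub_sub_le hf.1 ?_
    rw [sub_zero, ← two_mul_two_rpow_neg]
    have := norm_le_of_pd_moll_ne_zero (enorm_ne_zero.1 hz)
    have h0 : (0 : ℝ) ≤ 2 ^ (-(n : ℝ)) := by positivity
    linarith

/-- The averaging variable `y` of the covariance is moved outside; for each `y` in the support,
Hölder with exponents 3, 3, 3 in `x` bounds the two deviations times the mollified gradient. -/
theorem exists_lintegral_covariance_mul_le : ∃ C : ℝ≥0∞, C ≠ ⊤ ∧ ∀ (n : ℕ) (l : Fin 3)
    (f g h : E3 → ℝ), MemLp f 2 → MemLp g 2 → MemLp h 2 →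
    ∫⁻ x, ‖covariance (moll n) f g x‖ₑ * ‖(pd l (moll n) ⋆[lsmul ℝ ℝ] h) x‖ₑ
      ≤ C * (modulus n f * modulus n g * modulus n h) := by
  obtain ⟨C, hC, hCle⟩ := exists_lintegral_enorm_pd_moll_le
  refine ⟨C, hC, fun n l f g h hf hg hh => ?_⟩
  have hm : ∀ f : E3 → ℝ, MemLp f 2 → AEMeasurable
      (fun z : E3 × E3 => ‖f (z.1 - z.2) - (moll n ⋆[lsmul ℝ ℝ] f) z.1‖ₑ)
      (volume.prod volume) := fun f hf => ((aestronglyMeasurable_comp_sub hf.1).sub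
    (isTame_conv (contDiff_moll n) (hasCompactSupport_moll n) hf).memLp.1.comp_fst).enorm
  have hG := (isTame_conv (contDiff_pd (contDiff_moll n) l)
    (hasCompactSupport_pd (hasCompactSupport_moll n) l) hh).smooth.continuous.enorm.measurable
  have hk := (contDiff_moll n).continuous.enorm.measurable
  have hm' : AEMeasurable (fun z : E3 × E3 => ‖moll n z.2‖ₑ *
      (‖f (z.1 - z.2) - (moll n ⋆[lsmul ℝ ℝ] f) z.1‖ₑ *
        ‖g (z.1 - z.2) - (moll n ⋆[lsmul ℝ ℝ] g) z.1‖ₑ *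
          ‖(pd l (moll n) ⋆[lsmul ℝ ℝ] h) z.1‖ₑ)) (volume.prod volume) :=
    (hk.comp measurable_snd).aemeasurable.mul
      (((hm f hf).mul (hm g hg)).mul (hG.comp measurable_fst).aemeasurable)
  have hms : ∀ f : E3 → ℝ, MemLp f 2 → ∀ y, AEMeasurable
      (fun x => ‖f (x - y) - (moll n ⋆[lsmul ℝ ℝ] f) x‖ₑ) := fun f hf y =>
    ((aestronglyMeasurable_comp_sub_const hf.1 y).sub
      (isTame_conv (contDiff_moll n) (hasCompactSupport_moll n) hf).memLp.1).enorm
  calc _ ≤ ∫⁻ x, ∫⁻ y, ‖moll n y‖ₑ * (‖f (x - y) - (moll n ⋆[lsmul ℝ ℝ] f) x‖ₑ *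
        ‖g (x - y) - (moll n ⋆[lsmul ℝ ℝ] g) x‖ₑ *
          ‖(pd l (moll n) ⋆[lsmul ℝ ℝ] h) x‖ₑ) := by
        refine lintegral_mono fun x => ?_
        simp only [← mul_assoc]
        rw [lintegral_mul_const' _ _ enorm_ne_top]
        refine mul_le_mul_left ((enorm_integral_le_lintegral_enorm _).trans_eq ?_) _
        simp only [enorm_mul, mul_assoc]
    _ = ∫⁻ y, ∫⁻ x, ‖moll n y‖ₑ * (‖f (x - y) - (moll n ⋆[lsmul ℝ ℝ] f) x‖ₑ *
        ‖g (x - y) - (moll n ⋆[lsmul ℝ ℝ] g) x‖ₑ *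
          ‖(pd l (moll n) ⋆[lsmul ℝ ℝ] h) x‖ₑ) := lintegral_lintegral_swap hm'
    _ ≤ ∫⁻ y, ‖moll n y‖ₑ * (incrBound n f * incrBound n g *
        ((∫⁻ x, ‖pd l (moll n) x‖ₑ) * incrBound n h)) := by
      refine lintegral_mono fun y => ?_
      simp only
      rw [lintegral_const_mul' _ _ enorm_ne_top]
      rcases eq_or_ne (moll n y) 0 with h0 | h0
      · simp [h0]
      · exact mul_le_mul_right (lintegral_mul_mul_le (hms f hf y) (hms g hg y) hG.aemeasurable
          (lintegral_enorm_sub_conv_le hf h0) (lintegral_enorm_sub_conv_le hg h0)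
          (lintegral_enorm_pd_conv_le hh l)) _
    _ = incrBound n f * incrBound n g * ((∫⁻ x, ‖pd l (moll n) x‖ₑ) * incrBound n h) := by
      rw [lintegral_mul_const _ hk, lintegral_enorm_moll, one_mul]
    _ ≤ incrBound n f * incrBound n g * (C * 2 ^ (n : ℝ) * incrBound n h) := by
      gcongr
      exact hCle n l
    _ = C * (incrBound n f * incrBound n g * (2 ^ (n : ℝ) * incrBound n h)) := by ring
    _ = _ := by rw [incrBound_mul_mul]

/-- The bound of the flux in terms of moduli: every product involves one of the first two
components. -/
def fluxBound (m : Fin 3 → ℝ≥0∞) : ℝ≥0∞ := (m 0 + m 1) * (m 0 + m 1 + m 2) ^ 2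

theorem mul_mul_le_fluxBound (m : Fin 3 → ℝ≥0∞) {a b c : Fin 3} (h : a ≠ 2) :
    m a * m b * m c ≤ fluxBound m := by
  have h1 : m a ≤ m 0 + m 1 := by
    fin_cases a
    · exact le_self_add
    · exact le_add_self
    · exact absurd rfl h
  have h2 : ∀ b, m b ≤ m 0 + m 1 + m 2 := by
    intro b
    fin_cases b
    · exact le_self_add.trans le_self_add
    · exact le_add_self.trans le_self_add
    · exact le_add_self
  rw [fluxBound, mul_assoc, sq]
  exact mul_le_mul' h1 (mul_le_mul' (h2 b) (h2 c))

/-- This is where the third component is spared. Write `R` for the covariances and `G` for the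
mollified gradients. Since `∑ G_ii = 0`, subtracting `R_22` from each diagonal entry changes
nothing. The term `i = j = 2` then cancels, and all others contain a modulus of component 0 or 1. -/
theorem exists_enorm_integral_covariance_le : ∃ C : ℝ≥0∞, C ≠ ⊤ ∧ ∀ (n : ℕ) (f : Fin 3 → E3 → ℝ),
    (∀ i, MemLp (f i) 2) → (∀ x, ∑ i, (pd i (moll n) ⋆[lsmul ℝ ℝ] f i) x = 0) →
    ‖∫ x, ∑ j, ∑ i, covariance (moll n) (f i) (f j) x * (pd i (moll n) ⋆[lsmul ℝ ℝ] f j) x‖ₑ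
      ≤ C * fluxBound fun i => modulus n (f i) := by
  obtain ⟨C, hC, hCle⟩ := exists_lintegral_covariance_mul_le
  -- One `C` pays for `R_ij`, the other for the subtracted `R_22`.
  refine ⟨∑ _j : Fin 3, ∑ _i : Fin 3, (C + C), by simp [hC, ENNReal.mul_eq_top],
    fun n f hf hdiv => ?_⟩
  set R : Fin 3 → Fin 3 → E3 → ℝ := fun i j => covariance (moll n) (f i) (f j) with hR
  set G : Fin 3 → Fin 3 → E3 → ℝ := fun i j => pd i (moll n) ⋆[lsmul ℝ ℝ] f j with hG
  set m : Fin 3 → ℝ≥0∞ := fun i => modulus n (f i) with hm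
  have hle : ∀ i j l q, ∫⁻ x, ‖R i j x‖ₑ * ‖G l q x‖ₑ ≤ C * (m i * m j * m q) := fun i j l q =>
    hCle n l (f i) (f j) (f q) (hf i) (hf j) (hf q)
  have hRm : ∀ i j, Measurable fun x => ‖R i j x‖ₑ := fun i j =>
    (continuous_covariance (isEvenKernel_moll n) (integral_moll n) (hf i) (hf j)).enorm.measurable
  have hGm : ∀ i j, Measurable fun x => ‖G i j x‖ₑ := fun i j =>
    (isTame_conv (contDiff_pd (contDiff_moll n) i)
      (hasCompactSupport_pd (hasCompactSupport_moll n) i) (hf j)).smooth.continuous.enorm.measurable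
  have hsum : ∀ x, ∑ j, ∑ i, R i j x * G i j x
      = ∑ j, ∑ i, (R i j x - if i = j then R 2 2 x else 0) * G i j x := by
    intro x
    simp only [sub_mul, Finset.sum_sub_distrib, ite_mul, zero_mul, Finset.sum_ite_eq',
      Finset.mem_univ, if_true]
    rw [← Finset.mul_sum, hdiv x, mul_zero, sub_zero]
  have hterm : ∀ i j, ∫⁻ x, ‖(R i j x - if i = j then R 2 2 x else 0) * G i j x‖ₑ
      ≤ (C + C) * fluxBound m := by
    intro i j
    rcases eq_or_ne i j with rfl | hij
    · rcases eq_or_ne i 2 with rfl | hi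
      · simp
      · calc _ ≤ ∫⁻ x, (‖R i i x‖ₑ * ‖G i i x‖ₑ + ‖R 2 2 x‖ₑ * ‖G i i x‖ₑ) := by
              refine lintegral_mono fun x => ?_
              simp only [if_true]
              rw [enorm_mul, ← add_mul]
              gcongr
              exact enorm_sub_le
          _ = (∫⁻ x, ‖R i i x‖ₑ * ‖G i i x‖ₑ) + ∫⁻ x, ‖R 2 2 x‖ₑ * ‖G i i x‖ₑ :=
            lintegral_add_left ((hRm i i).mul (hGm i i)) _
          _ ≤ C * (m i * m i * m i) + C * (m i * m 2 * m 2) := by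
            refine add_le_add (hle _ _ _ _) ((hle _ _ _ _).trans_eq ?_)
            ring
          _ ≤ _ := by
            rw [add_mul]
            exact add_le_add (mul_le_mul_right (mul_mul_le_fluxBound m hi) _)
              (mul_le_mul_right (mul_mul_le_fluxBound m hi) _)
    · simp only [if_neg hij, sub_zero, enorm_mul]
      refine (hle i j i j).trans (mul_le_mul' le_self_add ?_)
      by_cases hi : i = 2
      · have hj : j ≠ 2 := fun h => hij (hi.trans h.symm)
        calc m i * m j * m j = m j * m i * m j := by ring
          _ ≤ _ := mul_mul_le_fluxBound m hj
      · exact mul_mul_le_fluxBound m hi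
  change ‖∫ x, ∑ j, ∑ i, R i j x * G i j x‖ₑ ≤ _
  simp only [hsum]
  have hmeas : ∀ i j, Measurable
      fun x => ‖(R i j x - if i = j then R 2 2 x else 0) * G i j x‖ₑ := by
    intro i j
    have hc : ∀ i j, Continuous (R i j) := fun i j =>
      continuous_covariance (isEvenKernel_moll n) (integral_moll n) (hf i) (hf j)
    have hc' : Continuous (G i j) := (isTame_conv (contDiff_pd (contDiff_moll n) i)
      (hasCompactSupport_pd (hasCompactSupport_moll n) i) (hf j)).smooth.continuous
    refine (Continuous.enorm (Continuous.mul ((hc i j).sub ?_) hc')).measurable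
    split_ifs
    exacts [hc 2 2, continuous_const]
  calc _ ≤ ∫⁻ x, ∑ j, ∑ i, ‖(R i j x - if i = j then R 2 2 x else 0) * G i j x‖ₑ := by
        refine (enorm_integral_le_lintegral_enorm _).trans (lintegral_mono fun x => ?_)
        exact (enorm_sum_le _ _).trans (Finset.sum_le_sum fun j _ => enorm_sum_le _ _)
    _ = ∑ j, ∑ i, ∫⁻ x, ‖(R i j x - if i = j then R 2 2 x else 0) * G i j x‖ₑ := by
        rw [lintegral_finsetSum _ fun j _ => Finset.measurable_sum _ fun i _ => hmeas i j]
        exact Finset.sum_congr rfl fun j _ => lintegral_finsetSum _ fun i _ => hmeas i j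
    _ ≤ ∑ _j : Fin 3, ∑ _i : Fin 3, (C + C) * fluxBound m :=
        Finset.sum_le_sum fun j _ => Finset.sum_le_sum fun i _ => hterm i j
    _ = _ := by simp only [Finset.sum_mul]

/-- The weak divergence condition, tested with `y ↦ k (x - y)`. -/
theorem sum_pd_conv_eq_zero {k : E3 → ℝ} (hk : IsEvenKernel k) {v : L2Field} (hv : v ∈ divFreeL2)
    (x : E3) : ∑ i, (pd i k ⋆[lsmul ℝ ℝ] fun y => v y i) x = 0 := by
  have hφ : ContDiff ℝ ∞ fun y => k (x - y) := hk.smooth.comp (contDiff_const.sub contDiff_id)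
  have hφ' : HasCompactSupport fun y => k (x - y) :=
    hk.compact.comp_homeomorph (Homeomorph.subLeft x)
  have h := hv _ hφ hφ'
  have hi : ∀ i, Integrable fun y => (v y i) * pd i k (x - y) := by
    intro i
    have h1 := (integrable_conv_integrand (contDiff_pd hk.smooth i)
      (hasCompactSupport_pd hk.compact i)
      ((memLp_coord (Lp.memLp v) i).locallyIntegrable one_le_two) x).comp_sub_left x
    refine h1.congr (.of_forall fun y => ?_)
    simp [mul_comm]
  simp only [fderiv_eq_sum_pd, pd_comp_sub_left hk.smooth, mul_neg, Finset.sum_neg_distrib,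
    integral_neg, neg_eq_zero] at h
  rw [integral_finsetSum _ fun i _ => hi i] at h
  rw [← h]
  refine Finset.sum_congr rfl fun i _ => ?_
  rw [conv_comm]
  simp [MeasureTheory.convolution]

theorem flux_smoothing_eq {k : E3 → ℝ} (hk : IsEvenKernel k) (v : L2Field) :
    flux hk v v (smoothing hk v) = ∑ j, ∑ i, ∫ x, v x i * v x j *
      (pd i k ⋆[lsmul ℝ ℝ] (k ⋆[lsmul ℝ ℝ] fun y => v y j)) x := by
  have hv : ∀ j, MemLp (fun x => v x j) 2 := memLp_coord (Lp.memLp v)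
  have hloc := locallyIntegrable_L2 (smoothing hk v)
  have hs : ContDiff ℝ ∞ (k ⋆[lsmul ℝ ℝ] smoothing hk v) := contDiff_conv hk.smooth hk.compact hloc
  have hcoord : ∀ j, (fun x => (k ⋆[lsmul ℝ ℝ] smoothing hk v) x j)
      = k ⋆[lsmul ℝ ℝ] (k ⋆[lsmul ℝ ℝ] fun y => v y j) := by
    intro j
    have hae : (fun y => smoothing hk v y j) =ᵐ[volume] k ⋆[lsmul ℝ ℝ] fun y => v y j := by
      filter_upwards [coeFn_smoothing hk v] with y hy
      rw [hy, conv_apply_coord hk.smooth hk.compact (locallyIntegrable_L2 v)]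
    ext x
    rw [conv_apply_coord hk.smooth hk.compact hloc, convolution_congr_ae_right hae]
  have hw : ∀ j, IsTame (k ⋆[lsmul ℝ ℝ] fun y => v y j) := fun j =>
    isTame_conv hk.smooth hk.compact (hv j)
  have hi : ∀ i j, Integrable fun x => v x i * v x j *
      (pd i k ⋆[lsmul ℝ ℝ] (k ⋆[lsmul ℝ ℝ] fun y => v y j)) x := by
    intro i j
    have ht := isTame_conv (contDiff_pd hk.smooth i) (hasCompactSupport_pd hk.compact i)
      (hw j).memLp
    obtain ⟨C, hC⟩ := ht.bounded
    exact ((hv i).integrable_mul (hv j)).mul_bdd ht.smooth.continuous.aestronglyMeasurable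
      (.of_forall hC)
  have hpt : ∀ x, inner ℝ (v x) (fderiv ℝ (k ⋆[lsmul ℝ ℝ] smoothing hk v) x (v x))
      = ∑ j, ∑ i, v x i * v x j *
        (pd i k ⋆[lsmul ℝ ℝ] (k ⋆[lsmul ℝ ℝ] fun y => v y j)) x := by
    intro x
    rw [PiLp.inner_apply]
    refine Finset.sum_congr rfl fun j _ => ?_
    rw [fderiv_coord (hs.differentiable (by simp) x), hcoord, fderiv_eq_sum_pd]
    simp only [pd_conv hk.smooth hk.compact ((hw j).memLp.locallyIntegrable one_le_two)]
    rw [real_inner_comm, RCLike.inner_apply, conj_trivial, Finset.mul_sum]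
    exact Finset.sum_congr rfl fun i _ => by ring
  rw [flux_apply]
  simp only [hpt]
  rw [integral_finsetSum _ fun j _ => integrable_finsetSum _ fun i _ => hi i j]
  exact Finset.sum_congr rfl fun j _ => integral_finsetSum _ fun i _ => hi i j

/-- The Constantin–E–Titi estimate of the mollified flux. -/
theorem exists_enorm_flux_le : ∃ C : ℝ≥0∞, C ≠ ⊤ ∧ ∀ (n : ℕ) (v : L2Field), v ∈ divFreeL2 →
    ‖flux (isEvenKernel_moll n) v v (smoothing (isEvenKernel_moll n) v)‖ₑ
      ≤ C * fluxBound fun i => modulus n fun x => v x i := by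
  obtain ⟨C, hC, h⟩ := exists_enorm_integral_covariance_le
  refine ⟨C, hC, fun n v hv => ?_⟩
  have hm : ∀ j, MemLp (fun x => v x j) 2 := memLp_coord (Lp.memLp v)
  have hdiv := sum_pd_conv_eq_zero (isEvenKernel_moll n) hv
  rw [flux_smoothing_eq, sum_flux_eq_integral_covariance (isEvenKernel_moll n) (integral_moll n)
    (f := fun i x => v x i) hm hdiv]
  exact h n (fun i x => v x i) hm hdiv

end FluxEstimate

/-! ### Conservation of the energy -/

section Conservation

open ContinuousLinearMap (lsmul)
open scoped Convolution

/-- The complexified `i`-th component of a square integrable field. -/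
def complexCoord (v : L2Field) (i : Fin 3) : L2C :=
  (Complex.ofRealCLM ∘L (EuclideanSpace.proj i : E3 →L[ℝ] ℝ)).compLp v

theorem coeFn_complexCoord (v : L2Field) (i : Fin 3) :
    complexCoord v i =ᵐ[volume] fun x => ((v x i : ℝ) : ℂ) :=
  ContinuousLinearMap.coeFn_compLp' _ v

/-- Complexification preserves absolute values, so the Littlewood–Paley estimates for complex
functions apply to the real components. -/
theorem modulus_complexCoord (v : L2Field) (i : Fin 3) (n : ℕ) :
    modulus n (complexCoord v i) = modulus n fun x => v x i := by
  have h : ∀ z, eLpNorm (incr z (complexCoord v i)) 3 volume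
      = eLpNorm (incr z fun x => v x i) 3 volume := by
    intro z
    rw [eLpNorm_congr_ae (incr_congr_ae (coeFn_complexCoord v i) z)]
    refine eLpNorm_congr_norm_ae (.of_forall fun x => ?_)
    simp only [incr]
    rw [← Complex.ofReal_sub, Complex.norm_real]
  simp only [modulus, h]

theorem enorm_complexCoord_le (v : L2Field) (i : Fin 3) : ‖complexCoord v i‖ₑ ≤ ‖v‖ₑ := by
  rw [← ofReal_norm, ← ofReal_norm]
  refine ENNReal.ofReal_le_ofReal (Lp.norm_le_norm_of_ae_le ?_)
  filter_upwards [coeFn_complexCoord v i] with x hx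
  rw [hx, Complex.norm_real]
  exact PiLp.norm_apply_le (v x) i

/-- The integrability exponent `2p / (p - 1)`. -/
def dualExponent (p : ℝ) : ℝ≥0∞ := ENNReal.ofReal (2 * p / (p - 1))

variable (P : DyadicPartition)

theorem besovCoeff_complexCoord_le {p : ℝ} (hp : p ∈ Ioc (1 : ℝ) 3) {M : ℝ≥0∞} {v : L2Field}
    (hM : ‖v‖ₑ ≤ M) (i : Fin 3) (j : ℤ) : besovCoeff P (complexCoord v i) j ≤
      M ^ (1 - p / 3) * ((2 : ℝ≥0∞) ^ ((j : ℝ) * (1 / p)) *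
        distLpNorm (dualExponent p) (block P j (component v i))) ^ (p / 3) := by
  refine (besovCoeff_le P hp (complexCoord v i) j).trans (mul_le_mul_left ?_ _)
  exact ENNReal.rpow_le_rpow ((enorm_complexCoord_le v i).trans hM) (by linarith [hp.2])

theorem besovCoeff_complexCoord_le_besovNorm {p : ℝ} (hp : p ∈ Ioc (1 : ℝ) 3) {M : ℝ≥0∞}
    {v : L2Field} (hM : ‖v‖ₑ ≤ M) (i : Fin 3) (j : ℤ) : besovCoeff P (complexCoord v i) j ≤
      M ^ (1 - p / 3) * besovNorm P (1 / p) (dualExponent p) (component v i) ^ (p / 3) := by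
  refine (besovCoeff_complexCoord_le P hp hM i j).trans (mul_le_mul_right ?_ _)
  refine ENNReal.rpow_le_rpow ?_ (by linarith [hp.1])
  exact le_iSup (fun j : ℤ => (2 : ℝ≥0∞) ^ ((j : ℝ) * (1 / p)) *
        distLpNorm (dualExponent p) (block P j (component v i))) j

/-- Interpolation passes the decay built into `besovC` to the `L³` coefficients, because its
exponent `p / 3` is positive. -/
theorem tendsto_modulus_coord {p : ℝ} (hp : p ∈ Ioc (1 : ℝ) 3) {v : L2Field} {i : Fin 3}
    (h : component v i ∈ besovC P (1 / p) (dualExponent p)) :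
    Tendsto (fun n => modulus n fun x => v x i) atTop (𝓝 0) := by
  have hp3 : 0 ≤ 1 - p / 3 := by linarith [hp.2]
  have hp0 : 0 < p / 3 := by linarith [hp.1]
  have hv : ‖v‖ₑ ^ (1 - p / 3) ≠ ⊤ := ENNReal.rpow_ne_top_of_nonneg hp3 enorm_ne_top
  simp only [← modulus_complexCoord]
  refine tendsto_modulus P (ENNReal.mul_ne_top hv
    (ENNReal.rpow_ne_top_of_nonneg hp0.le h.1.ne))
    (besovCoeff_complexCoord_le_besovNorm P hp le_rfl i) ?_
  refine tendsto_of_tendsto_of_tendsto_of_le_of_le tendsto_const_nhds ?_ (fun _ => zero_le)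
    (besovCoeff_complexCoord_le P hp le_rfl i)
  have h1 := ENNReal.Tendsto.const_mul
    (((ENNReal.continuous_rpow_const (y := p / 3)).tendsto 0).comp h.2) (Or.inr hv)
  rwa [ENNReal.zero_rpow_of_pos hp0, mul_zero] at h1

theorem enorm_smoothing_le (n : ℕ) (v : L2Field) : ‖smoothing (isEvenKernel_moll n) v‖ₑ ≤ ‖v‖ₑ := by
  have h := norm_convL2_apply_le (F := E3) (integrable_moll n) v
  rw [← ofReal_norm, ← ofReal_norm]
  rw [lintegral_enorm_moll, ENNReal.toReal_one, one_mul] at h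
  exact ENNReal.ofReal_le_ofReal h

/-- Mollification does not increase the norm, which bounds the limsup; Fatou's lemma with almost
everywhere convergence bounds the liminf. -/
theorem tendsto_norm_smoothing (v : L2Field) :
    Tendsto (fun n => ‖smoothing (isEvenKernel_moll n) v‖) atTop (𝓝 ‖v‖) := by
  have h : Tendsto (fun n => ‖smoothing (isEvenKernel_moll n) v‖ₑ) atTop (𝓝 ‖v‖ₑ) := by
    refine tendsto_of_le_liminf_of_limsup_le ?_
      (limsup_le_of_le (h := .of_forall fun n => enorm_smoothing_le n v))
    have h1 : ∀ᵐ x, Tendsto (fun n => smoothing (isEvenKernel_moll n) v x) atTop (𝓝 (v x)) := by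
      filter_upwards [ae_tendsto_moll_conv (locallyIntegrable_L2 v),
        ae_all_iff.2 fun n => coeFn_smoothing (isEvenKernel_moll n) v] with x hx hx'
      simpa only [hx'] using hx
    have h2 := Lp.eLpNorm_lim_le_liminf_eLpNorm (p := 2) (fun n => Lp.aestronglyMeasurable _)
      (v : E3 → E3) h1
    simpa only [Lp.enorm_def] using h2
  have h3 := (ENNReal.tendsto_toReal enorm_ne_top).comp h
  simpa [Function.comp_def] using h3

theorem aemeasurable_enorm_flux {T : ℝ} {u₀ : L2Field} {u : ℝ → L2Field} {k : E3 → ℝ}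
    (hu : IsWeakSolution T u₀ u) (hk : IsEvenKernel k) : AEMeasurable
      (fun s => ‖flux hk (u s) (u s) (smoothing hk (u s))‖ₑ) (volume.restrict (Icc 0 T)) :=
  (isBoundedBilinearMap_apply.continuous.comp_aestronglyMeasurable
    ((aestronglyMeasurable_fluxFunctional hu hk).prodMk
      ((smoothing hk).continuous.comp_aestronglyMeasurable hu.aestronglyMeasurable))).enorm

theorem fluxBound_mono {m m' : Fin 3 → ℝ≥0∞} (h : ∀ i, m i ≤ m' i) :
    fluxBound m ≤ fluxBound m' := by
  have h0 := h 0
  have h1 := h 1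
  have h2 := h 2
  rw [fluxBound, fluxBound]
  gcongr

theorem fluxBound_le (m : Fin 3 → ℝ≥0∞) : fluxBound m ≤ 9 * ∑ i, m i ^ (3 : ℝ) := by
  have h : fluxBound m ≤ (m 0 + m 1 + m 2) ^ (3 : ℝ) := by
    rw [fluxBound, show (3 : ℝ) = ((3 : ℕ) : ℝ) by norm_num, ENNReal.rpow_natCast,
      pow_succ' _ 2]
    exact mul_le_mul_left le_self_add _
  refine h.trans ?_
  -- The constant 9 is `3 ^ (3 - 1)`, from convexity of the cube over three terms.
  have h2 := ENNReal.rpow_sum_le_const_mul_sum_rpow Finset.univ m (p := 3) (by norm_num)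
  rw [Fin.sum_univ_three] at h2
  refine h2.trans_eq ?_
  norm_num

/-- The factor `m 0 + m 1` tends to zero while the squared factor stays bounded; no decay of `m 2`
is required. -/
theorem tendsto_fluxBound {m : ℕ → Fin 3 → ℝ≥0∞} {A : Fin 3 → ℝ≥0∞} (hA : ∀ i, A i ≠ ⊤)
    (hm : ∀ n i, m n i ≤ A i) (h0 : Tendsto (fun n => m n 0) atTop (𝓝 0))
    (h1 : Tendsto (fun n => m n 1) atTop (𝓝 0)) :
    Tendsto (fun n => fluxBound (m n)) atTop (𝓝 0) := by
  have hfin : (A 0 + A 1 + A 2) ^ 2 ≠ ⊤ := by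
    simp [hA]
  have h2 := ENNReal.Tendsto.mul_const (h0.add h1) (Or.inr hfin)
  rw [add_zero, zero_mul] at h2
  refine tendsto_of_tendsto_of_tendsto_of_le_of_le tendsto_const_nhds h2 (fun _ => zero_le)
    fun n => ?_
  have e0 := hm n 0
  have e1 := hm n 1
  have e2 := hm n 2
  simp only [fluxBound]
  gcongr

/-- The mollified fluxes vanish in the limit. -/
theorem tendsto_lintegral_enorm_flux {T : ℝ} {u₀ : L2Field} {u : ℝ → L2Field}
    (hu : IsWeakSolution T u₀ u) {p : Fin 3 → ℝ} (hp : ∀ i, p i ∈ Ioc (1 : ℝ) 3)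
    (h : ∀ i, MemLpTime (p i) T (if i = 2 then besovInfty P (1 / p i) (dualExponent (p i))
      else besovC P (1 / p i) (dualExponent (p i)))
      (besovNorm P (1 / p i) (dualExponent (p i))) fun t => component (u t) i) :
    Tendsto (fun n => ∫⁻ s in Ioo 0 T, ‖flux (isEvenKernel_moll n) (u s) (u s)
      (smoothing (isEvenKernel_moll n) (u s))‖ₑ) atTop (𝓝 0) := by
  obtain ⟨C, hC, hCle⟩ := exists_enorm_flux_le
  obtain ⟨C', hC', hmod⟩ := modulus_le P
  obtain ⟨M₀, hM₀, hM⟩ := hu.exists_norm_le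
  set M := ENNReal.ofReal M₀ with hMdef
  have hM' : ∀ s ∈ Icc 0 T, ‖u s‖ₑ ≤ M := fun s hs => by
    rw [← ofReal_norm]; exact ENNReal.ofReal_le_ofReal (hM s hs)
  set N : Fin 3 → ℝ → ℝ≥0∞ := fun i s =>
    besovNorm P (1 / p i) (dualExponent (p i)) (component (u s) i) with hN
  -- A majorant of the moduli that is uniform in `n`; the bound `M` on the `L²` norm is uniform in
  -- time.
  set A : ℝ → Fin 3 → ℝ≥0∞ := fun s i => C' * (M ^ (1 - p i / 3) * N i s ^ (p i / 3)) with hA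
  have hmA : ∀ s ∈ Icc 0 T, ∀ n i, modulus n (fun x => u s x i) ≤ A s i := fun s hs n i => by
    rw [← modulus_complexCoord]
    exact hmod _ _ (besovCoeff_complexCoord_le_besovNorm P (hp i) (hM' s hs) i) n
  have hp0 : ∀ i, 0 < p i := fun i => by linarith [(hp i).1]
  have hp3 : ∀ i, 0 ≤ 1 - p i / 3 := fun i => by linarith [(hp i).2]
  have hNm : ∀ i, AEMeasurable (N i) (volume.restrict (Ioo 0 T)) := fun i =>
    (h i).2.2.1.aemeasurable
  -- Cubing turns the interpolation power `p i / 3` into `p i`, exactly the power of the Besov norm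
  -- that is integrable in time.
  have hcube : ∀ s i, A s i ^ (3 : ℝ) = (C' * M ^ (1 - p i / 3)) ^ (3 : ℝ) * N i s ^ (p i) := by
    intro s i
    rw [hA]
    simp only
    rw [← mul_assoc, ENNReal.mul_rpow_of_nonneg _ _ (by norm_num), ← ENNReal.rpow_mul]
    congr 2
    ring
  have hNfin : ∀ i, ∫⁻ s in Ioo 0 T, N i s ^ (p i) ≠ ⊤ := by
    intro i
    have h1 := lintegral_rpow_enorm_lt_top_of_eLpNorm_lt_top
      (ENNReal.ofReal_pos.2 (hp0 i)).ne' ENNReal.ofReal_ne_top (h i).2.2.2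
    rw [ENNReal.toReal_ofReal (hp0 i).le] at h1
    exact h1.ne
  have hsub : Ioo 0 T ⊆ Icc 0 T := Ioo_subset_Icc_self
  have hflux : ∀ s ∈ Icc 0 T, ∀ n, ‖flux (isEvenKernel_moll n) (u s) (u s)
      (smoothing (isEvenKernel_moll n) (u s))‖ₑ
        ≤ C * fluxBound fun i => modulus n fun x => u s x i :=
    fun s hs n => hCle n (u s) (hu.mem_divFreeL2 hs)
  have hlim := tendsto_lintegral_of_dominated_convergence' (μ := volume.restrict (Ioo 0 T))
    (F := fun n s => ‖flux (isEvenKernel_moll n) (u s) (u s)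
      (smoothing (isEvenKernel_moll n) (u s))‖ₑ) (f := fun _ => 0)
    (fun s => C * (9 * ∑ i, A s i ^ (3 : ℝ)))
    (fun n => (aemeasurable_enorm_flux hu (isEvenKernel_moll n)).mono_set hsub)
    (fun n => ?_) ?_ ?_
  · simpa using hlim
  · filter_upwards [ae_restrict_mem measurableSet_Ioo] with s hs
    refine (hflux s (hsub hs) n).trans (mul_le_mul_right ?_ _)
    exact (fluxBound_mono fun i => hmA s (hsub hs) n i).trans (fluxBound_le _)
  · simp only [hcube]
    rw [lintegral_const_mul' _ _ hC, lintegral_const_mul' _ _ (by simp),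
      lintegral_finsetSum' _ fun i _ => ((hNm i).pow_const _).const_mul _]
    refine ENNReal.mul_ne_top hC (ENNReal.mul_ne_top (by simp) (ENNReal.sum_ne_top.2 fun i _ => ?_))
    have hfin : (C' * M ^ (1 - p i / 3)) ^ (3 : ℝ) ≠ ⊤ :=
      ENNReal.rpow_ne_top_of_nonneg (by norm_num) (ENNReal.mul_ne_top hC'
        (ENNReal.rpow_ne_top_of_nonneg (hp3 i) ENNReal.ofReal_ne_top))
    rw [lintegral_const_mul' _ _ hfin]
    exact ENNReal.mul_ne_top hfin (hNfin i)
  · filter_upwards [ae_restrict_mem measurableSet_Ioo, (h 0).2.1, (h 1).2.1, (h 2).2.1]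
      with s hs h0 h1 h2
    rw [if_neg (by decide)] at h0 h1
    rw [if_pos rfl] at h2
    have hNs : ∀ i, N i s ≠ ⊤ := by
      intro i
      fin_cases i
      exacts [h0.1.ne, h1.1.ne, h2.ne]
    have hAs : ∀ i, A s i ≠ ⊤ := fun i => ENNReal.mul_ne_top hC' (ENNReal.mul_ne_top
      (ENNReal.rpow_ne_top_of_nonneg (hp3 i) ENNReal.ofReal_ne_top)
      (ENNReal.rpow_ne_top_of_nonneg (by linarith [hp0 i]) (hNs i)))
    have h3 := tendsto_fluxBound hAs (hmA s (hsub hs)) (tendsto_modulus_coord P (hp 0) h0)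
      (tendsto_modulus_coord P (hp 1) h1)
    have h4 := ENNReal.Tendsto.const_mul h3 (Or.inr hC)
    rw [mul_zero] at h4
    exact tendsto_of_tendsto_of_tendsto_of_le_of_le tendsto_const_nhds h4 (fun _ => zero_le)
      (hflux s (hsub hs))

/-- In the limit of the mollified balance on `[0, t]`, the norms converge to those of `u t` and `u₀`
and the flux term disappears. -/
theorem norm_eq_of_tendsto_flux {T : ℝ} {u₀ : L2Field} {u : ℝ → L2Field}
    (hu : IsWeakSolution T u₀ u) (h : Tendsto (fun n => ∫⁻ s in Ioo 0 T,
      ‖flux (isEvenKernel_moll n) (u s) (u s) (smoothing (isEvenKernel_moll n) (u s))‖ₑ)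
      atTop (𝓝 0)) {t : ℝ} (ht : t ∈ Icc 0 T) : ‖u t‖ ^ 2 = ‖u₀‖ ^ 2 := by
  have h1 : Tendsto (fun n => ∫ s in (0 : ℝ)..t, flux (isEvenKernel_moll n) (u s) (u s)
      (smoothing (isEvenKernel_moll n) (u s))) atTop (𝓝 0) := by
    rw [tendsto_iff_enorm_sub_tendsto_zero]
    simp only [sub_zero]
    refine tendsto_of_tendsto_of_tendsto_of_le_of_le tendsto_const_nhds h (fun _ => zero_le)
      fun n => ?_
    simp only
    rw [intervalIntegral.integral_of_le ht.1, setIntegral_congr_set Ioo_ae_eq_Ioc.symm]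
    exact (enorm_integral_le_lintegral_enorm _).trans
      (lintegral_mono_set (Ioo_subset_Ioo_right ht.2))
  have h2 := ((tendsto_norm_smoothing (u t)).pow 2).sub ((tendsto_norm_smoothing u₀).pow 2)
  simp only [hu.energy_balance (isEvenKernel_moll _) ht] at h2
  have h3 := tendsto_nhds_unique h2 (h1.const_mul 2)
  linarith

theorem integral_norm_sq (v : L2Field) : ∫ x, ‖v x‖ ^ 2 = ‖v‖ ^ 2 := by
  rw [← real_inner_self_eq_norm_sq, L2.inner_def]
  simp only [real_inner_self_eq_norm_sq]

end Conservation

end EulerEnergy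

end

theorem corollary1p3 (P : EulerEnergy.DyadicPartition) (T : ℝ) (hT : 0 < T)
    (u₀ : EulerEnergy.L2Field) (u : ℝ → EulerEnergy.L2Field)
    (hu : EulerEnergy.IsWeakSolution T u₀ u)
    (p₁ p₂ p₃ : ℝ) (hp₁ : p₁ ∈ Ioc (1 : ℝ) 3) (hp₂ : p₂ ∈ Ioc (1 : ℝ) 3)
    (hp₃ : p₃ ∈ Ioc (1 : ℝ) 3)
    (h₁ : EulerEnergy.MemLpTime p₁ T
      (EulerEnergy.besovC P (1 / p₁) (ENNReal.ofReal (2 * p₁ / (p₁ - 1))))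
      (EulerEnergy.besovNorm P (1 / p₁) (ENNReal.ofReal (2 * p₁ / (p₁ - 1))))
      (fun t => EulerEnergy.component (u t) 0))
    (h₂ : EulerEnergy.MemLpTime p₂ T
      (EulerEnergy.besovC P (1 / p₂) (ENNReal.ofReal (2 * p₂ / (p₂ - 1))))
      (EulerEnergy.besovNorm P (1 / p₂) (ENNReal.ofReal (2 * p₂ / (p₂ - 1))))
      (fun t => EulerEnergy.component (u t) 1))
    (h₃ : EulerEnergy.MemLpTime p₃ T
      (EulerEnergy.besovInfty P (1 / p₃) (ENNReal.ofReal (2 * p₃ / (p₃ - 1))))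
      (EulerEnergy.besovNorm P (1 / p₃) (ENNReal.ofReal (2 * p₃ / (p₃ - 1))))
      (fun t => EulerEnergy.component (u t) 2)) :
    ∀ t ∈ Icc 0 T, (1 / 2 : ℝ) * ∫ x, ‖u t x‖ ^ 2 = (1 / 2 : ℝ) * ∫ x, ‖u₀ x‖ ^ 2 := by
  have h := EulerEnergy.tendsto_lintegral_enorm_flux P hu (p := ![p₁, p₂, p₃])
    (fun i => by fin_cases i; exacts [hp₁, hp₂, hp₃])
    (fun i => by fin_cases i; exacts [h₁, h₂, h₃])
  intro t ht
  rw [EulerEnergy.integral_norm_sq, EulerEnergy.integral_norm_sq,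
    EulerEnergy.norm_eq_of_tendsto_flux hu h ht]
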